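/- Let $M$ be an $n$-dimensional smooth manifold, $\mathcal TM=TM\setminus\{0\}$ its slashed tangent bundle, $J$ the vertical endomorphism and $C$ the Liouville vector field of $TM$ (locally $J=dx^i\otimes\partial/\partial y^i$, $C=y^i\,\partial/\partial y^i$). Let $S$ be a spray on $M$, that is, a smooth vector field on $\mathcal TM$ with $JS=C$ and $[C,S]=S$, and let $\Gamma=[J,S]$ be its connection, i.e. $\Gamma X=[JX,S]-J[X,S]$, $h=\frac12(I+\Gamma)$ the horizontal projector, $R=\frac12[h,h]$ the curvature and $\Phi=i_SR$ the Jacobi endomorphism (Frölicher–Nijenhuis brackets). For a smooth function $F$ put $\Omega=dd_JF$, where $d_JF(X)=(JX)F$, and consider the linear differential operator $$\mathcal P F=(\mathcal L_CF-F,\; i_\Gamma\Omega,\; i_\Phi\Omega).$$ For $m\ge 2$, the jet $j_m(F)_x$ is an $m$-th order solution of $\mathcal P$ at $x$ if the $(m-1)$-jet of $\mathcal L_CF-F$ and the $(m-2)$-jets of $i_\Gamma\Omega$ and $i_\Phi\Omega$ vanish at $x$. An eigenvector field of $\Phi$ near $x$ with eigenfunction $\lambda$ is a smooth horizontal vector field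 $X$ ($hX=X$) defined near $x$ such that $\Phi X=\lambda JX$, $\lambda$ being a smooth function. Let $x\in\mathcal TM$ and suppose that $\Phi$ has $n$ pairwise distinct eigenvalues near $x$: there are eigenvector fields $h_1,\dots,h_n$ near $x$, nonzero at $x$, with eigenfunctions $\lambda_1,\dots,\lambda_n$ pairwise distinct at $x$, one of the $h_i$ being $S$. Put $v_i=Jh_i$. For vector fields $A,B,D$ write $$\sum_{cycl}\Omega([A,B],D)=\Omega([A,B],D)+\Omega([B,D],A)+\Omega([D,A],B).$$ Then a third-order solution $j_3(F)_x$ of $\mathcal P$ at $x$ can be lifted to a fourth-order solution (there is a fourth-order solution $j_4(G)_x$ with $j_3(G)_x=j_3(F)_x$) if and only if (a) the prolonged first compatibility condition holds at $x$: the $1$-jets at $x$ of $i_R\Omega$, of $i_{[\Phi,\Phi]}\Omega$ and of the functions $\sum_{cycl}\Omega([v_i,h_j],h_k)$ ($i,j,k$ pairwise different) vanish; and (b) for any two eigenvector fields $X,Y$ of $\Phi$ near $x$ whose eigenvalues at $x$ are different, one has at $x$ $$\begin{aligned} [hX,\Phi X]\,\Omega(JY,Y)-[hY,\Phi Y]\,\Omega(X,JX)={}&\Phi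 X\Big(\sum_{cycl}\Omega([JY,hX],hY)\Big)\\ &-hX\Big(\sum_{cycl}\Omega([JY,\Phi X],hY)-\sum_{cycl}\Omega([JY,\Phi Y],X)\Big)\\ &-\Phi Y\Big(\sum_{cycl}\Omega([JX,hX],hY)\Big)\\ &+hY\Big(\sum_{cycl}\Omega([JX,\Phi X],Y)-\sum_{cycl}\Omega([JX,\Phi Y],X)\Big). \end{aligned}$$ -/

import Mathlib

open Set Filter Topology Bundle
open scoped Manifold ContDiff

noncomputable section

namespace Rapcsak

/-- The tangent bundle `TM` of an `n`-dimensional manifold. -/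
abbrev TM (n : ℕ) (M : Type*) [TopologicalSpace M] [ChartedSpace (EuclideanSpace ℝ (Fin n)) M]
    [IsManifold (𝓡 n) ∞ M] : Type _ :=
  TangentBundle (𝓡 n) M

/-- (Not necessarily smooth) vector fields on the manifold `TM`. -/
abbrev VF (n : ℕ) (M : Type*) [TopologicalSpace M] [ChartedSpace (EuclideanSpace ℝ (Fin n)) M]
    [IsManifold (𝓡 n) ∞ M] : Type _ :=
  (p : TM n M) → TangentSpace (𝓡 n).tangent p

variable {n : ℕ} {M : Type*} [TopologicalSpace M] [ChartedSpace (EuclideanSpace ℝ (Fin n)) M]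
  [IsManifold (𝓡 n) ∞ M]

/-- The slashed tangent bundle: nonzero tangent vectors. -/
def slashed (n : ℕ) (M : Type*) [TopologicalSpace M] [ChartedSpace (EuclideanSpace ℝ (Fin n)) M]
    [IsManifold (𝓡 n) ∞ M] : Set (TM n M) :=
  {p | p.snd ≠ 0}

/-- `X` is a smooth vector field on the set `U`. -/
def SmoothFieldOn (X : VF n M) (U : Set (TM n M)) : Prop :=
  ContMDiffOn (𝓡 n).tangent (𝓡 n).tangent.tangent ∞
    (fun p => (⟨p, X p⟩ : TangentBundle (𝓡 n).tangent (TM n M))) U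

/-- `X` is a smooth vector field on a neighbourhood of `x`. -/
def SmoothFieldNear (X : VF n M) (x : TM n M) : Prop :=
  ∃ U ∈ 𝓝 x, SmoothFieldOn X U

/-- `f` is a smooth function on a neighbourhood of `x`. -/
def SmoothNear (f : TM n M → ℝ) (x : TM n M) : Prop :=
  ∃ U ∈ 𝓝 x, ContMDiffOn (𝓡 n).tangent 𝓘(ℝ, ℝ) ∞ f U

/-- The Lie bracket of vector fields on `TM`. -/
def br (X Y : VF n M) : VF n M := VectorField.mlieBracket (𝓡 n).tangent X Y

/-- The derivative `X f` of a function along a vector field. -/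
def act (X : VF n M) (f : TM n M → ℝ) : TM n M → ℝ :=
  fun p => mfderiv (𝓡 n).tangent 𝓘(ℝ, ℝ) f p (X p)

/-- The vertical lift of `w ∈ T_{π p} M` to `T_p TM`: the velocity at `t = 0` of `t ↦ p + t w`. -/
def vertLift (p : TM n M) (w : TangentSpace (𝓡 n) p.proj) : TangentSpace (𝓡 n).tangent p :=
  mfderiv 𝓘(ℝ, ℝ) (𝓡 n).tangent (fun t : ℝ => (⟨p.proj, p.snd + t • w⟩ : TM n M)) 0 (1 : ℝ)

/-- The vertical endomorphism `J = dx^i ⊗ ∂/∂y^i`: the vertical lift of the projection. -/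
def J (X : VF n M) : VF n M :=
  fun p => vertLift p (mfderiv (𝓡 n).tangent (𝓡 n) (fun q : TM n M => q.proj) p (X p))

/-- The Liouville vector field `C = y^i ∂/∂y^i`. -/
def liouville : VF n M := fun p => vertLift p p.snd

/-- A spray: a smooth vector field `S` on the slashed tangent bundle with `J S = C` and
`[C, S] = S`. (The values of `S` on the zero section are irrelevant.) -/
structure IsSpray (S : VF n M) : Prop where
  smooth : SmoothFieldOn S (slashed n M)
  second_order : ∀ p ∈ slashed n M, J S p = liouville p
  homogeneous : ∀ p ∈ slashed n M, br liouville S p = S p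

/-- The Frölicher–Nijenhuis bracket `[K, S]` of a vector valued 1-form and a vector field. -/
def fnField (K : VF n M → VF n M) (S X : VF n M) : VF n M :=
  br (K X) S - K (br X S)

/-- The Frölicher–Nijenhuis bracket `[K, K]` of a vector valued 1-form with itself. -/
def fnSelf (K : VF n M → VF n M) (X Y : VF n M) : VF n M :=
  (2 : ℝ) • (br (K X) (K Y) + K (K (br X Y)) - K (br (K X) Y) - K (br X (K Y)))

/-- The connection `Γ = [J, S]` of the spray. -/
def conn (S : VF n M) (X : VF n M) : VF n M := fnField J S X

/-- The horizontal projector `h = (I + Γ) / 2`. -/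
def hor (S : VF n M) (X : VF n M) : VF n M := (1 / 2 : ℝ) • (X + conn S X)

/-- The curvature `R = [h, h] / 2`. -/
def curv (S : VF n M) (X Y : VF n M) : VF n M := (1 / 2 : ℝ) • fnSelf (hor S) X Y

/-- The Jacobi endomorphism `Φ = i_S R`. -/
def jacobi (S : VF n M) (X : VF n M) : VF n M := curv S S X

/-- The 2-form `Ω = d d_J F`, where `(d_J F)(X) = (J X) F`, evaluated on vector fields. -/
def Om (F : TM n M → ℝ) (X Y : VF n M) : TM n M → ℝ :=
  act X (act (J Y) F) - act Y (act (J X) F) - act (J (br X Y)) F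

/-- `i_K Ω` for a vector valued 1-form `K`. -/
def ins1 (F : TM n M → ℝ) (K : VF n M → VF n M) (X Y : VF n M) : TM n M → ℝ :=
  Om F (K X) Y + Om F X (K Y)

/-- `i_L Ω` for a vector valued 2-form `L`. -/
def ins2 (F : TM n M → ℝ) (L : VF n M → VF n M → VF n M) (X Y Z : VF n M) : TM n M → ℝ :=
  Om F (L X Y) Z + Om F (L Y Z) X + Om F (L Z X) Y

/-- The cyclic sum `Ω([X, Y], Z) + Ω([Y, Z], X) + Ω([Z, X], Y)`. -/
def cyc (F : TM n M → ℝ) (X Y Z : VF n M) : TM n M → ℝ :=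
  Om F (br X Y) Z + Om F (br Y Z) X + Om F (br Z X) Y

/-- The `k`-jet of the function `f` at `x` vanishes. -/
def JetVanishes (k : ℕ) (f : TM n M → ℝ) (x : TM n M) : Prop :=
  ∀ j ≤ k, iteratedFDeriv ℝ j (f ∘ (extChartAt (𝓡 n).tangent x).symm)
    (extChartAt (𝓡 n).tangent x x) = 0

/-- The `k`-jets at `x` of two functions agree. -/
def SameJet (k : ℕ) (f g : TM n M → ℝ) (x : TM n M) : Prop := JetVanishes k (f - g) x

/-- The `(l + 2)`-jet of `F` at `x` is a solution of order `l + 2` of the second order operator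
`P = (F ↦ C F - F, F ↦ i_Γ Ω, F ↦ i_Φ Ω)`: it lies in the kernel of the `l`-th prolongation of `P`,
where `C F - F` is of first order. A `k`-jet of a form vanishes iff the `k`-jets of all its
values on smooth vector fields do. -/
structure IsFormalSolution (S : VF n M) (l : ℕ) (F : TM n M → ℝ) (x : TM n M) : Prop where
  homogeneity : JetVanishes (l + 1) (act liouville F - F) x
  connection : ∀ X Y : VF n M, SmoothFieldNear X x → SmoothFieldNear Y x →
    JetVanishes l (ins1 F (conn S) X Y) x
  curvature : ∀ X Y : VF n M, SmoothFieldNear X x → SmoothFieldNear Y x →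
    JetVanishes l (ins1 F (jacobi S) X Y) x

/-- Near `x`, `X` is a smooth horizontal field with `Φ X = lam J X`, `lam` smooth. -/
structure IsEigenfield (S : VF n M) (x : TM n M) (lam : TM n M → ℝ) (X : VF n M) : Prop where
  smooth : SmoothFieldNear X x
  smooth_eigenfunction : SmoothNear lam x
  horizontal : ∀ᶠ p in 𝓝 x, hor S X p = X p
  eigen : ∀ᶠ p in 𝓝 x, jacobi S X p = lam p • J X p

/-- Adapted frame at `x`: `n` eigenvector fields of `Φ` near `x`, nonzero at `x`, whose eigenvalues
at `x` (hence near `x`) are pairwise distinct, one of them being the spray itself. -/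
structure IsAdaptedFrame (S : VF n M) (x : TM n M) (lam : Fin n → TM n M → ℝ)
    (e : Fin n → VF n M) : Prop where
  eigenfield : ∀ i, IsEigenfield S x (lam i) (e i)
  ne_zero : ∀ i, e i x ≠ 0
  distinct : ∀ i j, i ≠ j → lam i x ≠ lam j x
  spray : ∃ o, ∀ᶠ p in 𝓝 x, e o p = S p

/-- The prolongation at `x` of the first compatibility condition
`i_R Ω = 0`, `i_{[Φ, Φ]} Ω = 0`, `Ω([v_i, h_j], h_k) + cyclic = 0` (`i, j, k` distinct,
`v_i = J h_i`): these expressions vanish at `x` together with their first derivatives. -/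
structure ProlongedFirstCondition (S : VF n M) (e : Fin n → VF n M) (F : TM n M → ℝ)
    (x : TM n M) : Prop where
  curv_cond : ∀ X Y Z : VF n M, SmoothFieldNear X x → SmoothFieldNear Y x → SmoothFieldNear Z x →
    JetVanishes 1 (ins2 F (curv S) X Y Z) x
  jacobi_cond : ∀ X Y Z : VF n M, SmoothFieldNear X x → SmoothFieldNear Y x → SmoothFieldNear Z x →
    JetVanishes 1 (ins2 F (fnSelf (jacobi S)) X Y Z) x
  frame_cond : ∀ i j k, i ≠ j → j ≠ k → i ≠ k → JetVanishes 1 (cyc F (J (e i)) (e j) (e k)) x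

/-- The third order condition at `x` for the horizontal fields `X`, `Y`. -/
def ThirdOrderIdentity (S : VF n M) (F : TM n M → ℝ) (X Y : VF n M) (x : TM n M) : Prop :=
  act (br (hor S X) (jacobi S X)) (Om F (J Y) Y) x
      - act (br (hor S Y) (jacobi S Y)) (Om F X (J X)) x =
    act (jacobi S X) (cyc F (J Y) (hor S X) (hor S Y)) x
      - act (hor S X) (cyc F (J Y) (jacobi S X) (hor S Y) - cyc F (J Y) (jacobi S Y) X) x
      - act (jacobi S Y) (cyc F (J X) (hor S X) (hor S Y)) x
      + act (hor S Y) (cyc F (J X) (jacobi S X) Y - cyc F (J X) (jacobi S Y) X) x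

end Rapcsak

end

/-!
Germs at `x` of smooth functions and of smooth vector fields form a Lie–Rinehart pair `(A, L)`, in
which every object attached to the spray has a purely algebraic counterpart. All jet conditions
become the vanishing at `x` of iterated derivatives along elements of `L`.

On a second-order solution, `i_[J, Φ] Ω = 3 i_R Ω` and `i_[Φ, Φ] Ω` are combinations of the first
derivatives of `i_Φ Ω`. For eigenvector fields with different eigenvalues, `i_Γ Ω = 0` and
`i_Φ Ω = 0` say that `Ω(X, Y) = 0` and `Ω(JX, Y) = 0`. The third order condition is then
`(JX)(JY) Ω(X, Y) + (JX)Y Ω(JX, Y) - X(JY) Ω(JX, Y) = 0` up to the nonzero difference of the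
eigenvalues, so that both conditions are necessary.

Conversely, correcting `F` to a fourth-order solution amounts to finding a symmetric quartic form
in the frame `h_i`, `v_i = J h_i` with prescribed contraction with `C = v_o`, where `h_o = S`,
prescribed components in `(v_i, v_j)` for `i ≠ j`, and prescribed antisymmetrizations in
`(h_i, v_j)`. The components of such a form satisfy linear relations; the first compatibility
condition provides those with three different indices, the third order condition the one for each
pair `i ≠ j`, and these relations are sufficient. A function with a prescribed leading part exists
because the frame has a dual system of functions.
-/

noncomputable section

namespace Rapcsak

section FormInsertion

variable {A L : Type*} [CommRing A] [AddCommGroup L] [Module A L]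

/-- The derivation `i_K` for an endomorphism `K`, on 2-forms. -/
def insertOne (β : L →ₗ[A] L →ₗ[A] A) (K : L →ₗ[A] L) : L →ₗ[A] L →ₗ[A] A :=
  β.comp K + β.compl₂ K

theorem insertOne_apply (β : L →ₗ[A] L →ₗ[A] A) (K : L →ₗ[A] L) (X Y : L) :
    insertOne β K X Y = β (K X) Y + β X (K Y) := rfl

/-- The derivation `i_R` for a vector valued 2-form `R`, on 2-forms. -/
def insertTwo (β : L →ₗ[A] L →ₗ[A] A) (R : L →ₗ[A] L →ₗ[A] L) (X Y Z : L) : A :=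
  β (R X Y) Z + β (R Y Z) X + β (R Z X) Y

/-- The derivation `i_K` for an endomorphism `K`, on 3-forms. -/
def insertThree (η : L → L → L → A) (K : L →ₗ[A] L) (X Y Z : L) : A :=
  η (K X) Y Z + η X (K Y) Z + η X Y (K Z)

end FormInsertion

section ExteriorCalculus

variable {A L : Type*} [CommRing A] [LieRing L] [Module A L] [LieRingModule L A]

/-- The cyclic sum of `β([X, Y], Z)`. -/
def lieCyclic (β : L →ₗ[A] L →ₗ[A] A) (X Y Z : L) : A :=
  β ⁅X, Y⁆ Z + β ⁅Y, Z⁆ X + β ⁅Z, X⁆ Y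

/-- The exterior derivative of a 2-form `β`. -/
def extDerivTwo (β : L →ₗ[A] L →ₗ[A] A) (X Y Z : L) : A :=
  ⁅X, β Y Z⁆ + ⁅Y, β Z X⁆ + ⁅Z, β X Y⁆ - lieCyclic β X Y Z

theorem extDerivTwo_rotate (β : L →ₗ[A] L →ₗ[A] A) (X Y Z : L) :
    extDerivTwo β X Y Z = extDerivTwo β Y Z X := by
  simp only [extDerivTwo, lieCyclic]
  ring

variable [LieRinehartRing A L]

theorem lie_one_eq_zero (X : L) : ⁅X, (1 : A)⁆ = 0 := by
  simpa using LieRinehartRing.leibniz_mul_right X (1 : A) 1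

theorem lie_ite_one_zero (X : L) (p : Prop) [Decidable p] : ⁅X, if p then (1 : A) else 0⁆ = 0 := by
  split_ifs
  exacts [lie_one_eq_zero X, lie_zero X]

theorem smul_lie_eq_sub (a : A) (X Y : L) : ⁅a • X, Y⁆ = a • ⁅X, Y⁆ - ⁅Y, a⁆ • X := by
  rw [← lie_skew, LieRinehartRing.leibniz_smul_right, ← lie_skew X Y]
  module

/-- The differential of a function, the 1-form `X ↦ X f`. -/
def differential (f : A) : L →ₗ[A] A where
  toFun X := ⁅X, f⁆
  map_add' X Y := add_lie X Y f
  map_smul' _ _ := LieRinehartRing.lie_smul_eq_mul ..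

/-- The exterior derivative of a 1-form, `dα(X, Y) = X (α Y) - Y (α X) - α [X, Y]`. -/
def extDerivOne (α : L →ₗ[A] A) : L →ₗ[A] L →ₗ[A] A :=
  LinearMap.mk₂ A (fun X Y => ⁅X, α Y⁆ - ⁅Y, α X⁆ - α ⁅X, Y⁆)
    (fun X X' Y => by simp only [add_lie, lie_add, map_add]; abel)
    (fun a X Y => by simp [smul_lie_eq_sub]; ring)
    (fun X Y Y' => by simp only [add_lie, lie_add, map_add]; abel)
    (fun a X Y => by simp [LieRinehartRing.leibniz_smul_right]; ring)

theorem extDerivOne_apply (α : L →ₗ[A] A) (X Y : L) :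
    extDerivOne α X Y = ⁅X, α Y⁆ - ⁅Y, α X⁆ - α ⁅X, Y⁆ := rfl

theorem extDerivOne_swap (α : L →ₗ[A] A) (X Y : L) :
    extDerivOne α X Y = -extDerivOne α Y X := by
  rw [extDerivOne_apply, extDerivOne_apply, ← lie_skew X Y, map_neg]
  ring

theorem extDerivTwo_extDerivOne (α : L →ₗ[A] A) (X Y Z : L) :
    extDerivTwo (extDerivOne α) X Y Z = 0 := by
  have jacobi : α ⁅⁅X, Y⁆, Z⁆ + α ⁅⁅Y, Z⁆, X⁆ + α ⁅⁅Z, X⁆, Y⁆ = 0 := by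
    have h := congrArg α (lie_jacobi X Y Z)
    rw [← lie_skew X ⁅Y, Z⁆, ← lie_skew Y ⁅Z, X⁆, ← lie_skew Z ⁅X, Y⁆] at h
    simp only [map_add, map_neg, map_zero] at h
    linear_combination -h
  simp only [extDerivTwo, lieCyclic, extDerivOne_apply, lie_sub, lie_lie X Y (α Z),
    lie_lie Y Z (α X), lie_lie Z X (α Y)]
  linear_combination jacobi

/-- The Frölicher–Nijenhuis bracket `[K, N]` of two endomorphisms. -/
def fnBracket (K N : L →ₗ[A] L) : L →ₗ[A] L →ₗ[A] L :=
  LinearMap.mk₂ A (fun X Y => ⁅K X, N Y⁆ + ⁅N X, K Y⁆ + K (N ⁅X, Y⁆) + N (K ⁅X, Y⁆)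
      - K ⁅N X, Y⁆ - K ⁅X, N Y⁆ - N ⁅K X, Y⁆ - N ⁅X, K Y⁆)
    (fun X X' Y => by simp only [add_lie, map_add]; abel)
    (fun a X Y => by simp only [smul_lie_eq_sub, map_sub, map_smul]; module)
    (fun X Y Y' => by simp only [lie_add, map_add]; abel)
    (fun a X Y => by
      simp only [LieRinehartRing.leibniz_smul_right, map_add, map_smul]; module)

theorem fnBracket_apply (K N : L →ₗ[A] L) (X Y : L) : fnBracket K N X Y =
    ⁅K X, N Y⁆ + ⁅N X, K Y⁆ + K (N ⁅X, Y⁆) + N (K ⁅X, Y⁆)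
      - K ⁅N X, Y⁆ - K ⁅X, N Y⁆ - N ⁅K X, Y⁆ - N ⁅X, K Y⁆ := rfl

theorem fnBracket_swap (K N : L →ₗ[A] L) (X Y : L) : fnBracket K N X Y = -fnBracket K N Y X := by
  simp only [fnBracket_apply]
  rw [← lie_skew (K X) (N Y), ← lie_skew (N X) (K Y), ← lie_skew X Y, ← lie_skew (N X) Y,
    ← lie_skew X (N Y), ← lie_skew (K X) Y, ← lie_skew X (K Y)]
  simp only [map_neg]
  abel

theorem insertTwo_fnBracket {β : L →ₗ[A] L →ₗ[A] A} {K N : L →ₗ[A] L}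
    (closed : ∀ X Y Z, extDerivTwo β X Y Z = 0)
    (hKN : ∀ X, K (N X) = 0) (hNK : ∀ X, N (K X) = 0)
    (hβ : ∀ X Y, β (K X) (N Y) = 0) (hβ' : ∀ X Y, β (N X) (K Y) = 0) (X Y Z : L) :
    insertTwo β (fnBracket K N) X Y Z =
      insertThree (extDerivTwo (insertOne β N)) K X Y Z +
        insertThree (extDerivTwo (insertOne β K)) N X Y Z := by
  have h₁ := closed (K X) (N Y) Z
  have h₂ := closed (N X) (K Y) Z
  have h₃ := closed X (K Y) (N Z)
  have h₄ := closed X (N Y) (K Z)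
  have h₅ := closed (N X) Y (K Z)
  have h₆ := closed (K X) Y (N Z)
  simp only [extDerivTwo, lieCyclic, hβ, hβ', lie_zero] at h₁ h₂ h₃ h₄ h₅ h₆
  simp only [insertTwo, insertThree, fnBracket_apply, extDerivTwo, lieCyclic, insertOne_apply, hKN,
    hNK, hβ, hβ', map_add, map_sub, map_zero, LinearMap.add_apply, LinearMap.sub_apply,
    LinearMap.zero_apply, lie_add, lie_zero]
  linear_combination -h₁ - h₂ - h₃ - h₄ - h₅ - h₆

end ExteriorCalculus

/-- Fibred coordinates `x i`, `y i` with their coordinate fields `px i`, `py i`, and a spray `S`,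
in a Lie–Rinehart pair: `A` plays the role of the ring of functions near a point of the slashed
tangent bundle and `L` that of the vector fields. -/
structure SprayAlgebra (ι A L : Type*) [Fintype ι] [DecidableEq ι] [CommRing A] [LieRing L]
    [Module A L] [LieRingModule L A] where
  x : ι → A
  y : ι → A
  px : ι → L
  py : ι → L
  px_x : ∀ i j, ⁅px i, x j⁆ = if i = j then 1 else 0
  px_y : ∀ i j, ⁅px i, y j⁆ = 0
  py_x : ∀ i j, ⁅py i, x j⁆ = 0
  py_y : ∀ i j, ⁅py i, y j⁆ = if i = j then 1 else 0
  decomp : ∀ X : L, X = ∑ i, ⁅X, x i⁆ • px i + ∑ i, ⁅X, y i⁆ • py i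
  S : L
  S_x : ∀ i, ⁅S, x i⁆ = y i
  homogeneous : ⁅∑ i, y i • py i, S⁆ = S

namespace SprayAlgebra

variable {ι A L : Type*} [Fintype ι] [DecidableEq ι] [CommRing A] [LieRing L] [Module A L]
  [LieRingModule L A]

theorem ext_coord {T : SprayAlgebra ι A L} {X Y : L} (hx : ∀ i, ⁅X, T.x i⁆ = ⁅Y, T.x i⁆)
    (hy : ∀ i, ⁅X, T.y i⁆ = ⁅Y, T.y i⁆) : X = Y := by
  rw [T.decomp X, T.decomp Y]
  simp only [hx, hy]

theorem linearMap_ext (T : SprayAlgebra ι A L) {N : Type*} [AddCommMonoid N] [Module A N]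
    {f g : L →ₗ[A] N} (hx : ∀ i, f (T.px i) = g (T.px i)) (hy : ∀ i, f (T.py i) = g (T.py i)) :
    f = g := by
  ext X
  rw [T.decomp X]
  simp only [map_add, map_sum, map_smul, hx, hy]

variable (T : SprayAlgebra ι A L)

/-- The Liouville field. -/
def C : L := ∑ i, T.y i • T.py i

theorem C_lie_S : ⁅T.C, T.S⁆ = T.S := T.homogeneous

variable [LieRinehartRing A L]

section VerticalEndomorphism

/-- The vertical endomorphism. -/
def J : L →ₗ[A] L where
  toFun X := ∑ i, ⁅X, T.x i⁆ • T.py i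
  map_add' X Y := by simp only [add_lie, add_smul, Finset.sum_add_distrib]
  map_smul' a X := by
    simp only [LieRinehartRing.lie_smul_eq_mul, mul_smul, Finset.smul_sum, RingHom.id_apply]

theorem J_apply (X : L) : T.J X = ∑ i, ⁅X, T.x i⁆ • T.py i := rfl

theorem J_lie_x (X : L) (i : ι) : ⁅T.J X, T.x i⁆ = 0 := by
  simp [J_apply, sum_lie, T.py_x]

theorem J_lie_y (X : L) (i : ι) : ⁅T.J X, T.y i⁆ = ⁅X, T.x i⁆ := by
  simp [J_apply, sum_lie, T.py_y]

theorem C_lie_x (i : ι) : ⁅T.C, T.x i⁆ = 0 := by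
  simp [C, sum_lie, T.py_x]

theorem C_lie_y (i : ι) : ⁅T.C, T.y i⁆ = T.y i := by
  simp [C, sum_lie, T.py_y]

theorem J_J (X : L) : T.J (T.J X) = 0 := by
  simp [J_apply T (T.J X), J_lie_x]

theorem J_S : T.J T.S = T.C := by
  simp [J_apply, C, T.S_x]

theorem J_C : T.J T.C = 0 := by rw [← J_S, J_J]

theorem J_lie_J (X Y : L) : ⁅T.J X, T.J Y⁆ = T.J ⁅T.J X, Y⁆ + T.J ⁅X, T.J Y⁆ := by
  refine T.ext_coord (fun i => ?_) (fun i => ?_) <;>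
    simp [add_lie, lie_lie, J_lie_x, J_lie_y]
  abel

theorem C_lie_J (X : L) : ⁅T.C, T.J X⁆ = T.J ⁅T.C, X⁆ - T.J X := by
  refine T.ext_coord (fun i => ?_) (fun i => ?_) <;>
    simp [sub_lie, lie_lie, J_lie_x, J_lie_y, C_lie_x, C_lie_y]

theorem J_lie_J_S (X : L) : T.J ⁅T.J X, T.S⁆ = T.J X := by
  refine T.ext_coord (fun i => ?_) (fun i => ?_) <;>
    simp [lie_lie, J_lie_x, J_lie_y, T.S_x]

theorem exists_eq_J_of_J_eq_zero {X : L} (h : T.J X = 0) : ∃ Y, X = T.J Y := by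
  refine ⟨∑ i, ⁅X, T.y i⁆ • T.px i, T.ext_coord (fun i => ?_) (fun i => ?_)⟩
  · rw [J_lie_x, ← J_lie_y, h, zero_lie]
  · simp [J_lie_y, sum_lie, T.px_x]

/-- The connection `Γ = [J, S]`. -/
def conn : L →ₗ[A] L where
  toFun X := ⁅T.J X, T.S⁆ - T.J ⁅X, T.S⁆
  map_add' X Y := by simp only [map_add, add_lie]; abel
  map_smul' a X := by
    simp only [map_smul, smul_lie_eq_sub, map_sub, RingHom.id_apply]; module

theorem conn_apply (X : L) : T.conn X = ⁅T.J X, T.S⁆ - T.J ⁅X, T.S⁆ := rfl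

theorem conn_J (X : L) : T.conn (T.J X) = -T.J X := by
  rw [conn_apply, J_J, J_lie_J_S, zero_lie, zero_sub]

theorem J_conn (X : L) : T.J (T.conn X) = T.J X := by
  rw [conn_apply, map_sub, J_lie_J_S, J_J, sub_zero]

theorem conn_conn (X : L) : T.conn (T.conn X) = X := by
  obtain ⟨Y, hY⟩ := T.exists_eq_J_of_J_eq_zero (X := X - T.conn X)
    (by rw [map_sub, J_conn, sub_self])
  have h : T.conn (X - T.conn X) = -(X - T.conn X) := by rw [hY, conn_J]
  rw [map_sub, neg_sub] at h
  exact sub_right_injective h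

theorem conn_S : T.conn T.S = T.S := by
  rw [conn_apply, J_S, C_lie_S, lie_self, map_zero, sub_zero]

theorem conn_C_lie (X : L) : T.conn ⁅T.C, X⁆ = ⁅T.C, T.conn X⁆ := by
  rw [conn_apply, conn_apply, lie_sub, C_lie_J, leibniz_lie T.C (T.J X), C_lie_J,
    leibniz_lie T.C X, C_lie_S, sub_lie, map_add]
  abel

end VerticalEndomorphism

section CanonicalTwoForm

/-- The 1-form `d_J F`. -/
def dJ (F : A) : L →ₗ[A] A := (differential F).comp T.J

/-- The 2-form `Ω = d d_J F`. -/
def Om (F : A) : L →ₗ[A] L →ₗ[A] A := extDerivOne (T.dJ F)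

theorem Om_apply (F : A) (X Y : L) :
    T.Om F X Y = ⁅X, ⁅T.J Y, F⁆⁆ - ⁅Y, ⁅T.J X, F⁆⁆ - ⁅T.J ⁅X, Y⁆, F⁆ := rfl

variable (F G : A) (X Y Z : L)

theorem Om_swap : T.Om F X Y = -T.Om F Y X := extDerivOne_swap _ X Y

theorem extDerivTwo_Om : extDerivTwo (T.Om F) X Y Z = 0 := extDerivTwo_extDerivOne _ X Y Z

theorem lieCyclic_Om : lieCyclic (T.Om F) X Y Z =
    ⁅X, T.Om F Y Z⁆ + ⁅Y, T.Om F Z X⁆ + ⁅Z, T.Om F X Y⁆ :=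
  (sub_eq_zero.mp (T.extDerivTwo_Om F X Y Z)).symm

theorem Om_add_fun : T.Om (F + G) X Y = T.Om F X Y + T.Om G X Y := by
  simp only [Om_apply, lie_add]
  ring

theorem Om_sub_fun : T.Om (F - G) X Y = T.Om F X Y - T.Om G X Y := by
  simp only [Om_apply, lie_sub]
  ring

theorem Om_J_symm : T.Om F (T.J X) Y = T.Om F (T.J Y) X := by
  have h := congrArg (fun Z => ⁅Z, F⁆) (T.J_lie_J X Y)
  simp only [add_lie, lie_lie (T.J X)] at h
  simp only [Om_apply, J_J, zero_lie, lie_zero]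
  rw [← lie_skew (T.J Y) X, map_neg, neg_lie]
  linear_combination h

theorem Om_J_right : T.Om F X (T.J Y) = -T.Om F (T.J X) Y := by
  rw [Om_swap, Om_J_symm]

theorem Om_J_J : T.Om F (T.J X) (T.J Y) = 0 := by
  rw [Om_J_right, J_J, map_zero, LinearMap.zero_apply, neg_zero]

theorem insertOne_Om_J : insertOne (T.Om F) T.J = 0 := by
  ext X Y
  simp [insertOne_apply, Om_J_right]

theorem Om_C : T.Om F T.C X = ⁅T.J X, ⁅T.C, F⁆ - F⁆ := by
  have h := congrArg (fun Z => ⁅Z, F⁆) (T.C_lie_J X)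
  simp only [sub_lie, lie_lie T.C (T.J X)] at h
  simp only [Om_apply, J_C, zero_lie, lie_zero, lie_sub]
  linear_combination h

end CanonicalTwoForm

section CoordinateFields

theorem J_px (i : ι) : T.J (T.px i) = T.py i := by
  refine T.ext_coord (fun j => ?_) (fun j => ?_) <;>
    simp [J_lie_x, J_lie_y, T.px_x, T.py_x, T.py_y]

theorem J_py (i : ι) : T.J (T.py i) = 0 := by rw [← J_px, J_J]

theorem py_lie_px (i j : ι) : ⁅T.py i, T.px j⁆ = 0 := by
  refine T.ext_coord (fun k => ?_) (fun k => ?_) <;>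
    simp [lie_lie, T.px_x, T.px_y, T.py_x, T.py_y, lie_ite_one_zero]

theorem px_lie_py (i j : ι) : ⁅T.px i, T.py j⁆ = 0 := by
  rw [← lie_skew, py_lie_px, neg_zero]

theorem py_lie_py (i j : ι) : ⁅T.py i, T.py j⁆ = 0 := by
  refine T.ext_coord (fun k => ?_) (fun k => ?_) <;>
    simp [lie_lie, T.py_x, T.py_y, lie_ite_one_zero]

theorem C_lie_px (i : ι) : ⁅T.C, T.px i⁆ = 0 := by
  refine T.ext_coord (fun k => ?_) (fun k => ?_) <;>
    simp [lie_lie, T.px_x, T.px_y, C_lie_x, C_lie_y, lie_ite_one_zero]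

theorem J_px_lie_J (i : ι) (X : L) : T.J ⁅T.px i, T.J X⁆ = 0 := by
  refine T.ext_coord (fun k => ?_) (fun k => ?_) <;>
    simp [lie_lie, J_lie_x, J_lie_y, T.px_x, lie_ite_one_zero]

theorem J_py_lie_J (i : ι) (X : L) : T.J ⁅T.py i, T.J X⁆ = 0 := by
  rw [← J_px, J_lie_J, map_add, J_J, J_J, add_zero]

theorem J_px_lie_S (i : ι) : T.J ⁅T.px i, T.S⁆ = 0 := by
  refine T.ext_coord (fun k => ?_) (fun k => ?_) <;>
    simp [lie_lie, J_lie_x, J_lie_y, T.S_x, T.px_x, T.px_y, lie_ite_one_zero]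

end CoordinateFields

variable [Algebra ℝ A] [LieAlgebra ℝ L] [LieRinehartAlgebra ℝ A L]

section Curvature

/-- The horizontal projector `h = (I + Γ) / 2`. -/
def hor : L →ₗ[A] L := (1 / 2 : ℝ) • (LinearMap.id + T.conn)

theorem hor_apply (X : L) : T.hor X = (1 / 2 : ℝ) • (X + T.conn X) := rfl

theorem conn_hor (X : L) : T.conn (T.hor X) = T.hor X := by
  rw [hor_apply, LinearMap.map_smul_of_tower, map_add, conn_conn, add_comm]

theorem hor_eq_self_of_conn {X : L} (h : T.conn X = X) : T.hor X = X := by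
  rw [hor_apply, h]
  module

theorem hor_hor (X : L) : T.hor (T.hor X) = T.hor X := T.hor_eq_self_of_conn (T.conn_hor X)

theorem hor_S : T.hor T.S = T.S := T.hor_eq_self_of_conn T.conn_S

theorem hor_J (X : L) : T.hor (T.J X) = 0 := by
  rw [hor_apply, conn_J, add_neg_cancel, smul_zero]

theorem J_hor (X : L) : T.J (T.hor X) = T.J X := by
  rw [hor_apply, LinearMap.map_smul_of_tower, map_add, J_conn]
  module

theorem exists_sub_hor_eq_J (X : L) : ∃ Y, X - T.hor X = T.J Y :=
  T.exists_eq_J_of_J_eq_zero (by rw [map_sub, J_hor, sub_self])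

theorem C_lie_hor (X : L) : ⁅T.C, T.hor X⁆ = T.hor ⁅T.C, X⁆ := by
  rw [hor_apply, hor_apply, lie_smul, lie_add, conn_C_lie]

/-- The curvature `R = [h, h] / 2`. -/
def curv : L →ₗ[A] L →ₗ[A] L := (1 / 2 : ℝ) • fnBracket T.hor T.hor

theorem curv_apply (X Y : L) : T.curv X Y = (1 / 2 : ℝ) • fnBracket T.hor T.hor X Y := rfl

theorem curv_swap (X Y : L) : T.curv X Y = -T.curv Y X := by
  rw [curv_apply, fnBracket_swap, smul_neg, curv_apply]

theorem curv_eq (X Y : L) : T.curv X Y = ⁅T.hor X, T.hor Y⁆ - T.hor ⁅T.hor X, T.hor Y⁆ := by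
  obtain ⟨X', hX⟩ := T.exists_sub_hor_eq_J X
  obtain ⟨Y', hY⟩ := T.exists_sub_hor_eq_J Y
  have vertical : T.hor ⁅X - T.hor X, Y - T.hor Y⁆ = 0 := by
    rw [hX, hY, J_lie_J, map_add, hor_J, hor_J, add_zero]
  simp only [lie_sub, sub_lie, map_sub] at vertical
  simp only [curv_apply, fnBracket_apply, hor_hor]
  linear_combination (norm := module) vertical

theorem J_curv (X Y : L) : T.J (T.curv X Y) = 0 := by
  rw [curv_eq, map_sub, J_hor, sub_self]

theorem curv_J_left (X Y : L) : T.curv (T.J X) Y = 0 := by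
  rw [curv_eq, hor_J, zero_lie, map_zero, sub_zero]

theorem curv_J_right (X Y : L) : T.curv X (T.J Y) = 0 := by
  rw [curv_swap, curv_J_left, neg_zero]

theorem Om_curv_J (F : A) (X Y Z : L) : T.Om F (T.curv X Y) (T.J Z) = 0 := by
  obtain ⟨W, hW⟩ := T.exists_eq_J_of_J_eq_zero (T.J_curv X Y)
  rw [hW, Om_J_J]

theorem Om_curv (F : A) (X Y Z : L) : T.Om F (T.curv X Y) Z =
    T.Om F ⁅T.hor X, T.hor Y⁆ (T.hor Z) - T.Om F (T.hor ⁅T.hor X, T.hor Y⁆) (T.hor Z) := by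
  obtain ⟨W, hW⟩ := T.exists_sub_hor_eq_J Z
  have h : T.Om F (T.curv X Y) (Z - T.hor Z) = 0 := by rw [hW, Om_curv_J]
  rw [map_sub, sub_eq_zero] at h
  rw [h, curv_eq, map_sub, LinearMap.sub_apply]

theorem insertTwo_Om_curv (F : A) (X Y Z : L) : insertTwo (T.Om F) T.curv X Y Z =
    extDerivTwo ((T.Om F).compl₁₂ T.hor T.hor) (T.hor X) (T.hor Y) (T.hor Z) := by
  have closed := T.lieCyclic_Om F (T.hor X) (T.hor Y) (T.hor Z)
  simp only [lieCyclic] at closed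
  simp only [insertTwo, Om_curv, extDerivTwo, lieCyclic, LinearMap.compl₁₂_apply, hor_hor]
  linear_combination closed

theorem insertOne_Om_conn_hor (F : A) (X Y : L) :
    insertOne (T.Om F) T.conn (T.hor X) (T.hor Y) = (2 : ℝ) • T.Om F (T.hor X) (T.hor Y) := by
  rw [insertOne_apply, conn_hor, conn_hor, two_smul]

end Curvature

section JacobiEndomorphism

/-- The Jacobi endomorphism `Φ = i_S R`. -/
def jacobi : L →ₗ[A] L := T.curv T.S

theorem J_jacobi (X : L) : T.J (T.jacobi X) = 0 := T.J_curv _ _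

theorem jacobi_J (X : L) : T.jacobi (T.J X) = 0 := T.curv_J_right _ _

theorem exists_jacobi_eq_J (X : L) : ∃ Y, T.jacobi X = T.J Y :=
  T.exists_eq_J_of_J_eq_zero (T.J_jacobi X)

theorem jacobi_jacobi (X : L) : T.jacobi (T.jacobi X) = 0 := by
  obtain ⟨Y, hY⟩ := T.exists_jacobi_eq_J X
  rw [hY, jacobi_J]

theorem Om_jacobi_J (F : A) (X Y : L) : T.Om F (T.jacobi X) (T.J Y) = 0 := T.Om_curv_J F _ _ _

theorem Om_J_jacobi (F : A) (X Y : L) : T.Om F (T.J X) (T.jacobi Y) = 0 := by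
  rw [Om_swap, Om_jacobi_J, neg_zero]

theorem Om_jacobi_jacobi (F : A) (X Y : L) : T.Om F (T.jacobi X) (T.jacobi Y) = 0 := by
  obtain ⟨Z, hZ⟩ := T.exists_jacobi_eq_J Y
  rw [hZ, Om_jacobi_J]

theorem insertTwo_Om_fnBracket_jacobi (F : A) (X Y Z : L) :
    insertTwo (T.Om F) (fnBracket T.jacobi T.jacobi) X Y Z =
      (2 : ℝ) • insertThree (extDerivTwo (insertOne (T.Om F) T.jacobi)) T.jacobi X Y Z := by
  rw [insertTwo_fnBracket (T.extDerivTwo_Om F) T.jacobi_jacobi T.jacobi_jacobi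
    (T.Om_jacobi_jacobi F) (T.Om_jacobi_jacobi F), two_smul]

theorem insertTwo_Om_fnBracket_J_jacobi (F : A) (X Y Z : L) :
    insertTwo (T.Om F) (fnBracket T.J T.jacobi) X Y Z =
      insertThree (extDerivTwo (insertOne (T.Om F) T.jacobi)) T.J X Y Z := by
  rw [insertTwo_fnBracket (T.extDerivTwo_Om F) T.J_jacobi T.jacobi_J (T.Om_J_jacobi F)
    (T.Om_jacobi_J F), insertOne_Om_J]
  simp [insertThree, extDerivTwo, lieCyclic]

theorem hor_px (i : ι) : T.hor (T.px i) = (1 / 2 : ℝ) • (T.px i + ⁅T.py i, T.S⁆) := by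
  rw [hor_apply, conn_apply, J_px_lie_S, J_px, sub_zero]

theorem hor_px_lie_x (i j : ι) : ⁅T.hor (T.px i), T.x j⁆ = if i = j then 1 else 0 := by
  rw [← J_lie_y, J_hor, J_px, T.py_y]

theorem curv_px_px (i j : ι) : T.curv (T.px i) (T.px j) = ⁅T.hor (T.px i), T.hor (T.px j)⁆ := by
  obtain ⟨Y, hY⟩ := T.exists_eq_J_of_J_eq_zero (X := ⁅T.hor (T.px i), T.hor (T.px j)⁆) (by
    refine T.ext_coord (fun k => ?_) (fun k => ?_) <;>
      simp [lie_lie, J_lie_x, J_lie_y, hor_px_lie_x, lie_ite_one_zero])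
  rw [curv_eq, hY, hor_J, sub_zero]

theorem py_lie_hor_px (i j : ι) : ⁅T.py i, T.hor (T.px j)⁆ = ⁅T.py j, T.hor (T.px i)⁆ := by
  simp only [hor_px, lie_smul, lie_add, py_lie_px]
  rw [leibniz_lie (T.py i), py_lie_py, zero_lie, zero_add]

/-- The coordinate form of the Bianchi identity `[J, R] = 0`. -/
theorem py_lie_curv_cyclic (i j k : ι) :
    ⁅T.py i, T.curv (T.px j) (T.px k)⁆ + ⁅T.py j, T.curv (T.px k) (T.px i)⁆
      + ⁅T.py k, T.curv (T.px i) (T.px j)⁆ = 0 := by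
  simp only [curv_px_px]
  rw [leibniz_lie (T.py i), leibniz_lie (T.py j), leibniz_lie (T.py k), py_lie_hor_px T i j,
    py_lie_hor_px T i k, py_lie_hor_px T j k]
  rw [← lie_skew (T.hor (T.px j)), ← lie_skew (T.hor (T.px k)), ← lie_skew (T.hor (T.px i))]
  abel

/-- Euler's relation: `R` is homogeneous of degree one. -/
theorem sum_y_smul_py_lie_curv (i j : ι) :
    ∑ k, T.y k • ⁅T.py k, T.curv (T.px i) (T.px j)⁆ = T.curv (T.px i) (T.px j) := by
  have homogeneous : ⁅T.C, T.curv (T.px i) (T.px j)⁆ = 0 := by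
    rw [curv_px_px, leibniz_lie, C_lie_hor, C_lie_hor, C_lie_px, C_lie_px]
    simp
  have vertical (k : ι) : ⁅T.curv (T.px i) (T.px j), T.x k⁆ = 0 := by
    rw [← J_lie_y, J_curv, zero_lie]
  rw [C, sum_lie] at homogeneous
  simp only [smul_lie_eq_sub, Finset.sum_sub_distrib] at homogeneous
  rw [sub_eq_zero.mp homogeneous]
  conv_rhs => rw [T.decomp (T.curv (T.px i) (T.px j))]
  simp [vertical]

theorem jacobi_px (j : ι) : T.jacobi (T.px j) = ∑ i, T.y i • T.curv (T.px i) (T.px j) := by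
  rw [jacobi]
  conv_lhs => rw [T.decomp T.S]
  simp [T.S_x, ← J_px, curv_J_left]

theorem py_lie_jacobi_px (i j : ι) : ⁅T.py i, T.jacobi (T.px j)⁆ =
    T.curv (T.px i) (T.px j) + ∑ k, T.y k • ⁅T.py i, T.curv (T.px k) (T.px j)⁆ := by
  rw [jacobi_px, lie_sum]
  simp [T.py_y, Finset.sum_add_distrib, add_comm]

theorem py_lie_jacobi_px_sub (i j : ι) :
    ⁅T.py i, T.jacobi (T.px j)⁆ - ⁅T.py j, T.jacobi (T.px i)⁆ =
      (3 : ℝ) • T.curv (T.px i) (T.px j) := by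
  have bianchi : ∑ k, T.y k • ⁅T.py i, T.curv (T.px k) (T.px j)⁆
      - ∑ k, T.y k • ⁅T.py j, T.curv (T.px k) (T.px i)⁆ = T.curv (T.px i) (T.px j) := by
    rw [← sum_y_smul_py_lie_curv T i j, ← Finset.sum_sub_distrib]
    refine Finset.sum_congr rfl fun k _ => ?_
    have h := T.py_lie_curv_cyclic i k j
    rw [curv_swap T (T.px j), curv_swap T (T.px i) (T.px k), lie_neg, lie_neg] at h
    rw [← smul_sub]
    congr 1
    rw [← sub_eq_zero, ← h]
    abel
  rw [py_lie_jacobi_px, py_lie_jacobi_px, curv_swap T (T.px j)]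
  linear_combination (norm := module) bianchi

theorem J_px_lie_jacobi (i : ι) (X : L) : T.J ⁅T.px i, T.jacobi X⁆ = 0 := by
  obtain ⟨Y, hY⟩ := T.exists_jacobi_eq_J X
  rw [hY, J_px_lie_J]

theorem fnBracket_J_jacobi_px_px (i j : ι) :
    fnBracket T.J T.jacobi (T.px i) (T.px j) = (3 : ℝ) • T.curv (T.px i) (T.px j) := by
  have vertical : T.J ⁅T.jacobi (T.px i), T.px j⁆ = 0 := by
    rw [← lie_skew, map_neg, J_px_lie_jacobi, neg_zero]
  rw [fnBracket_apply, J_px, J_px, J_px_lie_jacobi, vertical, px_lie_py, py_lie_px, J_jacobi,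
    jacobi_J, ← lie_skew (T.jacobi (T.px i)), ← py_lie_jacobi_px_sub]
  simp [sub_eq_add_neg]

theorem curv_py_left (i : ι) : T.curv (T.py i) = 0 := by
  ext X
  rw [← J_px, curv_J_left, LinearMap.zero_apply]

theorem jacobi_py (i : ι) : T.jacobi (T.py i) = 0 := by rw [← J_px, jacobi_J]

theorem fnBracket_J_jacobi_py (i : ι) : fnBracket T.J T.jacobi (T.py i) = 0 := by
  refine T.linearMap_ext (fun j => ?_) (fun j => ?_)
  · obtain ⟨Z, hZ⟩ := T.exists_jacobi_eq_J (T.px j)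
    simp [fnBracket_apply, J_px, J_py, jacobi_py, py_lie_py, py_lie_px, hZ, J_py_lie_J]
  · simp [fnBracket_apply, J_py, jacobi_py, J_jacobi, jacobi_J]

theorem fnBracket_J_jacobi : fnBracket T.J T.jacobi = (3 : ℝ) • T.curv := by
  refine T.linearMap_ext (fun i => T.linearMap_ext (fun j => ?_) fun j => ?_) fun i => ?_
  · exact T.fnBracket_J_jacobi_px_px i j
  · rw [fnBracket_swap, fnBracket_J_jacobi_py, LinearMap.smul_apply, LinearMap.smul_apply,
      curv_swap, curv_py_left]
    simp
  · rw [fnBracket_J_jacobi_py, LinearMap.smul_apply, curv_py_left, smul_zero]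

end JacobiEndomorphism

end SprayAlgebra

section ZeroJet

variable {A L : Type*} [CommRing A] [LieRing L] [Module A L] [LieRingModule L A] [Algebra ℝ A]

/-- The `k`-jet of `f` is zero at the point where `ev` evaluates: all iterated derivatives of `f`
of order at most `k` along elements of `L` vanish there. -/
def ZeroJet (L : Type*) [LieRing L] [LieRingModule L A] (ev : A →ₐ[ℝ] ℝ) : ℕ → A → Prop
  | 0, f => ev f = 0
  | k + 1, f => ev f = 0 ∧ ∀ X : L, ZeroJet L ev k ⁅X, f⁆

namespace ZeroJet

section LieRing

omit [Module A L]

variable {ev : A →ₐ[ℝ] ℝ} {k : ℕ} {f g : A}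

theorem ev_eq_zero (h : ZeroJet L ev k f) : ev f = 0 := by
  cases k with
  | zero => exact h
  | succ k => exact h.1

theorem lie (h : ZeroJet L ev (k + 1) f) (X : L) : ZeroJet L ev k ⁅X, f⁆ := h.2 X

theorem of_succ (h : ZeroJet L ev (k + 1) f) : ZeroJet L ev k f := by
  induction k generalizing f with
  | zero => exact h.1
  | succ k ih => exact ⟨h.1, fun X => ih (h.2 X)⟩

theorem of_le {m : ℕ} (h : ZeroJet L ev k f) (hmk : m ≤ k) : ZeroJet L ev m f := by
  induction hmk with
  | refl => exact h
  | step _ ih => exact ih h.of_succ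

theorem zero : ZeroJet L ev k 0 := by
  induction k with
  | zero => exact map_zero ev
  | succ k ih => exact ⟨map_zero ev, fun X => by rwa [lie_zero]⟩

theorem add (hf : ZeroJet L ev k f) (hg : ZeroJet L ev k g) : ZeroJet L ev k (f + g) := by
  induction k generalizing f g with
  | zero =>
    simp only [ZeroJet] at hf hg ⊢
    rw [map_add, hf, hg, add_zero]
  | succ k ih =>
    exact ⟨by rw [map_add, hf.1, hg.1, add_zero], fun X => by
      rw [lie_add]; exact ih (hf.2 X) (hg.2 X)⟩

theorem sum {ι : Type*} {s : Finset ι} {f : ι → A} (h : ∀ i ∈ s, ZeroJet L ev k (f i)) :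
    ZeroJet L ev k (∑ i ∈ s, f i) :=
  Finset.sum_induction f (ZeroJet L ev k) (fun _ _ => add) zero h

theorem ev_lie_lie_comm (hf : ZeroJet L ev 1 f) (X Y : L) : ev ⁅X, ⁅Y, f⁆⁆ = ev ⁅Y, ⁅X, f⁆⁆ := by
  have h : ev ⁅⁅X, Y⁆, f⁆ = 0 := hf.2 _
  rwa [lie_lie, map_sub, sub_eq_zero] at h

end LieRing

theorem lieCyclic {ev : A →ₐ[ℝ] ℝ} {k : ℕ} {β : L →ₗ[A] L →ₗ[A] A}
    (h : ∀ X Y, ZeroJet L ev k (β X Y)) (X Y Z : L) : ZeroJet L ev k (lieCyclic β X Y Z) :=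
  ((h _ _).add (h _ _)).add (h _ _)

variable [LieRinehartRing A L] {ev : A →ₐ[ℝ] ℝ} {k : ℕ} {f g : A}

theorem mul_left (a : A) (hf : ZeroJet L ev k f) : ZeroJet L ev k (a * f) := by
  induction k generalizing f a with
  | zero =>
    simp only [ZeroJet] at hf ⊢
    rw [map_mul, hf, mul_zero]
  | succ k ih =>
    exact ⟨by rw [map_mul, hf.1, mul_zero], fun X => by
      rw [LieRinehartRing.leibniz_mul_right]; exact (ih a (hf.2 X)).add (ih _ hf.of_succ)⟩

theorem neg (hf : ZeroJet L ev k f) : ZeroJet L ev k (-f) := by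
  rw [← neg_one_mul]
  exact hf.mul_left _

theorem sub (hf : ZeroJet L ev k f) (hg : ZeroJet L ev k g) : ZeroJet L ev k (f - g) := by
  rw [sub_eq_add_neg]
  exact hf.add hg.neg

theorem real_smul (r : ℝ) (hf : ZeroJet L ev k f) : ZeroJet L ev k (r • f) := by
  rw [Algebra.smul_def]
  exact hf.mul_left _

theorem of_real_smul {r : ℝ} (hr : r ≠ 0) (hf : ZeroJet L ev k (r • f)) : ZeroJet L ev k f := by
  simpa [smul_smul, hr] using hf.real_smul r⁻¹

theorem of_mul [IsLocalHom ev] {a : A} (ha : ev a ≠ 0) (hf : ZeroJet L ev k (a * f)) :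
    ZeroJet L ev k f := by
  obtain ⟨u, rfl⟩ := isUnit_of_map_unit ev a (IsUnit.mk0 _ ha)
  simpa using hf.mul_left (↑u⁻¹ : A)

theorem ev_lie_smul_lie (hf : ZeroJet L ev 1 f) (a : A) (X Y : L) :
    ev ⁅X, ⁅a • Y, f⁆⁆ = ev a * ev ⁅X, ⁅Y, f⁆⁆ := by
  simp [LieRinehartRing.lie_smul_eq_mul, (hf.lie Y).ev_eq_zero]

theorem ev_lie_lie_mul (hf : ZeroJet L ev 1 f) (a : A) (X Y : L) :
    ev ⁅X, ⁅Y, a * f⁆⁆ = ev a * ev ⁅X, ⁅Y, f⁆⁆ := by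
  simp [(hf.lie X).ev_eq_zero, (hf.lie Y).ev_eq_zero, hf.ev_eq_zero]

theorem extDerivTwo {β : L →ₗ[A] L →ₗ[A] A} (h : ∀ X Y, ZeroJet L ev (k + 1) (β X Y))
    (X Y Z : L) : ZeroJet L ev k (extDerivTwo β X Y Z) :=
  (((h _ _).lie X |>.add ((h _ _).lie Y)).add ((h _ _).lie Z)).sub
    (lieCyclic (fun _ _ => (h _ _).of_succ) X Y Z)

end ZeroJet

end ZeroJet

namespace SprayAlgebra

variable {ι A L : Type*} [Fintype ι] [DecidableEq ι] [CommRing A] [LieRing L] [Module A L]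
  [LieRingModule L A] [LieRinehartRing A L] [Algebra ℝ A] (T : SprayAlgebra ι A L)
  (ev : A →ₐ[ℝ] ℝ)

theorem zeroJet_Om {F : A} {k : ℕ} {ev : A →ₐ[ℝ] ℝ} (h : ZeroJet L ev (k + 2) F) (X Y : L) :
    ZeroJet L ev k (T.Om F X Y) :=
  (((h.lie _).lie _).sub ((h.lie _).lie _)).sub (h.lie _).of_succ

variable [LieAlgebra ℝ L] [LieRinehartAlgebra ℝ A L]

/-- `F` is a formal solution of order `l + 2` of `P = (L_C - 1, i_Γ Ω, i_Φ Ω)`. -/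
structure IsSolution (l : ℕ) (F : A) : Prop where
  homogeneity : ZeroJet L ev (l + 1) (⁅T.C, F⁆ - F)
  connection : ∀ X Y, ZeroJet L ev l (insertOne (T.Om F) T.conn X Y)
  curvature : ∀ X Y, ZeroJet L ev l (insertOne (T.Om F) T.jacobi X Y)

/-- `X` is a horizontal eigenvector field of `Φ` with eigenfunction `a`. -/
structure IsEigenvector (a : A) (X : L) : Prop where
  hor_eq : T.hor X = X
  jacobi_eq : T.jacobi X = a • T.J X

/-- The prolonged first compatibility condition for `F`, relative to the frame `e`. -/
structure FirstCondition (e : ι → L) (F : A) : Prop where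
  curv_cond : ∀ X Y Z, ZeroJet L ev 1 (insertTwo (T.Om F) T.curv X Y Z)
  jacobi_cond : ∀ X Y Z, ZeroJet L ev 1 (insertTwo (T.Om F) (fnBracket T.jacobi T.jacobi) X Y Z)
  frame_cond : ∀ i j k, i ≠ j → j ≠ k → i ≠ k →
    ZeroJet L ev 1 (lieCyclic (T.Om F) (T.J (e i)) (e j) (e k))

/-- The third order condition for `F` on the fields `X`, `Y`. -/
def ThirdOrderCondition (F : A) (X Y : L) : Prop :=
  ev ⁅⁅T.hor X, T.jacobi X⁆, T.Om F (T.J Y) Y⁆ - ev ⁅⁅T.hor Y, T.jacobi Y⁆, T.Om F X (T.J X)⁆ =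
    ev ⁅T.jacobi X, lieCyclic (T.Om F) (T.J Y) (T.hor X) (T.hor Y)⁆
      - ev ⁅T.hor X, lieCyclic (T.Om F) (T.J Y) (T.jacobi X) (T.hor Y)
          - lieCyclic (T.Om F) (T.J Y) (T.jacobi Y) X⁆
      - ev ⁅T.jacobi Y, lieCyclic (T.Om F) (T.J X) (T.hor X) (T.hor Y)⁆
      + ev ⁅T.hor Y, lieCyclic (T.Om F) (T.J X) (T.jacobi X) Y
          - lieCyclic (T.Om F) (T.J X) (T.jacobi Y) X⁆

variable {T ev} {l : ℕ} {F G : A} {X Y Z : L} {a b c : A}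

theorem IsSolution.of_succ (h : T.IsSolution ev (l + 1) F) : T.IsSolution ev l F :=
  ⟨h.homogeneity.of_succ, fun X Y => (h.connection X Y).of_succ,
    fun X Y => (h.curvature X Y).of_succ⟩

theorem IsSolution.zeroJet_Om_hor (h : T.IsSolution ev l F) (hX : T.hor X = X)
    (hY : T.hor Y = Y) : ZeroJet L ev l (T.Om F X Y) := by
  have := h.connection (T.hor X) (T.hor Y)
  rw [insertOne_Om_conn_hor] at this
  rw [← hX, ← hY]
  exact this.of_real_smul two_ne_zero

theorem IsEigenvector.insertOne_jacobi (hX : T.IsEigenvector a X) (hY : T.IsEigenvector b Y)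
    (F : A) : insertOne (T.Om F) T.jacobi X Y = (a - b) * T.Om F (T.J X) Y := by
  rw [insertOne_apply, hX.jacobi_eq, hY.jacobi_eq, map_smul, map_smul, LinearMap.smul_apply,
    Om_J_right, smul_eq_mul, smul_eq_mul]
  ring

theorem IsSolution.zeroJet_Om_J [IsLocalHom ev] (h : T.IsSolution ev l F)
    (hX : T.IsEigenvector a X) (hY : T.IsEigenvector b Y) (hab : ev a ≠ ev b) :
    ZeroJet L ev l (T.Om F (T.J X) Y) := by
  have := h.curvature X Y
  rw [hX.insertOne_jacobi hY] at this
  exact this.of_mul (by rwa [map_sub, sub_ne_zero])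

/-- `i_Φ Ω` kills vertical fields, so that on a vertical field `d(i_Φ Ω)` is the derivative along
it, up to values of `i_Φ Ω`. -/
theorem IsSolution.zeroJet_J_lie_sub_extDerivTwo (h : T.IsSolution ev l F) (X Y Z : L) :
    ZeroJet L ev l (⁅T.J X, insertOne (T.Om F) T.jacobi Y Z⁆
      - extDerivTwo (insertOne (T.Om F) T.jacobi) (T.J X) Y Z) := by
  have hZJ : insertOne (T.Om F) T.jacobi Z (T.J X) = 0 := by
    simp [insertOne_apply, Om_jacobi_J, jacobi_J]
  have hJY : insertOne (T.Om F) T.jacobi (T.J X) Y = 0 := by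
    simp [insertOne_apply, Om_J_jacobi, jacobi_J]
  convert ZeroJet.lieCyclic h.curvature (T.J X) Y Z using 1
  simp [extDerivTwo, hZJ, hJY]

theorem IsSolution.zeroJet_cyclic_lie (h : T.IsSolution ev l F) {K : L →ₗ[A] L}
    (vertical : ∀ X, ∃ W, K X = T.J W)
    (hd : ZeroJet L ev l (insertThree (extDerivTwo (insertOne (T.Om F) T.jacobi)) K X Y Z)) :
    ZeroJet L ev l (⁅K X, insertOne (T.Om F) T.jacobi Y Z⁆
      + ⁅K Y, insertOne (T.Om F) T.jacobi Z X⁆ + ⁅K Z, insertOne (T.Om F) T.jacobi X Y⁆) := by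
  have along (X Y Z : L) : ZeroJet L ev l (⁅K X, insertOne (T.Om F) T.jacobi Y Z⁆
      - extDerivTwo (insertOne (T.Om F) T.jacobi) (K X) Y Z) := by
    obtain ⟨W, hW⟩ := vertical X
    rw [hW]
    exact h.zeroJet_J_lie_sub_extDerivTwo W Y Z
  convert (((along X Y Z).add (along Y Z X)).add (along Z X Y)).add hd using 1
  rw [insertThree, extDerivTwo_rotate _ X (K Y) Z, ← extDerivTwo_rotate _ (K Z) X Y]
  ring

/-- For a second-order solution, `i_[J,Φ] Ω = 3 i_R Ω` and `i_[Φ,Φ] Ω` are, up to values of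
`i_Φ Ω`, two linear combinations of the derivatives `[JX, i_Φ Ω (Y, Z)]` and their cyclic
permutations. On eigenvector fields this system allows to eliminate `[JX, Ω(JY, Z)]`. -/
theorem FirstCondition.zeroJet_lie_J_sub [IsLocalHom ev] {e : ι → L}
    (hF : T.FirstCondition ev e F) (h : T.IsSolution ev 1 F) (hX : T.IsEigenvector a X)
    (hY : T.IsEigenvector b Y) (hZ : T.IsEigenvector c Z) (hab : ev a ≠ ev b)
    (hca : ev c ≠ ev a) :
    ZeroJet L ev 1 (⁅T.J Y, T.Om F (T.J Z) X⁆ - ⁅T.J Z, T.Om F (T.J X) Y⁆) := by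
  have curv : ZeroJet L ev 1 (⁅T.J X, (b - c) * T.Om F (T.J Y) Z⁆
      + ⁅T.J Y, (c - a) * T.Om F (T.J Z) X⁆ + ⁅T.J Z, (a - b) * T.Om F (T.J X) Y⁆) := by
    rw [← hX.insertOne_jacobi hY, ← hY.insertOne_jacobi hZ, ← hZ.insertOne_jacobi hX]
    refine h.zeroJet_cyclic_lie (fun X => ⟨X, rfl⟩) ?_
    rw [← insertTwo_Om_fnBracket_J_jacobi, fnBracket_J_jacobi]
    convert (hF.curv_cond X Y Z).real_smul 3 using 1
    simp [insertTwo]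
  have jacobi : ZeroJet L ev 1 (a * ⁅T.J X, (b - c) * T.Om F (T.J Y) Z⁆
      + b * ⁅T.J Y, (c - a) * T.Om F (T.J Z) X⁆ + c * ⁅T.J Z, (a - b) * T.Om F (T.J X) Y⁆) := by
    rw [← hX.insertOne_jacobi hY, ← hY.insertOne_jacobi hZ, ← hZ.insertOne_jacobi hX,
      ← LieRinehartRing.lie_smul_eq_mul, ← LieRinehartRing.lie_smul_eq_mul,
      ← LieRinehartRing.lie_smul_eq_mul, ← hX.jacobi_eq, ← hY.jacobi_eq, ← hZ.jacobi_eq]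
    refine h.zeroJet_cyclic_lie T.exists_jacobi_eq_J (ZeroJet.of_real_smul two_ne_zero ?_)
    rw [← insertTwo_Om_fnBracket_jacobi]
    exact hF.jacobi_cond X Y Z
  refine ZeroJet.of_mul (a := (a - b) * (c - a)) ?_ ?_
  · rw [map_mul, map_sub, map_sub]
    exact mul_ne_zero (sub_ne_zero.mpr hab) (sub_ne_zero.mpr hca)
  · convert (((curv.mul_left a).sub jacobi).add ((h.zeroJet_Om_J hX hY hab).mul_left
      ((c - a) * ⁅T.J Z, a - b⁆))).add
      ((h.zeroJet_Om_J hZ hX hca).mul_left ((b - a) * ⁅T.J Y, c - a⁆)) using 1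
    simp only [LieRinehartRing.leibniz_mul_right]
    ring

theorem FirstCondition.congr {e : ι → L} (h : ZeroJet L ev 3 (G - F))
    (hG : T.FirstCondition ev e G) : T.FirstCondition ev e F := by
  have Om_eq (X Y : L) : T.Om F X Y = T.Om G X Y - T.Om (G - F) X Y := by
    rw [Om_sub_fun]
    ring
  have transfer (X X' Y Y' Z Z' : L)
      (hsum : ZeroJet L ev 1 (T.Om G X X' + T.Om G Y Y' + T.Om G Z Z')) :
      ZeroJet L ev 1 (T.Om F X X' + T.Om F Y Y' + T.Om F Z Z') := by
    convert hsum.sub (((T.zeroJet_Om h X X').add (T.zeroJet_Om h Y Y')).add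
      (T.zeroJet_Om h Z Z')) using 1
    rw [Om_eq, Om_eq, Om_eq]
    ring
  exact ⟨fun _ _ _ => transfer _ _ _ _ _ _ (hG.curv_cond _ _ _),
    fun _ _ _ => transfer _ _ _ _ _ _ (hG.jacobi_cond _ _ _),
    fun _ _ _ hij hjk hik => transfer _ _ _ _ _ _ (hG.frame_cond _ _ _ hij hjk hik)⟩

theorem IsSolution.firstCondition [IsLocalHom ev] {e : ι → L} {lam : ι → A}
    (he : ∀ i, T.IsEigenvector (lam i) (e i))
    (hlam : ∀ i j, i ≠ j → ev (lam i) ≠ ev (lam j)) (h : T.IsSolution ev 2 F) :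
    T.FirstCondition ev e F where
  curv_cond X Y Z := by
    rw [insertTwo_Om_curv]
    exact ZeroJet.extDerivTwo (β := (T.Om F).compl₁₂ T.hor T.hor)
      (fun X Y => h.zeroJet_Om_hor (T.hor_hor X) (T.hor_hor Y)) _ _ _
  jacobi_cond X Y Z := by
    rw [insertTwo_Om_fnBracket_jacobi]
    exact (((ZeroJet.extDerivTwo h.curvature _ _ _).add
      (ZeroJet.extDerivTwo h.curvature _ _ _)).add
      (ZeroJet.extDerivTwo h.curvature _ _ _)).real_smul 2
  frame_cond i j k hij _ hik := by
    rw [lieCyclic_Om, Om_swap T F (e k)]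
    exact (((h.zeroJet_Om_hor (he j).hor_eq (he k).hor_eq).lie _).add
      ((h.zeroJet_Om_J (he i) (he k) (hlam i k hik)).neg.lie _)).add
      ((h.zeroJet_Om_J (he i) (he j) (hlam i j hij)).lie _)

theorem ThirdOrderCondition.congr (h : ZeroJet L ev 3 (G - F))
    (hG : T.ThirdOrderCondition ev G X Y) : T.ThirdOrderCondition ev F X Y := by
  have ev_lie_Om (W X Y : L) : ev ⁅W, T.Om G X Y⁆ = ev ⁅W, T.Om F X Y⁆ := by
    have := ((T.zeroJet_Om h X Y).lie W).ev_eq_zero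
    rwa [Om_sub_fun, lie_sub, map_sub, sub_eq_zero] at this
  simp only [ThirdOrderCondition, lieCyclic, lie_sub, lie_add, map_sub, map_add,
    ev_lie_Om] at hG ⊢
  exact hG

/-- On eigenvector fields `Ω` is closed, so the cyclic sums are derivatives of values of `Ω`; in the
condition the second derivatives of `Ω(JX, X)` and `Ω(JY, Y)` cancel, and a factor `a - b` splits
off. -/
theorem IsSolution.thirdOrderCondition_iff [IsLocalHom ev] (h : T.IsSolution ev 1 F)
    (hX : T.IsEigenvector a X) (hY : T.IsEigenvector b Y) (hab : ev a ≠ ev b) :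
    T.ThirdOrderCondition ev F X Y ↔
      ev ⁅T.J X, ⁅T.J Y, T.Om F X Y⁆⁆ + ev ⁅T.J X, ⁅Y, T.Om F (T.J X) Y⁆⁆
        - ev ⁅X, ⁅T.J Y, T.Om F (T.J X) Y⁆⁆ = 0 := by
  have hXY := h.zeroJet_Om_hor hX.hor_eq hY.hor_eq
  have hJXY := h.zeroJet_Om_J hX hY hab
  have hJYX : T.Om F (T.J Y) X = T.Om F (T.J X) Y := T.Om_J_symm F Y X
  have factor : (ev a - ev b) * (ev ⁅T.J X, ⁅T.J Y, T.Om F X Y⁆⁆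
      + ev ⁅T.J X, ⁅Y, T.Om F (T.J X) Y⁆⁆ - ev ⁅X, ⁅T.J Y, T.Om F (T.J X) Y⁆⁆) = 0 ↔
      T.ThirdOrderCondition ev F X Y := by
    have lie_mul (f : A) (W V : L) (c : A) (hf : ZeroJet L ev 1 f) :
        ev ⁅W, c * ⁅V, f⁆⁆ = ev c * ev ⁅W, ⁅V, f⁆⁆ := by
      simpa only [LieRinehartRing.lie_smul_eq_mul] using hf.ev_lie_smul_lie c W V
    simp only [ThirdOrderCondition, hX.hor_eq, hY.hor_eq, hX.jacobi_eq, hY.jacobi_eq,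
      lieCyclic_Om, map_smul, LinearMap.smul_apply, smul_eq_mul, Om_J_J, hJYX, T.Om_J_right F X Y,
      T.Om_J_right F Y X, T.Om_J_right F X X, T.Om_J_right F Y Y, lie_lie,
      LieRinehartRing.lie_smul_eq_mul, mul_zero, lie_zero, lie_sub, lie_add, lie_neg, map_add,
      map_sub, map_neg, map_mul, lie_mul _ _ _ _ hJXY, hJXY.ev_lie_lie_mul,
      hXY.ev_lie_lie_comm (T.J Y) (T.J X), hJXY.ev_lie_lie_comm (T.J Y) X,
      hJXY.ev_lie_lie_comm (T.J X) Y]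
    constructor <;> intro h <;> linear_combination -h
  rw [← factor, mul_eq_zero, or_iff_right (sub_ne_zero.mpr hab)]

theorem IsSolution.thirdOrderCondition [IsLocalHom ev] (h : T.IsSolution ev 2 F)
    (hX : T.IsEigenvector a X) (hY : T.IsEigenvector b Y) (hab : ev a ≠ ev b) :
    T.ThirdOrderCondition ev F X Y := by
  have hXY := h.zeroJet_Om_hor hX.hor_eq hY.hor_eq
  have hJXY := h.zeroJet_Om_J hX hY hab
  rw [h.of_succ.thirdOrderCondition_iff hX hY hab, ((hXY.lie _).lie _).ev_eq_zero,
    ((hJXY.lie _).lie _).ev_eq_zero, ((hJXY.lie _).lie _).ev_eq_zero]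
  ring

end SprayAlgebra

section LeadingForm

theorem eq_of_perm_of_swap {κ γ : Type*} {β : List κ → γ}
    (swap : ∀ l₁ a b l₂, β (l₁ ++ a :: b :: l₂) = β (l₁ ++ b :: a :: l₂)) {l l' : List κ}
    (h : l.Perm l') : β l = β l' := by
  suffices ∀ l₁, β (l₁ ++ l) = β (l₁ ++ l') from this []
  induction h with
  | nil => exact fun _ => rfl
  | cons a _ ih => exact fun l₁ => by simpa using ih (l₁ ++ [a])
  | swap a b l => exact fun l₁ => swap l₁ b a l
  | trans _ _ ih ih' => exact fun l₁ => (ih l₁).trans (ih' l₁)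

variable {A L κ : Type*} [CommRing A] [LieRing L] [LieRingModule L A] {p : κ → L}

/-- The iterated derivative of `f` along the fields `p a`, where `a` runs through the list `l` and
the head of `l` acts first. -/
def iteratedLie (p : κ → L) : List κ → A → A
  | [], f => f
  | a :: l, f => iteratedLie p l ⁅p a, f⁆

theorem iteratedLie_add (l : List κ) (f g : A) :
    iteratedLie p l (f + g) = iteratedLie p l f + iteratedLie p l g := by
  induction l generalizing f g with
  | nil => rfl
  | cons a l ih => simp only [iteratedLie, lie_add, ih]

theorem iteratedLie_sum {ν : Type*} (s : Finset ν) (l : List κ) (f : ν → A) :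
    iteratedLie p l (∑ i ∈ s, f i) = ∑ i ∈ s, iteratedLie p l (f i) := by
  induction l generalizing f with
  | nil => rfl
  | cons a l ih => simp only [iteratedLie, lie_sum, ih]

variable [Algebra ℝ A] {ev : A →ₐ[ℝ] ℝ}

theorem ZeroJet.ev_iteratedLie_eq_zero {k : ℕ} {f : A} (hf : ZeroJet L ev k f) {l : List κ}
    (hl : l.length ≤ k) : ev (iteratedLie p l f) = 0 := by
  induction l generalizing k f with
  | nil => exact hf.ev_eq_zero
  | cons a l ih =>
    obtain ⟨k, rfl⟩ : ∃ m, k = m + 1 := Nat.exists_eq_succ_of_ne_zero (by grind)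
    exact ih (hf.lie _) (by grind)

variable [Module A L] [LieRinehartRing A L]

theorem iteratedLie_real_smul [LieAlgebra ℝ L] [LieRinehartAlgebra ℝ A L] (r : ℝ) (l : List κ)
    (f : A) : iteratedLie p l (r • f) = r • iteratedLie p l f := by
  induction l generalizing f with
  | nil => rfl
  | cons a l ih => simp only [iteratedLie, lie_smul, ih]

theorem ev_iteratedLie_mul (f : A) {g : A} {l : List κ}
    (hg : ∀ k, k + 1 ≤ l.length → ZeroJet L ev k g) :
    ev (iteratedLie p l (f * g)) = ev f * ev (iteratedLie p l g) := by
  induction l generalizing f g with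
  | nil => exact map_mul ev f g
  | cons a l ih =>
    have lower : ev (iteratedLie p l (⁅p a, f⁆ * g)) = 0 :=
      ((hg l.length le_rfl).mul_left _).ev_iteratedLie_eq_zero le_rfl
    rw [iteratedLie, LieRinehartRing.leibniz_mul_right, iteratedLie_add, map_add, lower, add_zero,
      smul_eq_mul, ih f fun k hk => (hg (k + 1) (by grind)).lie _, iteratedLie]

/-- Only one of the derivatives falls on `f` if `f` vanishes and `g` vanishes to the highest
possible order. -/
theorem ev_iteratedLie_mul_of_ev_eq_zero {f g : A} {l : List κ} (hf : ev f = 0)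
    (hg : ∀ k, k + 2 ≤ l.length → ZeroJet L ev k g) :
    ev (iteratedLie p l (f * g)) =
      ∑ i : Fin l.length, ev ⁅p l[i], f⁆ * ev (iteratedLie p (l.eraseIdx i) g) := by
  induction l generalizing g with
  | nil => simp [iteratedLie, hf]
  | cons a l ih =>
    rw [iteratedLie, LieRinehartRing.leibniz_mul_right, iteratedLie_add, map_add, smul_eq_mul,
      ih fun k hk => (hg (k + 1) (by grind)).lie _,
      ev_iteratedLie_mul _ fun k hk => hg k (by grind), add_comm]
    exact (Fin.sum_univ_succ (n := l.length) fun i =>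
      ev ⁅p (a :: l)[i], f⁆ * ev (iteratedLie p ((a :: l).eraseIdx i) g)).symm

theorem ZeroJet.mul_of_ev_eq_zero {k : ℕ} {f g : A} (hf : ev f = 0) (hg : ZeroJet L ev k g) :
    ZeroJet L ev (k + 1) (f * g) := by
  induction k generalizing g with
  | zero =>
    have hg₀ : ev g = 0 := hg
    refine ⟨by rw [map_mul, hf, zero_mul], fun X => ?_⟩
    simp [ZeroJet, hf, hg₀]
  | succ k ih =>
    refine ⟨by rw [map_mul, hf, zero_mul], fun X => ?_⟩
    rw [LieRinehartRing.leibniz_mul_right]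
    exact (ih (hg.lie X)).add (hg.mul_left _)

variable [LieAlgebra ℝ L] [LieRinehartAlgebra ℝ A L] [Finite κ] [DecidableEq κ]

/-- Euler's formula: by induction on the degree, take `(∑ a, ξ a * f a) / (n + 1)` where `f a` has
leading part `β (a, ·)`. -/
theorem exists_leadingForm {ξ : κ → A} (hξ : ∀ b, ev (ξ b) = 0)
    (dual : ∀ a b, ev ⁅p a, ξ b⁆ = if a = b then 1 else 0) (n : ℕ) {β : List κ → ℝ}
    (symm : ∀ l l', l.Perm l' → β l = β l') :
    ∃ f : A, ZeroJet L ev n f ∧ ∀ l, l.length = n + 1 → ev (iteratedLie p l f) = β l := by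
  have := Fintype.ofFinite κ
  induction n generalizing β with
  | zero =>
    refine ⟨∑ a, β [a] • ξ a, ?_, fun l hl => ?_⟩
    · simp [ZeroJet, hξ]
    · obtain ⟨a, rfl⟩ := List.length_eq_one_iff.mp hl
      simp [iteratedLie, lie_sum, dual]
  | succ n ih =>
    choose f zeroJet_f ev_f using fun a => ih fun l l' h => symm (a :: l) (a :: l') (h.cons a)
    refine ⟨(n + 2 : ℝ)⁻¹ • ∑ a, ξ a * f a, ZeroJet.real_smul _ (ZeroJet.sum fun a _ =>
      ZeroJet.mul_of_ev_eq_zero (hξ a) (zeroJet_f a)), fun l hl => ?_⟩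
    have leading (a : κ) : ev (iteratedLie p l (ξ a * f a)) =
        ∑ i : Fin l.length, if l[i] = a then β l else 0 := by
      rw [ev_iteratedLie_mul_of_ev_eq_zero (hξ a) fun k hk => (zeroJet_f a).of_le (by omega)]
      refine Finset.sum_congr rfl fun i _ => ?_
      rw [dual, ev_f a _ (by grind [List.length_eraseIdx])]
      split_ifs with h
      · rw [one_mul, ← h]
        exact symm _ _ (List.getElem_cons_eraseIdx_perm i.2)
      · rw [zero_mul]
    rw [iteratedLie_real_smul, iteratedLie_sum, map_smul, map_sum, Finset.sum_congr rfl
      fun a _ => leading a, Finset.sum_comm]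
    simp only [Finset.sum_ite_eq, Finset.mem_univ, if_true, Finset.sum_const, Finset.card_univ,
      Fintype.card_fin, hl, nsmul_eq_mul, smul_eq_mul]
    push_cast
    field_simp
    ring

/-- The form of degree four `β`, as a function of lists; its value on lists of other lengths is
zero. -/
def quarticOfList (β : κ → κ → κ → κ → ℝ) : List κ → ℝ
  | [a, b, c, d] => β a b c d
  | _ => 0

omit [Finite κ] [DecidableEq κ] in
theorem quarticOfList_perm {β : κ → κ → κ → κ → ℝ} (swap₁₂ : ∀ a b c d, β a b c d = β b a c d)
    (swap₂₃ : ∀ a b c d, β a b c d = β a c b d) (swap₃₄ : ∀ a b c d, β a b c d = β a b d c)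
    {l l' : List κ} (h : l.Perm l') : quarticOfList β l = quarticOfList β l' := by
  refine eq_of_perm_of_swap (fun l₁ a b l₂ => ?_) h
  match l₁, l₂ with
  | [], [c, d] => exact swap₁₂ a b c d
  | [c], [d] => exact swap₂₃ c a b d
  | [c, d], [] => exact swap₃₄ c d a b
  | [], [] | [], [_] | [], _ :: _ :: _ :: _ | [_], [] | [_], _ :: _ :: _ | [_, _], _ :: _
  | [_, _, _], _ => rfl
  | _ :: _ :: _ :: _ :: l, _ => cases l <;> rfl

theorem exists_leadingForm_four {ξ : κ → A} (hξ : ∀ b, ev (ξ b) = 0)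
    (dual : ∀ a b, ev ⁅p a, ξ b⁆ = if a = b then 1 else 0) {β : κ → κ → κ → κ → ℝ}
    (swap₁₂ : ∀ a b c d, β a b c d = β b a c d) (swap₂₃ : ∀ a b c d, β a b c d = β a c b d)
    (swap₃₄ : ∀ a b c d, β a b c d = β a b d c) :
    ∃ f : A, ZeroJet L ev 3 f ∧
      ∀ a b c d, ev ⁅p a, ⁅p b, ⁅p c, ⁅p d, f⁆⁆⁆⁆ = β a b c d := by
  have perm {l l' : List κ} := quarticOfList_perm swap₁₂ swap₂₃ swap₃₄ (l := l) (l' := l')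
  obtain ⟨f, hf, ev_f⟩ := exists_leadingForm hξ dual 3 fun _ _ => perm
  exact ⟨f, hf, fun a b c d => (ev_f [d, c, b, a] rfl).trans
    (perm (List.reverse_perm [a, b, c, d]))⟩

end LeadingForm

section SpanningFamily

variable {A L κ : Type*} [CommRing A] [LieRing L] [Module A L] [LieRingModule L A]
  [LieRinehartRing A L] [Algebra ℝ A] {ev : A →ₐ[ℝ] ℝ} {p : κ → L}

theorem zeroJet_linearMap_of_span (hp : Submodule.span A (Set.range p) = ⊤) {k : ℕ}
    {t : L →ₗ[A] A} (ht : ∀ a, ZeroJet L ev k (t (p a))) (X : L) : ZeroJet L ev k (t X) := by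
  have hX : X ∈ Submodule.span A (Set.range p) := hp ▸ Submodule.mem_top
  induction hX using Submodule.span_induction with
  | mem X hX => obtain ⟨a, rfl⟩ := hX; exact ht a
  | zero => rw [map_zero]; exact ZeroJet.zero
  | add X Y _ _ hX hY => rw [map_add]; exact hX.add hY
  | smul a X _ hX => rw [map_smul]; exact hX.mul_left a

theorem zeroJet_bilinear_of_span (hp : Submodule.span A (Set.range p) = ⊤) {k : ℕ}
    {β : L →ₗ[A] L →ₗ[A] A} (hβ : ∀ a b, ZeroJet L ev k (β (p a) (p b))) (X Y : L) :
    ZeroJet L ev k (β X Y) :=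
  zeroJet_linearMap_of_span hp (t := β.flip Y)
    (fun a => zeroJet_linearMap_of_span hp (t := β (p a)) (hβ a) Y) X

theorem zeroJet_succ_of_span (hp : Submodule.span A (Set.range p) = ⊤) {k : ℕ} {f : A}
    (hf : ev f = 0) (hp_f : ∀ a, ZeroJet L ev k ⁅p a, f⁆) : ZeroJet L ev (k + 1) f :=
  ⟨hf, zeroJet_linearMap_of_span hp (t := differential f) hp_f⟩

theorem zeroJet_two_of_span (hp : Submodule.span A (Set.range p) = ⊤) {f : A}
    (hf : ZeroJet L ev 1 f) (hp_f : ∀ a b, ev ⁅p a, ⁅p b, f⁆⁆ = 0) : ZeroJet L ev 2 f :=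
  zeroJet_succ_of_span hp hf.ev_eq_zero fun b =>
    zeroJet_succ_of_span hp (hf.lie _).ev_eq_zero fun a => hp_f a b

theorem zeroJet_three_of_span (hp : Submodule.span A (Set.range p) = ⊤) {f : A}
    (hf : ZeroJet L ev 2 f) (hp_f : ∀ a b c, ev ⁅p a, ⁅p b, ⁅p c, f⁆⁆⁆ = 0) :
    ZeroJet L ev 3 f :=
  zeroJet_succ_of_span hp hf.ev_eq_zero fun c =>
    zeroJet_two_of_span hp (hf.lie _) fun a b => hp_f a b c

/-- Express the fields `q` dual to the functions `z` in terms of `p` and invert the matrix. -/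
theorem exists_dual_of_span [LieAlgebra ℝ L] [LieRinehartAlgebra ℝ A L] [Finite κ]
    [DecidableEq κ] (hp : Submodule.span A (Set.range p) = ⊤) {z : κ → A} {q : κ → L}
    (hqz : ∀ a b, ⁅q a, z b⁆ = if a = b then 1 else 0) :
    ∃ ξ : κ → A, (∀ b, ev (ξ b) = 0) ∧ ∀ a b, ev ⁅p a, ξ b⁆ = if a = b then 1 else 0 := by
  have := Fintype.ofFinite κ
  have hN (c) : ∃ N : κ → A, ∑ a, N a • p a = q c :=
    (Submodule.mem_span_range_iff_exists_fun A).mp (hp ▸ Submodule.mem_top)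
  choose N hN using hN
  have left_inv : Matrix.of N * Matrix.of (fun a d => ⁅p a, z d⁆) = 1 := by
    ext c d
    simp only [Matrix.one_apply, ← hqz, ← hN, sum_lie, Matrix.mul_apply, Matrix.of_apply,
      LieRinehartRing.lie_smul_eq_mul]
  have right_inv (a b) : ∑ d, ev ⁅p a, z d⁆ * ev (N d b) = if a = b then 1 else 0 := by
    have := congrArg ev (Matrix.ext_iff.mpr (mul_eq_one_comm.mp left_inv) a b)
    simpa only [Matrix.mul_apply, Matrix.of_apply, map_sum, map_mul, Matrix.one_apply,
      apply_ite ev, map_one, map_zero] using this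
  refine ⟨fun b => ∑ d, ev (N d b) • (z d - algebraMap ℝ A (ev (z d))), fun b => ?_,
    fun a b => ?_⟩
  · simp
  · have lie_const (r : ℝ) : ⁅p a, algebraMap ℝ A r⁆ = 0 := by
      rw [Algebra.algebraMap_eq_smul_one, lie_smul, lie_one_eq_zero, smul_zero]
    rw [← right_inv]
    simp [lie_sum, lie_const, mul_comm]

end SpanningFamily

namespace SprayAlgebra

variable {ι A L : Type*} [Fintype ι] [DecidableEq ι] [CommRing A] [LieRing L] [Module A L]
  [LieRingModule L A] [LieRinehartRing A L]

/-- The family consisting of the fields `e i` and `J (e i)`. -/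
def frame (T : SprayAlgebra ι A L) (e : ι → L) : ι ⊕ ι → L := Sum.elim e fun i => T.J (e i)

@[simp] theorem frame_inl (T : SprayAlgebra ι A L) (e : ι → L) (i : ι) :
    T.frame e (.inl i) = e i := rfl

@[simp] theorem frame_inr (T : SprayAlgebra ι A L) (e : ι → L) (i : ι) :
    T.frame e (.inr i) = T.J (e i) := rfl

variable [Algebra ℝ A] [LieAlgebra ℝ L] [LieRinehartAlgebra ℝ A L] {T : SprayAlgebra ι A L}

theorem eq_sum_hor_px {X : L} (hX : T.hor X = X) : X = ∑ k, ⁅X, T.x k⁆ • T.hor (T.px k) := by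
  conv_lhs => rw [← hX, T.decomp X]
  simp [← J_px, hor_J]

theorem jacobi_eq_sum (X : L) : T.jacobi X = ∑ k, ⁅X, T.x k⁆ • T.jacobi (T.px k) := by
  conv_lhs => rw [T.decomp X]
  simp [jacobi_py]

theorem span_frame {e : ι → L} (he : ∀ k, T.hor (T.px k) ∈ Submodule.span A (Set.range e)) :
    Submodule.span A (Set.range (T.frame e)) = ⊤ := by
  set W := Submodule.span A (Set.range (T.frame e))
  have hor_px_mem (k) : T.hor (T.px k) ∈ W :=
    Submodule.span_mono (Set.range_comp_subset_range Sum.inl (T.frame e)) (he k)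
  have py_mem (k) : T.py k ∈ W := by
    have : T.J (T.hor (T.px k)) ∈ W := by
      refine Submodule.span_induction (p := fun X _ => T.J X ∈ W) ?_ (by simp)
        (fun X Y _ _ hX hY => by rw [map_add]; exact W.add_mem hX hY)
        (fun a X _ hX => by rw [map_smul]; exact W.smul_mem a hX) (he k)
      rintro _ ⟨i, rfl⟩
      exact Submodule.subset_span ⟨.inr i, rfl⟩
    rwa [J_hor, J_px] at this
  have px_mem (k) : T.px k ∈ W := by
    obtain ⟨Y, hY⟩ := T.exists_sub_hor_eq_J (T.px k)
    rw [sub_eq_iff_eq_add.mp hY, J_apply]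
    exact W.add_mem (W.sum_mem fun i _ => W.smul_mem _ (py_mem i)) (hor_px_mem k)
  refine eq_top_iff.mpr fun X _ => ?_
  rw [T.decomp X]
  exact W.add_mem (W.sum_mem fun k _ => W.smul_mem _ (px_mem k))
    (W.sum_mem fun k _ => W.smul_mem _ (py_mem k))

variable (T) (ev : A →ₐ[ℝ] ℝ)

/-- Horizontal eigenvector fields `e i` of `Φ`, nonzero at the base point, with eigenfunctions
`lam i` pairwise distinct there; the field `e o` is the spray. -/
structure EigenFrame (lam : ι → A) (e : ι → L) (o : ι) : Prop where
  eigenvector : ∀ i, T.IsEigenvector (lam i) (e i)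
  distinct : ∀ i j, i ≠ j → ev (lam i) ≠ ev (lam j)
  ne_zero : ∀ i, ∃ f : A, ev ⁅e i, f⁆ ≠ 0
  spray : e o = T.S

namespace EigenFrame

variable {T ev} {lam : ι → A} {e : ι → L} {o : ι}

/-- The rows are eigenvectors of the matrix of `Φ` at the base point. -/
theorem linearIndependent (h : T.EigenFrame ev lam e o) :
    LinearIndependent ℝ fun i k => ev ⁅e i, T.x k⁆ := by
  let P : Matrix ι ι ℝ := Matrix.of fun k j => ev ⁅T.jacobi (T.px k), T.y j⁆
  refine Module.End.eigenvectors_linearIndependent' P.vecMulLinear (fun i => ev (lam i))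
    (fun i j hij => by_contra fun hne => h.distinct i j hne hij) _ fun i => ?_
  rw [Module.End.hasEigenvector_iff, Module.End.mem_eigenspace_iff]
  refine ⟨?_, fun hzero => ?_⟩
  · ext j
    have := congrArg (fun X => ev ⁅X, T.y j⁆) (h.eigenvector i).jacobi_eq
    rw [jacobi_eq_sum] at this
    simpa [Matrix.vecMul, dotProduct, P, sum_lie, J_lie_y] using this
  · obtain ⟨f, hf⟩ := h.ne_zero i
    have component_eq_zero (k : ι) : ev ⁅e i, T.x k⁆ = 0 := congrFun hzero k
    apply hf
    rw [eq_sum_hor_px (h.eigenvector i).hor_eq, sum_lie, map_sum]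
    simp [component_eq_zero]

variable [IsLocalHom ev]

theorem isUnit_det (h : T.EigenFrame ev lam e o) :
    IsUnit (Matrix.of fun i k => ⁅e i, T.x k⁆).det := by
  refine isUnit_of_map_unit ev _ ?_
  have : ev (Matrix.of fun i k => ⁅e i, T.x k⁆).det =
      (Matrix.of fun i k => ev ⁅e i, T.x k⁆).det := ev.toRingHom.map_det _
  rw [this, ← Matrix.isUnit_iff_isUnit_det, ← Matrix.linearIndependent_rows_iff_isUnit]
  exact h.linearIndependent

theorem hor_px_mem_span (h : T.EigenFrame ev lam e o) (k : ι) :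
    T.hor (T.px k) ∈ Submodule.span A (Set.range e) := by
  set N : Matrix ι ι A := Matrix.of fun i k => ⁅e i, T.x k⁆
  have expand (i) : e i = ∑ j, N i j • T.hor (T.px j) := eq_sum_hor_px (h.eigenvector i).hor_eq
  have hk : T.hor (T.px k) = ∑ i, N⁻¹ k i • e i := calc
    T.hor (T.px k) = ∑ j, (N⁻¹ * N) k j • T.hor (T.px j) := by
      simp [Matrix.nonsing_inv_mul N h.isUnit_det, Matrix.one_apply]
    _ = ∑ i, N⁻¹ k i • ∑ j, N i j • T.hor (T.px j) := by
      simp only [Matrix.mul_apply, Finset.sum_smul, mul_smul, Finset.smul_sum]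
      exact Finset.sum_comm
    _ = ∑ i, N⁻¹ k i • e i := by simp only [← expand]
  rw [hk]
  exact Submodule.sum_mem _ fun i _ => Submodule.smul_mem _ _ (Submodule.subset_span ⟨i, rfl⟩)

theorem span_eq_top (h : T.EigenFrame ev lam e o) :
    Submodule.span A (Set.range (T.frame e)) = ⊤ :=
  span_frame h.hor_px_mem_span

theorem exists_dual (h : T.EigenFrame ev lam e o) : ∃ ξ : ι ⊕ ι → A,
    (∀ b, ev (ξ b) = 0) ∧ ∀ a b, ev ⁅T.frame e a, ξ b⁆ = if a = b then 1 else 0 :=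
  exists_dual_of_span h.span_eq_top (z := Sum.elim T.x T.y) (q := Sum.elim T.px T.py) <| by
    rintro (a | a) (b | b) <;> simp [T.px_x, T.px_y, T.py_x, T.py_y]

end EigenFrame

end SprayAlgebra

/-- Data prescribing some components of a symmetric quartic form on the span of fields
`h i = inl i`, `v i = inr i`: the antisymmetrizations `η i j` in `(h i, v j)`, the components
`ε i j` in `(v i, v j)` for `i ≠ j` or `i = o`, and the contraction `κ` with `v o`. The fields are
the relations that hold between these components of any such form. -/
structure QuarticData {ι : Type*} (o : ι) (ε η : ι → ι → ι ⊕ ι → ι ⊕ ι → ℝ)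
    (κ : ι ⊕ ι → ι ⊕ ι → ι ⊕ ι → ℝ) : Prop where
  κ_swap₁₂ : ∀ a b c, κ a b c = κ b a c
  κ_swap₂₃ : ∀ a b c, κ a b c = κ a c b
  ε_symm : ∀ i j a b, ε i j a b = ε j i a b
  ε_swap : ∀ i j a b, ε i j a b = ε i j b a
  η_antisymm : ∀ i j a b, η i j a b = -η j i a b
  η_swap : ∀ i j a b, η i j a b = η i j b a
  ε_base : ∀ i a b, ε o i a b = κ (.inr i) a b
  cyclic_η : ∀ i j k a, η i j (.inl k) a + η j k (.inl i) a + η k i (.inl j) a = 0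
  cyclic_ε : ∀ i j k a, i ≠ j → j ≠ k → i ≠ k → ε j k (.inr i) a = ε k i (.inr j) a
  mixed : ∀ i j k a, i ≠ j → j ≠ k → i ≠ k →
    η j k (.inr i) a - ε i k (.inl j) a + ε i j (.inl k) a = 0
  mixed_base : ∀ k a, η o k (.inr o) a - ε o k (.inl o) a + ε o o (.inl k) a = 0
  quadratic : ∀ i j, i ≠ j →
    η i j (.inr i) (.inr j) + ε i j (.inr i) (.inl j) - ε i j (.inl i) (.inr j) = 0

namespace QuarticData

variable {ι : Type*}

/-- The pairs `(i, j)` for which the components in `(v i, v j)` are prescribed. -/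
def Prescribed (o i j : ι) : Prop := i ≠ j ∨ i = o

theorem prescribed_of_ne {o i j : ι} (h : i ≠ j) : Prescribed o i j := .inl h

theorem prescribed_base (o i : ι) : Prescribed o o i := .inr rfl

theorem not_prescribed {o i j : ι} : ¬Prescribed o i j ↔ i = j ∧ i ≠ o := by
  rw [Prescribed, not_or, not_not]

open Classical in
/-- The symmetric form of degree four whose contraction with the vector `o` is the symmetric cubic
form `ψ`, and whose components not involving `o` vanish. -/
def symmExtension (o : ι) (ψ : ι → ι → ι → ℝ) (a b c d : ι) : ℝ :=
  if d = o then ψ a b c else if c = o then ψ a b d else if b = o then ψ a c d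
  else if a = o then ψ b c d else 0

section SymmExtension

variable {o : ι} {ψ : ι → ι → ι → ℝ}

theorem symmExtension_base (a b c : ι) : symmExtension o ψ a b c o = ψ a b c := by
  simp [symmExtension]

theorem symmExtension_swap₁₂ (h₁₂ : ∀ a b c, ψ a b c = ψ b a c) (a b c d : ι) :
    symmExtension o ψ a b c d = symmExtension o ψ b a c d := by
  unfold symmExtension
  split_ifs <;> subst_vars <;> grind

theorem symmExtension_swap₂₃ (h₁₂ : ∀ a b c, ψ a b c = ψ b a c)
    (h₂₃ : ∀ a b c, ψ a b c = ψ a c b) (a b c d : ι) :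
    symmExtension o ψ a b c d = symmExtension o ψ a c b d := by
  unfold symmExtension
  split_ifs <;> subst_vars <;> grind

theorem symmExtension_swap₁₄ (h₁₂ : ∀ a b c, ψ a b c = ψ b a c)
    (h₂₃ : ∀ a b c, ψ a b c = ψ a c b) (a b c d : ι) :
    symmExtension o ψ a b c d = symmExtension o ψ d b c a := by
  unfold symmExtension
  split_ifs <;> subst_vars <;> grind

end SymmExtension

variable {o : ι} {ε η : ι → ι → ι ⊕ ι → ι ⊕ ι → ℝ} {κ : ι ⊕ ι → ι ⊕ ι → ι ⊕ ι → ℝ}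

section Prescribed

theorem ε_swap_of_prescribed (D : QuarticData o ε η κ) {i j k : ι} (a : ι ⊕ ι)
    (hj : Prescribed o i j) (hk : Prescribed o i k) : ε i j (.inr k) a = ε i k (.inr j) a := by
  simp only [Prescribed] at hj hk
  grind [D.cyclic_ε, D.ε_symm, D.ε_swap, D.ε_base, D.κ_swap₁₂, D.κ_swap₂₃]

theorem ε_swap_of_prescribed' (D : QuarticData o ε η κ) {i j k : ι} (a : ι ⊕ ι)
    (hj : Prescribed o i j) (hk : Prescribed o i k) : ε i j a (.inr k) = ε i k a (.inr j) := by
  rw [D.ε_swap, D.ε_swap_of_prescribed a hj hk, D.ε_swap]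

theorem mixed_of_prescribed (D : QuarticData o ε η κ) {i j k : ι} (a : ι ⊕ ι)
    (hj : Prescribed o i j) (hk : Prescribed o i k) :
    η j k (.inr i) a - ε i k (.inl j) a + ε i j (.inl k) a = 0 := by
  have antisymm := D.η_antisymm j k (.inr i) a
  rcases eq_or_ne j k with rfl | hjk
  · linarith
  rcases hj with hj | rfl
  · rcases hk with hk | rfl
    · exact D.mixed i j k a hj hjk hk
    · rcases eq_or_ne i k with rfl | hk
      · linarith [D.mixed_base j a]
      · exact D.mixed i j k a hj hjk hk
  · rcases eq_or_ne i j with rfl | hij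
    · exact D.mixed_base k a
    · rcases eq_or_ne i k with rfl | hik
      · linarith [D.mixed_base j a]
      · exact D.mixed i j k a hij hjk hik

end Prescribed

section HHHV

/-- The part of the components in `(h a, h b, h c, v d)` that is forced by `η`. -/
def antiPart (η : ι → ι → ι ⊕ ι → ι ⊕ ι → ℝ) (a b c d : ι) : ℝ :=
  (1 / 4) * (η a d (.inl b) (.inl c) + η b d (.inl a) (.inl c) + η c d (.inl a) (.inl b))

theorem antiPart_swap₁₂ (D : QuarticData o ε η κ) (a b c d : ι) :
    antiPart η a b c d = antiPart η b a c d := by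
  rw [antiPart, antiPart, D.η_swap c d (.inl a)]
  ring

theorem antiPart_swap₂₃ (D : QuarticData o ε η κ) (a b c d : ι) :
    antiPart η a b c d = antiPart η a c b d := by
  rw [antiPart, antiPart, D.η_swap a d (.inl b)]
  ring

theorem antiPart_sub (D : QuarticData o ε η κ) (i j a b : ι) :
    antiPart η i a b j - antiPart η j a b i = η i j (.inl a) (.inl b) := by
  rw [antiPart, antiPart]
  linarith [D.cyclic_η a j i (.inl b), D.cyclic_η b j i (.inl a),
    D.η_antisymm i j (.inl a) (.inl b), D.η_antisymm i a (.inl j) (.inl b),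
    D.η_antisymm i b (.inl j) (.inl a), D.η_swap j i (.inl a) (.inl b),
    D.η_swap b j (.inl i) (.inl a), D.η_swap b i (.inl j) (.inl a)]

/-- What remains of the contraction of the `h h h v` components with `v o`. -/
def remainder (o : ι) (η : ι → ι → ι ⊕ ι → ι ⊕ ι → ℝ) (κ : ι ⊕ ι → ι ⊕ ι → ι ⊕ ι → ℝ)
    (a b c : ι) : ℝ :=
  κ (.inl a) (.inl b) (.inl c) - antiPart η a b c o

theorem remainder_swap₁₂ (D : QuarticData o ε η κ) (a b c : ι) :
    remainder o η κ a b c = remainder o η κ b a c := by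
  rw [remainder, remainder, D.κ_swap₁₂, D.antiPart_swap₁₂]

theorem remainder_swap₂₃ (D : QuarticData o ε η κ) (a b c : ι) :
    remainder o η κ a b c = remainder o η κ a c b := by
  rw [remainder, remainder, D.κ_swap₂₃, D.antiPart_swap₂₃]

/-- The components in `(h a, h b, h c, v d)`. -/
def hhhv (o : ι) (η : ι → ι → ι ⊕ ι → ι ⊕ ι → ℝ) (κ : ι ⊕ ι → ι ⊕ ι → ι ⊕ ι → ℝ)
    (a b c d : ι) : ℝ :=
  symmExtension o (remainder o η κ) a b c d + antiPart η a b c d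

theorem hhhv_swap₁₂ (D : QuarticData o ε η κ) (a b c d : ι) :
    hhhv o η κ a b c d = hhhv o η κ b a c d := by
  rw [hhhv, hhhv, symmExtension_swap₁₂ D.remainder_swap₁₂, D.antiPart_swap₁₂]

theorem hhhv_swap₂₃ (D : QuarticData o ε η κ) (a b c d : ι) :
    hhhv o η κ a b c d = hhhv o η κ a c b d := by
  rw [hhhv, hhhv, symmExtension_swap₂₃ D.remainder_swap₁₂ D.remainder_swap₂₃, D.antiPart_swap₂₃]

theorem hhhv_base (a b c : ι) : hhhv o η κ a b c o = κ (.inl a) (.inl b) (.inl c) := by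
  rw [hhhv, symmExtension_base, remainder, sub_add_cancel]

theorem hhhv_sub (D : QuarticData o ε η κ) (i j a b : ι) :
    hhhv o η κ i a b j - hhhv o η κ j a b i = η i j (.inl a) (.inl b) := by
  rw [hhhv, hhhv, symmExtension_swap₁₄ D.remainder_swap₁₂ D.remainder_swap₂₃ i,
    add_sub_add_left_eq_sub, D.antiPart_sub]

end HHHV

section HHVV

open Classical in
/-- The components in `(h a, h b, v c, v d)`. For `c = d ≠ o` they are determined by the
antisymmetrizations in `(h a, v c)` or `(h b, v c)`, unless `a = b = c`. -/
def hhvv (o : ι) (ε η : ι → ι → ι ⊕ ι → ι ⊕ ι → ℝ) (a b c d : ι) : ℝ :=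
  if Prescribed o c d then ε c d (.inl a) (.inl b)
  else if a ≠ c then ε a c (.inl c) (.inl b) + η a c (.inl b) (.inr c)
  else if b ≠ c then ε b c (.inl c) (.inl a) + η b c (.inl a) (.inr c) else 0

theorem hhvv_of_prescribed {i j : ι} (h : Prescribed o i j) (a b : ι) :
    hhvv o ε η a b i j = ε i j (.inl a) (.inl b) := if_pos h

theorem hhvv_self {a c : ι} (hc : c ≠ o) (hac : a ≠ c) (b : ι) :
    hhvv o ε η a b c c = ε a c (.inl c) (.inl b) + η a c (.inl b) (.inr c) := by
  rw [hhvv, if_neg (not_prescribed.mpr ⟨rfl, hc⟩), if_pos hac]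

theorem hhvv_swap₁₂ (D : QuarticData o ε η κ) (a b c d : ι) :
    hhvv o ε η a b c d = hhvv o ε η b a c d := by
  by_cases h : Prescribed o c d
  · rw [hhvv_of_prescribed h, hhvv_of_prescribed h, D.ε_swap]
  obtain ⟨rfl, hc⟩ := not_prescribed.mp h
  rcases eq_or_ne c a with rfl | ha <;> rcases eq_or_ne c b with rfl | hb
  · rfl
  · simp [hhvv, h]
  · simp [hhvv, h]
  · rw [hhvv_self hc ha.symm, hhvv_self hc hb.symm]
    linarith [D.mixed_of_prescribed (.inl c) (prescribed_of_ne ha) (prescribed_of_ne hb),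
      D.cyclic_η a b c (.inr c), D.η_swap a b (.inr c) (.inl c),
      D.η_antisymm c a (.inl b) (.inr c), D.ε_symm a c (.inl c) (.inl b),
      D.ε_symm b c (.inl c) (.inl a), D.ε_swap c a (.inl c) (.inl b),
      D.ε_swap c b (.inl c) (.inl a)]

theorem hhvv_swap₃₄ (D : QuarticData o ε η κ) (a b c d : ι) :
    hhvv o ε η a b c d = hhvv o ε η a b d c := by
  rcases eq_or_ne c d with rfl | h
  · rfl
  · rw [hhvv_of_prescribed (prescribed_of_ne h), hhvv_of_prescribed (prescribed_of_ne h.symm),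
      D.ε_symm]

theorem hhvv_sub (D : QuarticData o ε η κ) (i j a b : ι) :
    hhvv o ε η i a b j - hhvv o ε η j a b i = η i j (.inl a) (.inr b) := by
  have antisymm := D.η_antisymm i j (.inl a) (.inr b)
  by_cases hj : Prescribed o b j <;> by_cases hi : Prescribed o b i
  · rw [hhvv_of_prescribed hj, hhvv_of_prescribed hi]
    linarith [D.mixed_of_prescribed (.inl a) hi hj, D.η_swap i j (.inl a) (.inr b)]
  · obtain ⟨rfl, hb⟩ := not_prescribed.mp hi
    rcases eq_or_ne b j with rfl | hbj
    · linarith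
    rw [hhvv_of_prescribed hj, hhvv_self hb hbj.symm, D.ε_symm]
    linarith
  · obtain ⟨rfl, hb⟩ := not_prescribed.mp hj
    rcases eq_or_ne b i with rfl | hbi
    · linarith
    rw [hhvv_of_prescribed hi, hhvv_self hb hbi.symm, D.ε_symm]
    linarith
  · obtain ⟨rfl, -⟩ := not_prescribed.mp hi
    obtain ⟨rfl, -⟩ := not_prescribed.mp hj
    linarith

end HHVV

section HVVV

open Classical in
/-- The components in `(h a, v b, v c, v d)`. For `b = c = d ≠ o` they are determined by the
antisymmetrization in `(h a, v b)`, unless `a = b`. -/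
def hvvv (o : ι) (ε η : ι → ι → ι ⊕ ι → ι ⊕ ι → ℝ) (a b c d : ι) : ℝ :=
  if Prescribed o b c then ε b c (.inl a) (.inr d)
  else if c ≠ d then ε c d (.inl a) (.inr b)
  else if a ≠ b then ε a b (.inl b) (.inr b) + η a b (.inr b) (.inr b) else 0

theorem hvvv_of_prescribed {i j : ι} (h : Prescribed o i j) (a b : ι) :
    hvvv o ε η a i j b = ε i j (.inl a) (.inr b) := if_pos h

theorem hvvv_self {a b : ι} (hb : b ≠ o) (hab : a ≠ b) :
    hvvv o ε η a b b b = ε a b (.inl b) (.inr b) + η a b (.inr b) (.inr b) := by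
  rw [hvvv, if_neg (not_prescribed.mpr ⟨rfl, hb⟩), if_neg (not_not.mpr rfl), if_pos hab]

theorem hvvv_swap₂₃ (D : QuarticData o ε η κ) (a b c d : ι) :
    hvvv o ε η a b c d = hvvv o ε η a c b d := by
  rcases eq_or_ne b c with rfl | h
  · rfl
  · rw [hvvv_of_prescribed (prescribed_of_ne h), hvvv_of_prescribed (prescribed_of_ne h.symm),
      D.ε_symm]

theorem hvvv_swap₃₄ (D : QuarticData o ε η κ) (a b c d : ι) :
    hvvv o ε η a b c d = hvvv o ε η a b d c := by
  rcases eq_or_ne c d with rfl | h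
  · rfl
  by_cases hc : Prescribed o b c <;> by_cases hd : Prescribed o b d
  · rw [hvvv_of_prescribed hc, hvvv_of_prescribed hd, D.ε_swap_of_prescribed' _ hc hd]
  · obtain ⟨rfl, -⟩ := not_prescribed.mp hd
    rw [hvvv_of_prescribed hc, hvvv, if_neg hd, if_pos h.symm]
  · obtain ⟨rfl, -⟩ := not_prescribed.mp hc
    rw [hvvv_of_prescribed hd, hvvv, if_neg hc, if_pos h]
  · exact absurd ((not_prescribed.mp hc).1.symm.trans (not_prescribed.mp hd).1) h

theorem hvvv_sub_of_prescribed (D : QuarticData o ε η κ) {i j a : ι} (hi : Prescribed o a i)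
    (hj : Prescribed o a j) (b : ι) :
    hvvv o ε η i j a b - hvvv o ε η j i a b = η i j (.inr a) (.inr b) := by
  rw [D.hvvv_swap₂₃, hvvv_of_prescribed hj, D.hvvv_swap₂₃, hvvv_of_prescribed hi]
  linarith [D.mixed_of_prescribed (.inr b) hi hj]

theorem hvvv_sub_self (D : QuarticData o ε η κ) {i j : ι} (hi : i ≠ o) (hij : i ≠ j) :
    hvvv o ε η i j i i - hvvv o ε η j i i i = η i j (.inr i) (.inr i) := by
  rw [hvvv_self hi hij.symm, hvvv_of_prescribed (prescribed_of_ne hij.symm), D.η_antisymm i j]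
  ring

theorem hvvv_sub_cross (D : QuarticData o ε η κ) {i j : ι} (hij : i ≠ j) :
    hvvv o ε η i j i j - hvvv o ε η j i i j = η i j (.inr i) (.inr j) := by
  rw [D.hvvv_swap₃₄ j, hvvv_of_prescribed (prescribed_of_ne hij),
    hvvv_of_prescribed (prescribed_of_ne hij.symm), D.ε_symm j i, D.ε_swap i j (.inl j)]
  linarith [D.quadratic i j hij]

theorem hvvv_sub (D : QuarticData o ε η κ) (i j a b : ι) :
    hvvv o ε η i j a b - hvvv o ε η j i a b = η i j (.inr a) (.inr b) := by
  rcases eq_or_ne i j with rfl | hij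
  · linarith [D.η_antisymm i i (.inr a) (.inr b)]
  by_cases ha : Prescribed o a i ∧ Prescribed o a j
  · exact D.hvvv_sub_of_prescribed ha.1 ha.2 b
  by_cases hb : Prescribed o b i ∧ Prescribed o b j
  · rw [D.hvvv_swap₃₄, D.hvvv_swap₃₄ j, D.η_swap]
    exact D.hvvv_sub_of_prescribed hb.1 hb.2 a
  rw [not_and_or, not_prescribed, not_prescribed] at ha hb
  rcases ha with ⟨rfl, ha⟩ | ⟨rfl, ha⟩ <;> rcases hb with ⟨rfl, -⟩ | ⟨rfl, -⟩
  · exact D.hvvv_sub_self ha hij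
  · exact D.hvvv_sub_cross hij
  · linarith [D.hvvv_sub_cross hij.symm, D.η_antisymm b a (.inr a) (.inr b)]
  · linarith [D.hvvv_sub_self ha hij.symm, D.η_antisymm i b (.inr b) (.inr b)]

end HVVV

section VVVV

open Classical in
/-- The components in `(v a, v b, v c, v d)`. -/
def vvvv (o : ι) (ε : ι → ι → ι ⊕ ι → ι ⊕ ι → ℝ) (a b c d : ι) : ℝ :=
  if Prescribed o a b then ε a b (.inr c) (.inr d)
  else if b ≠ c then ε b c (.inr a) (.inr d)
  else if c ≠ d then ε c d (.inr a) (.inr b) else 0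

theorem vvvv_of_prescribed {i j : ι} (h : Prescribed o i j) (a b : ι) :
    vvvv o ε i j a b = ε i j (.inr a) (.inr b) := if_pos h

theorem vvvv_swap₁₂ (D : QuarticData o ε η κ) (a b c d : ι) :
    vvvv o ε a b c d = vvvv o ε b a c d := by
  rcases eq_or_ne a b with rfl | h
  · rfl
  · rw [vvvv_of_prescribed (prescribed_of_ne h), vvvv_of_prescribed (prescribed_of_ne h.symm),
      D.ε_symm]

theorem vvvv_swap₂₃ (D : QuarticData o ε η κ) (a b c d : ι) :
    vvvv o ε a b c d = vvvv o ε a c b d := by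
  rcases eq_or_ne b c with rfl | h
  · rfl
  by_cases hb : Prescribed o a b <;> by_cases hc : Prescribed o a c
  · rw [vvvv_of_prescribed hb, vvvv_of_prescribed hc, D.ε_swap_of_prescribed _ hb hc]
  · obtain ⟨rfl, -⟩ := not_prescribed.mp hc
    rw [vvvv_of_prescribed hb, vvvv, if_neg hc, if_pos h.symm]
  · obtain ⟨rfl, -⟩ := not_prescribed.mp hb
    rw [vvvv_of_prescribed hc, vvvv, if_neg hb, if_pos h]
  · exact absurd ((not_prescribed.mp hb).1.symm.trans (not_prescribed.mp hc).1) h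

theorem vvvv_swap₃₄ (D : QuarticData o ε η κ) (a b c d : ι) :
    vvvv o ε a b c d = vvvv o ε a b d c := by
  rcases eq_or_ne c d with rfl | h
  · rfl
  by_cases hb : Prescribed o a b
  · rw [vvvv_of_prescribed hb, vvvv_of_prescribed hb, D.ε_swap]
  obtain ⟨rfl, -⟩ := not_prescribed.mp hb
  rcases eq_or_ne a c with rfl | hc
  · simp [vvvv, hb, h]
  rcases eq_or_ne a d with rfl | hd
  · simp [vvvv, hb, hc]
  simp [vvvv, hb, hc, hd,
    D.ε_swap_of_prescribed' (.inr a) (prescribed_of_ne hc) (prescribed_of_ne hd)]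

end VVVV

section Quartic

/-- A symmetric quartic form with the prescribed components. -/
def quartic (o : ι) (ε η : ι → ι → ι ⊕ ι → ι ⊕ ι → ℝ) (κ : ι ⊕ ι → ι ⊕ ι → ι ⊕ ι → ℝ) :
    ι ⊕ ι → ι ⊕ ι → ι ⊕ ι → ι ⊕ ι → ℝ
  | .inl _, .inl _, .inl _, .inl _ => 0
  | .inl a, .inl b, .inl c, .inr d => hhhv o η κ a b c d
  | .inl a, .inl b, .inr c, .inl d => hhhv o η κ a b d c
  | .inl a, .inr b, .inl c, .inl d => hhhv o η κ a c d b
  | .inr a, .inl b, .inl c, .inl d => hhhv o η κ b c d a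
  | .inl a, .inl b, .inr c, .inr d => hhvv o ε η a b c d
  | .inl a, .inr b, .inl c, .inr d => hhvv o ε η a c b d
  | .inl a, .inr b, .inr c, .inl d => hhvv o ε η a d b c
  | .inr a, .inl b, .inl c, .inr d => hhvv o ε η b c a d
  | .inr a, .inl b, .inr c, .inl d => hhvv o ε η b d a c
  | .inr a, .inr b, .inl c, .inl d => hhvv o ε η c d a b
  | .inl a, .inr b, .inr c, .inr d => hvvv o ε η a b c d
  | .inr a, .inl b, .inr c, .inr d => hvvv o ε η b a c d
  | .inr a, .inr b, .inl c, .inr d => hvvv o ε η c a b d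
  | .inr a, .inr b, .inr c, .inl d => hvvv o ε η d a b c
  | .inr a, .inr b, .inr c, .inr d => vvvv o ε a b c d

theorem quartic_swap₁₂ (D : QuarticData o ε η κ) (a b c d : ι ⊕ ι) :
    quartic o ε η κ a b c d = quartic o ε η κ b a c d := by
  rcases a with a | a <;> rcases b with b | b <;> rcases c with c | c <;> rcases d with d | d <;>
    first
      | rfl
      | exact D.hhhv_swap₁₂ ..
      | exact D.hhvv_swap₁₂ ..
      | exact D.hhvv_swap₃₄ ..
      | exact D.hvvv_swap₂₃ ..
      | exact D.vvvv_swap₁₂ ..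

theorem quartic_swap₂₃ (D : QuarticData o ε η κ) (a b c d : ι ⊕ ι) :
    quartic o ε η κ a b c d = quartic o ε η κ a c b d := by
  rcases a with a | a <;> rcases b with b | b <;> rcases c with c | c <;> rcases d with d | d <;>
    first
      | rfl
      | exact D.hhhv_swap₁₂ ..
      | exact D.hhhv_swap₂₃ ..
      | exact D.hhvv_swap₁₂ ..
      | exact D.hhvv_swap₃₄ ..
      | exact D.hvvv_swap₂₃ ..
      | exact D.hvvv_swap₃₄ ..
      | exact D.vvvv_swap₂₃ ..

theorem quartic_swap₃₄ (D : QuarticData o ε η κ) (a b c d : ι ⊕ ι) :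
    quartic o ε η κ a b c d = quartic o ε η κ a b d c := by
  rcases a with a | a <;> rcases b with b | b <;> rcases c with c | c <;> rcases d with d | d <;>
    first
      | rfl
      | exact D.hhhv_swap₂₃ ..
      | exact D.hhvv_swap₁₂ ..
      | exact D.hhvv_swap₃₄ ..
      | exact D.hvvv_swap₃₄ ..
      | exact D.vvvv_swap₃₄ ..

theorem quartic_pair_swap (D : QuarticData o ε η κ) (a b c d : ι ⊕ ι) :
    quartic o ε η κ a b c d = quartic o ε η κ c d a b := by
  rw [D.quartic_swap₂₃, D.quartic_swap₁₂, D.quartic_swap₃₄, D.quartic_swap₂₃]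

theorem quartic_sub (D : QuarticData o ε η κ) (i j : ι) (a b : ι ⊕ ι) :
    quartic o ε η κ a b (.inl i) (.inr j) - quartic o ε η κ a b (.inl j) (.inr i) = η i j a b := by
  rw [D.quartic_pair_swap a, D.quartic_pair_swap a, D.quartic_swap₂₃, D.quartic_swap₂₃ (.inl j)]
  rcases a with a | a <;> rcases b with b | b
  · rw [D.quartic_swap₃₄, D.quartic_swap₃₄ (.inl j)]
    exact D.hhhv_sub i j a b
  · rw [D.quartic_swap₃₄, D.quartic_swap₃₄ (.inl j)]
    exact D.hhvv_sub i j a b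
  · rw [D.quartic_swap₃₄, D.quartic_swap₃₄ (.inl j), D.quartic_swap₂₃, D.quartic_swap₂₃ (.inl j),
      D.η_swap]
    exact D.hhvv_sub i j b a
  · rw [D.quartic_swap₂₃, D.quartic_swap₂₃ (.inl j)]
    exact D.hvvv_sub i j a b

theorem quartic_of_prescribed (D : QuarticData o ε η κ) {i j : ι} (h : Prescribed o i j)
    (a b : ι ⊕ ι) : quartic o ε η κ a b (.inr i) (.inr j) = ε i j a b := by
  rcases a with a | a <;> rcases b with b | b
  · exact hhvv_of_prescribed h a b
  · rw [D.quartic_swap₂₃, D.quartic_swap₃₄]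
    exact hvvv_of_prescribed h a b
  · rw [D.quartic_swap₁₂, D.quartic_swap₂₃, D.quartic_swap₃₄, D.ε_swap]
    exact hvvv_of_prescribed h b a
  · rw [D.quartic_pair_swap]
    exact vvvv_of_prescribed h a b

theorem quartic_base (D : QuarticData o ε η κ) (a b c : ι ⊕ ι) :
    quartic o ε η κ a b c (.inr o) = κ a b c := by
  have vertical (c : ι) (a b : ι ⊕ ι) :
      quartic o ε η κ a b (.inr c) (.inr o) = κ a b (.inr c) := by
    rw [D.quartic_swap₃₄, D.quartic_of_prescribed (prescribed_base o c), D.ε_base, D.κ_swap₁₂,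
      D.κ_swap₂₃]
  rcases c with c | c
  · rcases b with b | b
    · rcases a with a | a
      · exact hhhv_base a b c
      · rw [D.quartic_swap₁₂, D.quartic_swap₂₃, vertical, D.κ_swap₂₃, D.κ_swap₁₂]
    · rw [D.quartic_swap₂₃, vertical, D.κ_swap₂₃]
  · exact vertical c a b

end Quartic

end QuarticData

section Hessian

variable {κ A L : Type*} [CommRing A] [LieRing L] [LieRingModule L A] [Algebra ℝ A]
  {ev : A →ₐ[ℝ] ℝ} {p : κ → L} {f : A}

/-- The second derivatives of `f` along the fields `p` at the point where `ev` evaluates. -/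
def hess (ev : A →ₐ[ℝ] ℝ) (p : κ → L) (f : A) (a b : κ) : ℝ := ev ⁅p a, ⁅p b, f⁆⁆

theorem ZeroJet.hess_comm (hf : ZeroJet L ev 1 f) (a b : κ) : hess ev p f a b = hess ev p f b a :=
  hf.ev_lie_lie_comm _ _

theorem hess_neg (a b : κ) : hess ev p (-f) a b = -hess ev p f a b := by
  simp only [hess, lie_neg, map_neg]

theorem ZeroJet.hess_lie_comm (hf : ZeroJet L ev 2 f) (a b c : κ) :
    hess ev p ⁅p c, f⁆ a b = hess ev p ⁅p b, f⁆ a c := by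
  have := ((hf.lie ⁅p b, p c⁆).lie (p a)).ev_eq_zero
  rwa [lie_lie, lie_sub, map_sub, sub_eq_zero] at this

end Hessian

namespace SprayAlgebra

variable {ι A L : Type*} [Fintype ι] [DecidableEq ι] [CommRing A] [LieRing L] [Module A L]
  [LieRingModule L A] [LieRinehartRing A L] [Algebra ℝ A]

section LiftData

variable (T : SprayAlgebra ι A L) (ev : A →ₐ[ℝ] ℝ) (e : ι → L) (o : ι) (F : A)

open Classical QuarticData in
/-- The fourth derivatives along `J (e i)`, `J (e j)` of a correction of `F` which makes the second
derivatives of `Ω(J (e i), e j)` zero. -/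
def verticalData (i j : ι) (a b : ι ⊕ ι) : ℝ :=
  if Prescribed o i j then -hess ev (T.frame e) (T.Om F (T.J (e i)) (e j)) a b else 0

/-- The antisymmetrization in `i`, `j` of the fourth derivatives along `e i`, `J (e j)` of a
correction of `F` which makes the second derivatives of `Ω(e i, e j)` zero. -/
def horizontalData (i j : ι) (a b : ι ⊕ ι) : ℝ :=
  -hess ev (T.frame e) (T.Om F (e i) (e j)) a b

/-- The fourth derivatives along `C` of a correction of `F` which makes the third derivatives of
`C F - F` zero. -/
def homogeneityData (a b c : ι ⊕ ι) : ℝ :=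
  -hess ev (T.frame e) ⁅T.frame e c, ⁅T.C, F⁆ - F⁆ a b

variable {T ev e o F}

theorem verticalData_of_prescribed {i j : ι} (h : QuarticData.Prescribed o i j) (a b : ι ⊕ ι) :
    T.verticalData ev e o F i j a b = -hess ev (T.frame e) (T.Om F (T.J (e i)) (e j)) a b :=
  if_pos h

theorem verticalData_symm (i j : ι) (a b : ι ⊕ ι) :
    T.verticalData ev e o F i j a b = T.verticalData ev e o F j i a b := by
  rcases eq_or_ne i j with rfl | hij
  · rfl
  · rw [verticalData_of_prescribed (.inl hij), verticalData_of_prescribed (.inl hij.symm),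
      Om_J_symm]

end LiftData

theorem hess_Om {T : SprayAlgebra ι A L} {ev : A →ₐ[ℝ] ℝ} {Q : A} {κ : Type*} {p : κ → L}
    (hQ : ZeroJet L ev 3 Q) (a b : κ) (X Y : L) :
    hess ev p (T.Om Q X Y) a b =
      ev ⁅p a, ⁅p b, ⁅X, ⁅T.J Y, Q⁆⁆⁆⁆ - ev ⁅p a, ⁅p b, ⁅Y, ⁅T.J X, Q⁆⁆⁆⁆ := by
  have := (((hQ.lie (T.J ⁅X, Y⁆)).lie (p b)).lie (p a)).ev_eq_zero
  simp only [hess, Om_apply, lie_sub, map_sub, this, sub_zero]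

variable [LieAlgebra ℝ L] [LieRinehartAlgebra ℝ A L]
  {T : SprayAlgebra ι A L} {ev : A →ₐ[ℝ] ℝ} {lam : ι → A} {e : ι → L} {o : ι} {F G Q : A} {l : ℕ}

namespace EigenFrame

theorem J_base (h : T.EigenFrame ev lam e o) : T.J (e o) = T.C := by rw [h.spray, J_S]

theorem zeroJet_Om (h : T.EigenFrame ev lam e o) (hF : T.IsSolution ev l F) (i j : ι) :
    ZeroJet L ev l (T.Om F (e i) (e j)) :=
  hF.zeroJet_Om_hor (h.eigenvector i).hor_eq (h.eigenvector j).hor_eq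

section LiftData

variable (h : T.EigenFrame ev lam e o) (hF : T.IsSolution ev 1 F)
include h hF

theorem horizontalData_swap (i j : ι) (a b : ι ⊕ ι) :
    T.horizontalData ev e F i j a b = T.horizontalData ev e F i j b a :=
  congrArg Neg.neg ((h.zeroJet_Om hF i j).hess_comm a b)

theorem zeroJet_lieCyclic_base (k : ι) : ZeroJet L ev 1 (lieCyclic (T.Om F) T.C T.S (e k)) := by
  have horizontal : T.hor ⁅T.C, e k⁆ = ⁅T.C, e k⁆ := by
    rw [← C_lie_hor, (h.eigenvector k).hor_eq]
  rw [lieCyclic, C_lie_S, Om_swap T F ⁅T.S, e k⁆, Om_C, ← lie_skew (e k), map_neg,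
    LinearMap.neg_apply]
  exact ((hF.zeroJet_Om_hor T.hor_S (h.eigenvector k).hor_eq).add (hF.homogeneity.lie _).neg).add
    (hF.zeroJet_Om_hor horizontal T.hor_S).neg

theorem horizontalData_cyclic (hc : T.FirstCondition ev e F) (i j k : ι) (a : ι ⊕ ι) :
    T.horizontalData ev e F i j (.inl k) a + T.horizontalData ev e F j k (.inl i) a
      + T.horizontalData ev e F k i (.inl j) a = 0 := by
  have closed : ZeroJet L ev 1 (⁅e i, T.Om F (e j) (e k)⁆ + ⁅e j, T.Om F (e k) (e i)⁆
      + ⁅e k, T.Om F (e i) (e j)⁆) := by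
    have curv := hc.curv_cond (e i) (e j) (e k)
    simp only [insertTwo_Om_curv, (h.eigenvector _).hor_eq] at curv
    have := curv.add (ZeroJet.lieCyclic (β := (T.Om F).compl₁₂ T.hor T.hor)
      (fun X Y => hF.zeroJet_Om_hor (T.hor_hor X) (T.hor_hor Y)) (e i) (e j) (e k))
    rw [extDerivTwo, sub_add_cancel] at this
    simpa only [LinearMap.compl₁₂_apply, (h.eigenvector _).hor_eq] using this
  have second_deriv := (closed.lie (T.frame e a)).ev_eq_zero
  simp only [lie_add, map_add] at second_deriv
  rw [horizontalData, horizontalData, horizontalData, (h.zeroJet_Om hF i j).hess_comm,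
    (h.zeroJet_Om hF j k).hess_comm, (h.zeroJet_Om hF k i).hess_comm]
  simp only [hess, frame_inl]
  linear_combination -second_deriv

theorem verticalData_base (i : ι) (a b : ι ⊕ ι) :
    T.verticalData ev e o F o i a b = T.homogeneityData ev e F (.inr i) a b := by
  rw [verticalData_of_prescribed (QuarticData.prescribed_base o i), h.J_base, Om_C,
    homogeneityData]
  exact congrArg Neg.neg ((hF.homogeneity.hess_lie_comm a b (.inr i)).trans
    ((hF.homogeneity.lie _).hess_comm a (.inr i)))

variable [IsLocalHom ev]

theorem zeroJet_Om_J {i j : ι} (hij : QuarticData.Prescribed o i j) :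
    ZeroJet L ev 1 (T.Om F (T.J (e i)) (e j)) := by
  rcases hij with hij | rfl
  · exact hF.zeroJet_Om_J (h.eigenvector i) (h.eigenvector j) (h.distinct i j hij)
  · rw [h.J_base, Om_C]
    exact hF.homogeneity.lie _

theorem verticalData_swap (i j : ι) (a b : ι ⊕ ι) :
    T.verticalData ev e o F i j a b = T.verticalData ev e o F i j b a := by
  rw [verticalData, verticalData]
  split_ifs with hij
  · rw [(h.zeroJet_Om_J hF hij).hess_comm]
  · rfl

theorem verticalData_cyclic (hc : T.FirstCondition ev e F) {i j k : ι} (hjk : j ≠ k)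
    (hik : i ≠ k) (a : ι ⊕ ι) :
    T.verticalData ev e o F j k (.inr i) a = T.verticalData ev e o F k i (.inr j) a := by
  have second_deriv := ((hc.zeroJet_lie_J_sub hF (h.eigenvector k) (h.eigenvector i)
    (h.eigenvector j) (h.distinct k i hik.symm) (h.distinct j k hjk)).lie
    (T.frame e a)).ev_eq_zero
  rw [lie_sub, map_sub] at second_deriv
  rw [verticalData_of_prescribed (.inl hjk), verticalData_of_prescribed (.inl hik.symm),
    (h.zeroJet_Om_J hF (.inl hjk)).hess_comm, (h.zeroJet_Om_J hF (.inl hik.symm)).hess_comm]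
  simp only [hess, frame_inr]
  linear_combination -second_deriv

theorem horizontalData_sub_verticalData {i j k : ι} (hij : QuarticData.Prescribed o i j)
    (hik : QuarticData.Prescribed o i k)
    (hijk : ZeroJet L ev 1 (lieCyclic (T.Om F) (T.J (e i)) (e j) (e k))) (a : ι ⊕ ι) :
    T.horizontalData ev e F j k (.inr i) a - T.verticalData ev e o F i k (.inl j) a
      + T.verticalData ev e o F i j (.inl k) a = 0 := by
  have second_deriv := (hijk.lie (T.frame e a)).ev_eq_zero
  rw [lieCyclic_Om, Om_swap T F (e k)] at second_deriv
  simp only [lie_add, lie_neg, map_add, map_neg] at second_deriv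
  rw [verticalData_of_prescribed hik, verticalData_of_prescribed hij, horizontalData,
    (h.zeroJet_Om_J hF hik).hess_comm, (h.zeroJet_Om_J hF hij).hess_comm,
    (h.zeroJet_Om hF j k).hess_comm]
  simp only [hess, frame_inr, frame_inl]
  linear_combination -second_deriv

theorem quarticData (hc : T.FirstCondition ev e F)
    (ht : ∀ i j, i ≠ j → T.ThirdOrderCondition ev F (e i) (e j)) :
    QuarticData o (T.verticalData ev e o F) (T.horizontalData ev e F)
      (T.homogeneityData ev e F) where
  κ_swap₁₂ a b c := congrArg Neg.neg ((hF.homogeneity.lie _).hess_comm a b)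
  κ_swap₂₃ a b c := congrArg Neg.neg (hF.homogeneity.hess_lie_comm a b c)
  ε_symm := verticalData_symm
  ε_swap := h.verticalData_swap hF
  η_antisymm i j a b := by rw [horizontalData, Om_swap, hess_neg, horizontalData]
  η_swap := h.horizontalData_swap hF
  ε_base := h.verticalData_base hF
  cyclic_η := h.horizontalData_cyclic hF hc
  cyclic_ε _ _ _ a _ hjk hik := h.verticalData_cyclic hF hc hjk hik a
  mixed i j k a hij hjk hik :=
    h.horizontalData_sub_verticalData hF (.inl hij) (.inl hik) (hc.frame_cond i j k hij hjk hik) a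
  mixed_base k a := h.horizontalData_sub_verticalData hF (.inr rfl) (.inr rfl)
    (by rw [h.J_base, h.spray]; exact h.zeroJet_lieCyclic_base hF k) a
  quadratic i j hij := by
    have := (hF.thirdOrderCondition_iff (h.eigenvector i) (h.eigenvector j)
      (h.distinct i j hij)).mp (ht i j hij)
    rw [verticalData_of_prescribed (.inl hij), verticalData_of_prescribed (.inl hij),
      horizontalData]
    simp only [hess, frame_inr, frame_inl]
    linear_combination -this

end LiftData

variable [IsLocalHom ev]

theorem isSolution (h : T.EigenFrame ev lam e o)
    (homogeneity : ZeroJet L ev (l + 1) (⁅T.C, F⁆ - F))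
    (horizontal : ∀ i j, ZeroJet L ev l (T.Om F (e i) (e j)))
    (vertical : ∀ i j, i ≠ j → ZeroJet L ev l (T.Om F (T.J (e i)) (e j))) :
    T.IsSolution ev l F := by
  have conn_eq (i) : T.conn (e i) = e i := by rw [← (h.eigenvector i).hor_eq, conn_hor]
  refine ⟨homogeneity, zeroJet_bilinear_of_span h.span_eq_top ?_,
    zeroJet_bilinear_of_span h.span_eq_top ?_⟩
  · rintro (i | i) (j | j)
    · simpa [insertOne_apply, conn_eq] using (horizontal i j).add (horizontal i j)
    all_goals simp [insertOne_apply, conn_eq, conn_J, Om_J_J, ZeroJet.zero]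
  · rintro (i | i) (j | j)
    · rw [frame_inl, frame_inl, (h.eigenvector i).insertOne_jacobi (h.eigenvector j)]
      rcases eq_or_ne i j with rfl | hij
      · simp [ZeroJet.zero]
      · exact (vertical i j hij).mul_left _
    all_goals simp [insertOne_apply, jacobi_J, Om_jacobi_J, Om_J_jacobi, ZeroJet.zero]

theorem zeroJet_Om_add_of_hess (h : T.EigenFrame ev lam e o) (hQ : ZeroJet L ev 3 Q)
    {X Y : L} (hXY : ZeroJet L ev 1 (T.Om F X Y))
    (hhess : ∀ a b, hess ev (T.frame e) (T.Om Q X Y) a b = -hess ev (T.frame e) (T.Om F X Y) a b) :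
    ZeroJet L ev 2 (T.Om (F + Q) X Y) := by
  rw [Om_add_fun]
  refine zeroJet_two_of_span h.span_eq_top (hXY.add (T.zeroJet_Om hQ _ _)) fun a b => ?_
  rw [lie_add, lie_add, map_add]
  exact eq_neg_iff_add_eq_zero.mp (hhess a b) ▸ add_comm _ _

theorem zeroJet_homogeneity_add (h : T.EigenFrame ev lam e o) (hF : T.IsSolution ev 1 F)
    (hQ : ZeroJet L ev 3 Q)
    (hbase : ∀ a b c, ev ⁅T.frame e a, ⁅T.frame e b, ⁅T.frame e c, ⁅T.C, Q⁆⁆⁆⁆ =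
      T.homogeneityData ev e F a b c) :
    ZeroJet L ev 3 (⁅T.C, F + Q⁆ - (F + Q)) := by
  have split : ⁅T.C, F + Q⁆ - (F + Q) = (⁅T.C, F⁆ - F) + (⁅T.C, Q⁆ - Q) := by
    rw [lie_add]
    ring
  rw [split]
  refine zeroJet_three_of_span h.span_eq_top
    (hF.homogeneity.add ((hQ.lie _).sub hQ.of_succ)) fun a b c => ?_
  have third_deriv :=
    (((hQ.lie (T.frame e c)).lie (T.frame e b)).lie (T.frame e a)).ev_eq_zero
  have base := hbase a b c
  simp only [homogeneityData, hess] at base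
  simp only [lie_add, lie_sub, map_add, map_sub] at base ⊢
  linear_combination base - third_deriv

theorem exists_lift (h : T.EigenFrame ev lam e o) (hF : T.IsSolution ev 1 F)
    (hc : T.FirstCondition ev e F)
    (ht : ∀ i j, i ≠ j → T.ThirdOrderCondition ev F (e i) (e j)) :
    ∃ G, ZeroJet L ev 3 (G - F) ∧ T.IsSolution ev 2 G := by
  have D := h.quarticData hF hc ht
  obtain ⟨ξ, hξ, dual⟩ := h.exists_dual
  obtain ⟨Q, hQ, hess_Q⟩ :=
    exists_leadingForm_four hξ dual D.quartic_swap₁₂ D.quartic_swap₂₃ D.quartic_swap₃₄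
  refine ⟨F + Q, by rwa [add_sub_cancel_left], h.isSolution ?_ (fun i j => ?_) fun i j hij => ?_⟩
  · refine h.zeroJet_homogeneity_add hF hQ fun a b c => ?_
    rw [← D.quartic_base, ← hess_Q, frame_inr, h.J_base]
  · refine h.zeroJet_Om_add_of_hess hQ (h.zeroJet_Om hF i j) fun a b => ?_
    rw [hess_Om hQ, ← horizontalData, ← D.quartic_sub, ← hess_Q, ← hess_Q]
    rfl
  · refine h.zeroJet_Om_add_of_hess hQ (h.zeroJet_Om_J hF (.inl hij)) fun a b => ?_
    rw [hess_Om hQ, ← verticalData_of_prescribed (.inl hij),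
      ← D.quartic_of_prescribed (.inl hij), ← hess_Q, J_J]
    simp

end EigenFrame

end SprayAlgebra

section VectorField

variable {E : Type*} [NormedAddCommGroup E] [NormedSpace ℝ E]
  {H : Type*} [TopologicalSpace H] {I : ModelWithCorners ℝ E H}
  {N : Type*} [TopologicalSpace N] [ChartedSpace H N]
  {X Y Z : ∀ p : N, TangentSpace I p} {f g : N → ℝ} {x p : N}

/-- The derivative of a function along a vector field. -/
def along (X : ∀ p : N, TangentSpace I p) (f : N → ℝ) (p : N) : ℝ :=
  mvfderiv I f p (X p)

/-- The derivative at `p` of the preferred chart at `x`. -/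
def chartDeriv (I : ModelWithCorners ℝ E H) (x p : N) : TangentSpace I p →L[ℝ] E :=
  mfderiv I 𝓘(ℝ, E) (extChartAt I x) p

/-- The vector field near `x` that is constant equal to `v` in the preferred chart at `x`. -/
def coordField (I : ModelWithCorners ℝ E H) (x : N) (v : E) (p : N) : TangentSpace I p :=
  (chartDeriv I x p).inverse v

theorem along_congr (h : f =ᶠ[𝓝 p] g) : along X f p = along X g p := by
  simp only [along, mvfderiv, h.mfderiv_eq]
  rfl

theorem along_congr_field (f : N → ℝ) (h : X p = Y p) : along X f p = along Y f p :=
  congrArg (mvfderiv I f p) h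

theorem along_add (hf : MDifferentiableAt I 𝓘(ℝ, ℝ) f p) (hg : MDifferentiableAt I 𝓘(ℝ, ℝ) g p) :
    along X (f + g) p = along X f p + along X g p :=
  congr($(mvfderiv_add hf hg) (X p))

theorem along_mul (hf : MDifferentiableAt I 𝓘(ℝ, ℝ) f p) (hg : MDifferentiableAt I 𝓘(ℝ, ℝ) g p) :
    along X (f * g) p = f p * along X g p + g p * along X f p :=
  congr($(mvfderiv_mul hf hg) (X p))

theorem along_const (X : ∀ p : N, TangentSpace I p) (c : ℝ) (p : N) :
    along X (fun _ => c) p = 0 :=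
  congr($(mvfderiv_const c) (X p))

theorem along_add_field (X Y : ∀ p : N, TangentSpace I p) (f : N → ℝ) :
    along (X + Y) f = along X f + along Y f :=
  funext fun p => map_add (mvfderiv I f p) (X p) (Y p)

theorem along_smul_field (g : N → ℝ) (X : ∀ p : N, TangentSpace I p) (f : N → ℝ) :
    along (g • X) f = g * along X f :=
  funext fun p => map_smul (mvfderiv I f p) (g p) (X p)

section Chart

variable [IsManifold I 1 N]

theorem along_comp_extChartAt {f : E → ℝ} (hp : p ∈ (extChartAt I x).source)
    (hf : DifferentiableAt ℝ f (extChartAt I x p)) (X : ∀ p : N, TangentSpace I p) :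
    along X (f ∘ extChartAt I x) p =
      fderiv ℝ f (extChartAt I x p) (chartDeriv I x p (X p)) := by
  have chain := mfderiv_comp p hf.mdifferentiableAt
    (mdifferentiableAt_extChartAt (I := I) (by rwa [extChartAt_source] at hp))
  rw [mfderiv_eq_fderiv] at chain
  exact congr($chain (X p))

theorem along_eq_fderiv [I.Boundaryless] (hp : p ∈ (extChartAt I x).source)
    (hf : MDifferentiableAt I 𝓘(ℝ, ℝ) f p) (X : ∀ p : N, TangentSpace I p) :
    along X f p = fderiv ℝ (f ∘ (extChartAt I x).symm) (extChartAt I x p)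
      (chartDeriv I x p (X p)) := by
  have local_eq : f =ᶠ[𝓝 p] (f ∘ (extChartAt I x).symm) ∘ extChartAt I x := by
    filter_upwards [extChartAt_source_mem_nhds' hp] with q hq
    simp only [Function.comp_apply, (extChartAt I x).left_inv hq]
  rw [along_congr local_eq, along_comp_extChartAt hp]
  refine mdifferentiableAt_iff_differentiableAt.1
    (MDifferentiableAt.comp (I' := I) _ ?_ (mdifferentiableOn_extChartAt_symm.mdifferentiableAt
      (extChartAt_target_mem_nhds' ((extChartAt I x).map_source hp))))
  rwa [(extChartAt I x).left_inv hp]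

theorem chartDeriv_coordField (hp : p ∈ (extChartAt I x).source) (v : E) :
    chartDeriv I x p (coordField I x v p) = v :=
  (isInvertible_mfderiv_extChartAt hp).self_apply_inverse v

theorem coordField_chartDeriv (hp : p ∈ (extChartAt I x).source) (w : TangentSpace I p) :
    coordField I x (chartDeriv I x p w) p = w :=
  (isInvertible_mfderiv_extChartAt hp).inverse_apply_self w

theorem chartDeriv_velocity [I.Boundaryless] {c : ℝ → N} {t : ℝ} {v : E}
    (hc : ∀ᶠ s in 𝓝 t, c s ∈ (extChartAt I x).source)
    (hv : HasDerivAt (extChartAt I x ∘ c) v t) (hp : c t = p) :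
    chartDeriv I x p (mfderiv 𝓘(ℝ, ℝ) I c t (1 : ℝ)) = v := by
  subst hp
  have hct := hc.self_of_nhds
  have local_eq : c =ᶠ[𝓝 t] (extChartAt I x).symm ∘ (extChartAt I x ∘ c) :=
    hc.mono fun s hs => ((extChartAt I x).left_inv hs).symm
  have differentiable : MDifferentiableAt 𝓘(ℝ, ℝ) I c t :=
    MDifferentiableAt.congr_of_eventuallyEq (MDifferentiableAt.comp (I' := 𝓘(ℝ, E)) _
      (mdifferentiableOn_extChartAt_symm.mdifferentiableAt
        (extChartAt_target_mem_nhds' ((extChartAt I x).map_source hct)))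
      hv.differentiableAt.mdifferentiableAt) local_eq
  have chain := mfderiv_comp t
    (mdifferentiableAt_extChartAt (I := I) (by rwa [extChartAt_source] at hct)) differentiable
  rw [mfderiv_eq_fderiv] at chain
  refine (congr($chain (1 : ℝ))).symm.trans ?_
  rw [hv.hasFDerivAt.fderiv]
  exact one_smul ℝ v

end Chart

variable [IsManifold I ∞ N]

/-- The section of the tangent bundle given by the vector field `X` is smooth at `p`. -/
abbrev SmoothFieldAt (X : ∀ p : N, TangentSpace I p) (p : N) : Prop :=
  ContMDiffAt I I.tangent ∞ (fun q => (⟨q, X q⟩ : TangentBundle I N)) p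

theorem contMDiffAt_along (hf : ContMDiffAt I 𝓘(ℝ, ℝ) ∞ f p) (hX : SmoothFieldAt X p) :
    ContMDiffAt I 𝓘(ℝ, ℝ) ∞ (along X f) p := by
  have smooth_mfderiv : ContMDiffAt I 𝓘(ℝ, E →L[ℝ] ℝ) ∞
      (inTangentCoordinates I 𝓘(ℝ, ℝ) id f (mfderiv I 𝓘(ℝ, ℝ) f) p) p :=
    hf.mfderiv_const (by simp)
  have smooth_apply := ContMDiffAt.clm_apply_of_inCoordinates (b₁ := id) (b₂ := f) (m₀ := p)
    (ϕ := fun q => mfderiv I 𝓘(ℝ, ℝ) f q) (v := X) smooth_mfderiv hX hf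
  exact (contMDiff_snd_tangentBundle_modelSpace ℝ 𝓘(ℝ, ℝ)).contMDiffAt.comp p smooth_apply

theorem SmoothFieldAt.add (hX : SmoothFieldAt X p) (hY : SmoothFieldAt Y p) :
    SmoothFieldAt (X + Y) p :=
  have : IsManifold I (∞ + 1) N := ‹IsManifold I ∞ N›
  hX.add_section hY

theorem SmoothFieldAt.smul (hf : ContMDiffAt I 𝓘(ℝ, ℝ) ∞ f p) (hX : SmoothFieldAt X p) :
    SmoothFieldAt (f • X) p :=
  have : IsManifold I (∞ + 1) N := ‹IsManifold I ∞ N›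
  hf.smul_section hX

theorem contDiffAt_comp_extChartAt_symm [I.Boundaryless] (hf : ContMDiffAt I 𝓘(ℝ, ℝ) ∞ f x) :
    ContDiffAt ℝ ∞ (f ∘ (extChartAt I x).symm) (extChartAt I x x) := by
  rw [← contMDiffAt_iff_contDiffAt]
  refine ContMDiffAt.comp (I' := I) _ ?_ ((contMDiffOn_extChartAt_symm x).contMDiffAt
    (extChartAt_target_mem_nhds x))
  rwa [extChartAt_to_inv]

theorem along_coordField_comp_extChartAt_symm [I.Boundaryless]
    (hf : ∀ᶠ q in 𝓝 x, ContMDiffAt I 𝓘(ℝ, ℝ) ∞ f q) (v : E) :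
    along (coordField I x v) f ∘ (extChartAt I x).symm =ᶠ[𝓝 (extChartAt I x x)]
      fun u => fderiv ℝ (f ∘ (extChartAt I x).symm) u v := by
  rw [← extChartAt_to_inv (I := I) x] at hf
  filter_upwards [(continuousAt_extChartAt_symm x).eventually hf,
    extChartAt_target_mem_nhds (I := I) x] with u hu hu_target
  have hu_source := (extChartAt I x).map_target hu_target
  rw [Function.comp_apply, along_eq_fderiv hu_source (hu.mdifferentiableAt (by simp)),
    chartDeriv_coordField hu_source, (extChartAt I x).right_inv hu_target]

variable [CompleteSpace E]

theorem smoothFieldAt_coordField (hp : p ∈ (extChartAt I x).source) (v : E) :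
    SmoothFieldAt (coordField I x v) p := by
  change SmoothFieldAt (VectorField.mpullback I 𝓘(ℝ, E) (extChartAt I x) fun _ => v) p
  refine ContMDiffAt.mpullback_vectorField_preimage (n := ∞) ?_ (contMDiffAt_extChartAt' ?_)
    (isInvertible_mfderiv_extChartAt hp) (by simp)
  · exact contMDiffAt_vectorSpace_iff_contDiffAt.2 contDiffAt_const
  · rwa [extChartAt_source] at hp

theorem eventually_smoothFieldAt_coordField (x : N) (v : E) :
    ∀ᶠ p in 𝓝 x, SmoothFieldAt (coordField I x v) p :=
  .mono (extChartAt_source_mem_nhds x) fun _ hp => smoothFieldAt_coordField hp v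

theorem SmoothFieldAt.mlieBracket (hX : SmoothFieldAt X p) (hY : SmoothFieldAt Y p) :
    SmoothFieldAt (VectorField.mlieBracket I X Y) p := by
  have : IsManifold I (∞ + 1) N := ‹IsManifold I ∞ N›
  have : IsManifold I (minSmoothness ℝ 2) N := by
    rw [minSmoothness_of_isRCLikeNormedField]; infer_instance
  exact ContMDiffAt.mlieBracket_vectorField (m := ⊤) (n := ⊤) hX hY
    (by rw [minSmoothness_of_isRCLikeNormedField]; simp)

theorem mlieBracket_mlieBracket_smul (hf : ∀ᶠ q in 𝓝 p, ContMDiffAt I 𝓘(ℝ, ℝ) ∞ f q)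
    (hY : SmoothFieldAt Y p) (hZ : ∀ᶠ q in 𝓝 p, SmoothFieldAt Z q) :
    VectorField.mlieBracket I X (VectorField.mlieBracket I Y (f • Z)) p =
      along X (along Y f) p • Z p + along Y f p • VectorField.mlieBracket I X Z p +
      (along X f p • VectorField.mlieBracket I Y Z p +
        f p • VectorField.mlieBracket I X (VectorField.mlieBracket I Y Z) p) := by
  have hf_p := hf.self_of_nhds
  have hZ_p := hZ.self_of_nhds
  have hYf := contMDiffAt_along hf_p hY
  have hYZ := hY.mlieBracket hZ_p
  have leibniz : VectorField.mlieBracket I Y (f • Z) =ᶠ[𝓝 p]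
      along Y f • Z + f • VectorField.mlieBracket I Y Z := by
    filter_upwards [hf, hZ] with q hf_q hZ_q
    exact VectorField.mlieBracket_smul_right (hf_q.mdifferentiableAt (by simp))
      (hZ_q.mdifferentiableAt (by simp))
  rw [EventuallyEq.mlieBracket_vectorField_eq (EventuallyEq.refl _ X) leibniz,
    VectorField.mlieBracket_add_right ((SmoothFieldAt.smul hYf hZ_p).mdifferentiableAt (by simp))
      ((SmoothFieldAt.smul hf_p hYZ).mdifferentiableAt (by simp)),
    VectorField.mlieBracket_smul_right (hYf.mdifferentiableAt (by simp))
      (hZ_p.mdifferentiableAt (by simp)),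
    VectorField.mlieBracket_smul_right (hf_p.mdifferentiableAt (by simp))
      (hYZ.mdifferentiableAt (by simp))]
  rfl

theorem exists_smoothFieldAt_ne_zero [Nontrivial E] (I : ModelWithCorners ℝ E H)
    [IsManifold I ∞ N] (x : N) :
    ∃ Z : ∀ p : N, TangentSpace I p, (∀ᶠ p in 𝓝 x, SmoothFieldAt Z p) ∧ Z x ≠ 0 := by
  obtain ⟨v, hv⟩ := exists_ne (0 : E)
  refine ⟨coordField I x v, eventually_smoothFieldAt_coordField x v, fun h => hv ?_⟩
  rw [← chartDeriv_coordField (I := I) (mem_extChartAt_source x) v, h, map_zero]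

/- Mathlib defines the bracket through charts. Expanding the Jacobi identity for `X`, `Y` and
`f • Z` by the Leibniz rule leaves the multiple of `Z` below, so a nonvanishing `Z` suffices. -/
theorem along_mlieBracket (hf : ∀ᶠ q in 𝓝 p, ContMDiffAt I 𝓘(ℝ, ℝ) ∞ f q)
    (hX : SmoothFieldAt X p) (hY : SmoothFieldAt Y p) :
    along (VectorField.mlieBracket I X Y) f p = along X (along Y f) p - along Y (along X f) p := by
  rcases subsingleton_or_nontrivial E with hE | hE
  · have along_eq_zero (W : ∀ p : N, TangentSpace I p) (g : N → ℝ) : along W g p = 0 := by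
      rw [along, show W p = 0 from hE.elim (α := E) _ _, map_zero]
    simp only [along_eq_zero, sub_zero]
  obtain ⟨Z, hZ, hZ_ne⟩ := exists_smoothFieldAt_ne_zero I p
  have hf_p := hf.self_of_nhds
  have hZ_p := hZ.self_of_nhds
  have : IsManifold I (minSmoothness ℝ 3) N := by
    rw [minSmoothness_of_isRCLikeNormedField]; infer_instance
  have two_le : minSmoothness ℝ 2 ≤ ∞ := by
    rw [minSmoothness_of_isRCLikeNormedField]; exact ENat.LEInfty.out
  have jacobi := VectorField.leibniz_identity_mlieBracket_apply (hX.of_le two_le)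
    (hY.of_le two_le) (hZ_p.of_le two_le)
  have jacobi_smul := VectorField.leibniz_identity_mlieBracket_apply (hX.of_le two_le)
    (hY.of_le two_le) ((SmoothFieldAt.smul hf_p hZ_p).of_le two_le)
  rw [mlieBracket_mlieBracket_smul hf hY hZ, mlieBracket_mlieBracket_smul hf hX hZ, jacobi,
    VectorField.mlieBracket_smul_right (hf_p.mdifferentiableAt (by simp))
      (hZ_p.mdifferentiableAt (by simp))] at jacobi_smul
  change _ = along (VectorField.mlieBracket I X Y) f p • Z p + _ + _ at jacobi_smul
  have multiple_of_Z : (along (VectorField.mlieBracket I X Y) f p -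
      (along X (along Y f) p - along Y (along X f) p)) • Z p = 0 := by
    linear_combination (norm := module) (-1 : ℝ) • jacobi_smul
  exact sub_eq_zero.1 ((smul_eq_zero.1 multiple_of_Z).resolve_right hZ_ne)

end VectorField

section Jet

variable {E : Type*} [NormedAddCommGroup E] [NormedSpace ℝ E]
  {F : Type*} [NormedAddCommGroup F] [NormedSpace ℝ F] {g : E → F} {a : E}

theorem iteratedFDeriv_fderiv_apply_const {j : ℕ} (hg : ContDiffAt ℝ (j + 1) g a) (v : E)
    (m : Fin j → E) :
    iteratedFDeriv ℝ j (fun u => fderiv ℝ g u v) a m = iteratedFDeriv ℝ j (fderiv ℝ g) a m v :=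
  congr($((ContinuousLinearMap.apply ℝ F v).iteratedFDeriv_comp_left
    (hg.fderiv_right le_rfl) le_rfl) m)

theorem iteratedFDeriv_succ_eq_zero_iff {j : ℕ} (hg : ContDiffAt ℝ (j + 1) g a) :
    iteratedFDeriv ℝ (j + 1) g a = 0 ↔
      ∀ v, iteratedFDeriv ℝ j (fun u => fderiv ℝ g u v) a = 0 := by
  rw [← norm_eq_zero, ← norm_iteratedFDeriv_fderiv, norm_eq_zero]
  refine ⟨fun h v => ?_, fun h => ?_⟩
  · ext m
    rw [iteratedFDeriv_fderiv_apply_const hg, h]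
    simp
  · ext m v
    rw [← iteratedFDeriv_fderiv_apply_const hg, h]
    simp

theorem iteratedFDeriv_zero_eq_zero_iff : iteratedFDeriv ℝ 0 g a = 0 ↔ g a = 0 := by
  rw [← norm_eq_zero, norm_iteratedFDeriv_zero, norm_eq_zero]

theorem forall_le_succ_iteratedFDeriv_eq_zero_iff {k : ℕ} (hg : ContDiffAt ℝ (k + 1) g a) :
    (∀ j ≤ k + 1, iteratedFDeriv ℝ j g a = 0) ↔
      g a = 0 ∧ ∀ v, ∀ j ≤ k, iteratedFDeriv ℝ j (fun u => fderiv ℝ g u v) a = 0 := by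
  have succ_iff {j : ℕ} (hj : j ≤ k) := iteratedFDeriv_succ_eq_zero_iff
    (hg.of_le (show (j + 1 : ℕ∞ω) ≤ k + 1 by exact_mod_cast Nat.succ_le_succ hj))
  constructor
  · intro h
    exact ⟨iteratedFDeriv_zero_eq_zero_iff.1 (h 0 (Nat.zero_le _)),
      fun v j hj => (succ_iff hj).1 (h _ (Nat.succ_le_succ hj)) v⟩
  · rintro ⟨h_zero, h_succ⟩ (_ | j) hj
    · exact iteratedFDeriv_zero_eq_zero_iff.2 h_zero
    · exact (succ_iff (Nat.le_of_succ_le_succ hj)).2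
        fun v => h_succ v j (Nat.le_of_succ_le_succ hj)

end Jet

/-- The model space of `TM`: base coordinates, then fibre coordinates. -/
abbrev ModelTM (n : ℕ) : Type := EuclideanSpace ℝ (Fin n) × EuclideanSpace ℝ (Fin n)

section TangentChart

variable {n : ℕ} {M : Type*} [TopologicalSpace M] [ChartedSpace (EuclideanSpace ℝ (Fin n)) M]
  [IsManifold (𝓡 n) ∞ M] {x p : TM n M}

theorem smoothNear_iff {f : TM n M → ℝ} :
    SmoothNear f x ↔ ∀ᶠ p in 𝓝 x, ContMDiffAt (𝓡 n).tangent 𝓘(ℝ, ℝ) ∞ f p := by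
  constructor
  · rintro ⟨U, hU, h⟩
    filter_upwards [eventually_mem_nhds_iff.2 hU] with p hp using h.contMDiffAt hp
  · exact fun h => ⟨_, h, fun p hp => hp.contMDiffWithinAt⟩

theorem smoothFieldNear_iff {X : VF n M} :
    SmoothFieldNear X x ↔ ∀ᶠ p in 𝓝 x, SmoothFieldAt X p := by
  constructor
  · rintro ⟨U, hU, h⟩
    filter_upwards [eventually_mem_nhds_iff.2 hU] with p hp using ContMDiffOn.contMDiffAt h hp
  · exact fun h => ⟨_, h, fun p hp => ContMDiffAt.contMDiffWithinAt hp⟩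

/-- The fibre coordinates on `T_q M` given by the preferred chart at `b`. -/
def fibreCoord (b q : M) : TangentSpace (𝓡 n) q →L[ℝ] EuclideanSpace ℝ (Fin n) :=
  (trivializationAt (EuclideanSpace ℝ (Fin n)) (TangentSpace (𝓡 n)) b).continuousLinearMapAt ℝ q

theorem eq_zero_of_fibreCoord_self_eq_zero {b : M} {w : TangentSpace (𝓡 n) b}
    (h : fibreCoord b b w = 0) : w = 0 := by
  rw [← (trivializationAt (EuclideanSpace ℝ (Fin n)) (TangentSpace (𝓡 n))
    b).symmL_continuousLinearMapAt (R := ℝ) (mem_chart_source _ b) w]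
  exact (congrArg _ h).trans (map_zero _)

theorem mem_tangent_extChartAt_source_iff :
    p ∈ (extChartAt (𝓡 n).tangent x).source ↔
      p.proj ∈ (chartAt (EuclideanSpace ℝ (Fin n)) x.proj).source := by
  rw [extChartAt_source]
  exact TangentBundle.mem_chart_source_iff p x

theorem extChartAt_tangent_apply (hp : p ∈ (extChartAt (𝓡 n).tangent x).source) :
    extChartAt (𝓡 n).tangent x p =
      (extChartAt (𝓡 n) x.proj p.proj, fibreCoord x.proj p.proj p.snd) := by
  have hp_base := mem_tangent_extChartAt_source_iff.1 hp
  have fibre : fibreCoord x.proj p.proj p.snd =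
      (trivializationAt (EuclideanSpace ℝ (Fin n)) (TangentSpace (𝓡 n)) x.proj p).2 := by
    rw [fibreCoord, Trivialization.continuousLinearMapAt_apply, Trivialization.linearMapAt_apply]
    simp [hp_base]
  rw [fibre]
  rfl

theorem chartDeriv_fst (hp : p ∈ (extChartAt (𝓡 n).tangent x).source)
    (w : TangentSpace (𝓡 n).tangent p) :
    (chartDeriv (𝓡 n).tangent x p w).1 = fibreCoord x.proj p.proj
      (mfderiv (𝓡 n).tangent (𝓡 n) (fun q : TM n M => q.proj) p w) := by
  have hp_base := mem_tangent_extChartAt_source_iff.1 hp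
  have chain_fst := mfderiv_comp p
    ((ContinuousLinearMap.fst ℝ (EuclideanSpace ℝ (Fin n))
      (EuclideanSpace ℝ (Fin n))).mdifferentiableAt (x := extChartAt (𝓡 n).tangent x p))
    (mdifferentiableAt_extChartAt (by rwa [extChartAt_source] at hp))
  have chain_proj := mfderiv_comp p (mdifferentiableAt_extChartAt (I := 𝓡 n) hp_base)
    (mdifferentiableAt_proj (TangentSpace (𝓡 n)) (p := p))
  rw [ContinuousLinearMap.mfderiv_eq] at chain_fst
  rw [fibreCoord, TangentBundle.continuousLinearMapAt_trivializationAt hp_base]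
  exact (congr($chain_fst w)).symm.trans congr($chain_proj w)

theorem extChartAt_tangent_add_smul (hp : p ∈ (extChartAt (𝓡 n).tangent x).source)
    (w : TangentSpace (𝓡 n) p.proj) (t : ℝ) :
    extChartAt (𝓡 n).tangent x ⟨p.proj, p.snd + t • w⟩ =
      (extChartAt (𝓡 n).tangent x p + t • (0, fibreCoord x.proj p.proj w) : ModelTM n) := by
  have hp_add : (⟨p.proj, p.snd + t • w⟩ : TM n M) ∈ (extChartAt (𝓡 n).tangent x).source :=
    mem_tangent_extChartAt_source_iff.2 (mem_tangent_extChartAt_source_iff.1 hp)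
  rw [extChartAt_tangent_apply hp, extChartAt_tangent_apply hp_add]
  refine Prod.ext (by simp) ?_
  exact (map_add (fibreCoord x.proj p.proj) _ _).trans
    (congrArg _ (map_smul (fibreCoord x.proj p.proj) t w))

theorem chartDeriv_vertLift (hp : p ∈ (extChartAt (𝓡 n).tangent x).source)
    (w : TangentSpace (𝓡 n) p.proj) :
    chartDeriv (𝓡 n).tangent x p (vertLift p w) = (0, fibreCoord x.proj p.proj w) := by
  refine chartDeriv_velocity (.of_forall fun t => mem_tangent_extChartAt_source_iff.2
    (mem_tangent_extChartAt_source_iff.1 hp)) ?_ (by simp)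
  have affine : extChartAt (𝓡 n).tangent x ∘ (fun t : ℝ => (⟨p.proj, p.snd + t • w⟩ : TM n M)) =
      fun t => extChartAt (𝓡 n).tangent x p + t • ((0, fibreCoord x.proj p.proj w) : ModelTM n) :=
    funext (extChartAt_tangent_add_smul hp w)
  rw [affine]
  simpa using ((hasDerivAt_id (0 : ℝ)).smul_const
    ((0, fibreCoord x.proj p.proj w) : ModelTM n)).const_add (extChartAt (𝓡 n).tangent x p)

theorem chartDeriv_J (hp : p ∈ (extChartAt (𝓡 n).tangent x).source) (X : VF n M) :
    chartDeriv (𝓡 n).tangent x p (J X p) = (0, (chartDeriv (𝓡 n).tangent x p (X p)).1) := by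
  rw [chartDeriv_fst hp]
  exact chartDeriv_vertLift hp _

theorem chartDeriv_liouville (hp : p ∈ (extChartAt (𝓡 n).tangent x).source) :
    chartDeriv (𝓡 n).tangent x p (liouville p) = (0, (extChartAt (𝓡 n).tangent x p).2) := by
  rw [extChartAt_tangent_apply hp]
  exact chartDeriv_vertLift hp _

theorem slashed_mem_nhds (hx : x ∈ slashed n M) : slashed n M ∈ 𝓝 x := by
  have fibre_ne_zero : (extChartAt (𝓡 n).tangent x x).2 ≠ 0 := by
    rw [extChartAt_tangent_apply (mem_extChartAt_source x)]
    exact fun h => hx (eq_zero_of_fibreCoord_self_eq_zero h)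
  filter_upwards [extChartAt_source_mem_nhds (I := (𝓡 n).tangent) x,
    (continuousAt_extChartAt x).snd.eventually_ne fibre_ne_zero] with p hp hp_ne h
  rw [extChartAt_tangent_apply hp] at hp_ne
  exact hp_ne ((congrArg (fibreCoord x.proj p.proj) h).trans (map_zero _))

end TangentChart

section Germ

variable {E : Type*} [NormedAddCommGroup E] [NormedSpace ℝ E]
  {H : Type*} [TopologicalSpace H] (I : ModelWithCorners ℝ E H)
  {N : Type*} [TopologicalSpace N] [ChartedSpace H N] (x : N)

/-- The algebra of functions that are smooth near `x`. -/
def smoothFunctions : Subalgebra ℝ (N → ℝ) where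
  carrier := {f | ∀ᶠ p in 𝓝 x, ContMDiffAt I 𝓘(ℝ, ℝ) ∞ f p}
  mul_mem' hf hg := by filter_upwards [hf, hg] with p hfp hgp using hfp.mul hgp
  add_mem' hf hg := by filter_upwards [hf, hg] with p hfp hgp using hfp.add hgp
  algebraMap_mem' _ := .of_forall fun _ => contMDiffAt_const

/-- The ideal of functions that vanish near `x`. -/
def locallyZero : Ideal (smoothFunctions I x) where
  carrier := {f | ∀ᶠ p in 𝓝 x, (f : N → ℝ) p = 0}
  add_mem' hf hg := by
    filter_upwards [hf, hg] with p hfp hgp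
    simp [hfp, hgp]
  zero_mem' := .of_forall fun _ => rfl
  smul_mem' c f hf := by
    filter_upwards [hf] with p hfp
    simp [hfp]

/-- The algebra of germs at `x` of smooth functions. -/
def FnGerm : Type _ := smoothFunctions I x ⧸ locallyZero I x

instance : CommRing (FnGerm I x) :=
  inferInstanceAs (CommRing (smoothFunctions I x ⧸ locallyZero I x))

instance : Algebra ℝ (FnGerm I x) :=
  inferInstanceAs (Algebra ℝ (smoothFunctions I x ⧸ locallyZero I x))

/-- The germ of a function that is smooth near `x`. -/
def toGerm : smoothFunctions I x →ₐ[ℝ] FnGerm I x := Ideal.Quotient.mkₐ ℝ (locallyZero I x)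

/-- The value of a germ at `x`. -/
def evGerm : FnGerm I x →ₐ[ℝ] ℝ :=
  Ideal.Quotient.liftₐ (locallyZero I x)
    ((Pi.evalAlgHom ℝ (fun _ : N => ℝ) x).comp (smoothFunctions I x).val)
    fun _ ha => ha.self_of_nhds

variable {I x}

/-- `a` is the germ at `x` of the function `f`, which is smooth near `x`. -/
def HasGerm (f : N → ℝ) (a : FnGerm I x) : Prop :=
  ∃ h : f ∈ smoothFunctions I x, toGerm I x ⟨f, h⟩ = a

theorem toGerm_eq_iff {f g : smoothFunctions I x} :
    toGerm I x f = toGerm I x g ↔ (f : N → ℝ) =ᶠ[𝓝 x] g :=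
  (Ideal.Quotient.mk_eq_mk_iff_sub_mem f g).trans
    (eventually_congr (.of_forall fun _ => sub_eq_zero))

theorem exists_hasGerm (a : FnGerm I x) : ∃ f, HasGerm f a := by
  obtain ⟨⟨f, hf⟩, rfl⟩ := Ideal.Quotient.mk_surjective a
  exact ⟨f, hf, rfl⟩

variable {f g : N → ℝ} {a b : FnGerm I x}

theorem exists_germ (h : ∀ᶠ p in 𝓝 x, ContMDiffAt I 𝓘(ℝ, ℝ) ∞ f p) :
    ∃ a : FnGerm I x, HasGerm f a :=
  ⟨_, h, rfl⟩

namespace HasGerm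

theorem smooth (h : HasGerm f a) : ∀ᶠ p in 𝓝 x, ContMDiffAt I 𝓘(ℝ, ℝ) ∞ f p := h.1

theorem eventuallyEq (hf : HasGerm f a) (hg : HasGerm g a) : f =ᶠ[𝓝 x] g := by
  obtain ⟨_, rfl⟩ := hf
  obtain ⟨_, hga⟩ := hg
  exact (toGerm_eq_iff.1 hga).symm

theorem eq_of_eventuallyEq (hf : HasGerm f a) (hg : HasGerm g b) (h : f =ᶠ[𝓝 x] g) : a = b := by
  obtain ⟨_, rfl⟩ := hf
  obtain ⟨_, rfl⟩ := hg
  exact toGerm_eq_iff.2 h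

theorem congr (hf : HasGerm f a) (h : f =ᶠ[𝓝 x] g) : HasGerm g a := by
  have hg : ∀ᶠ p in 𝓝 x, ContMDiffAt I 𝓘(ℝ, ℝ) ∞ g p := by
    filter_upwards [hf.smooth, h.eventuallyEq_nhds] with p hfp hp
    exact hfp.congr_of_eventuallyEq hp.symm
  obtain ⟨b, hb⟩ := exists_germ hg
  rwa [hf.eq_of_eventuallyEq hb h]

theorem add (hf : HasGerm f a) (hg : HasGerm g b) : HasGerm (f + g) (a + b) := by
  obtain ⟨hf_mem, rfl⟩ := hf
  obtain ⟨hg_mem, rfl⟩ := hg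
  exact ⟨add_mem hf_mem hg_mem, map_add (toGerm I x) ⟨f, hf_mem⟩ ⟨g, hg_mem⟩⟩

theorem sub (hf : HasGerm f a) (hg : HasGerm g b) : HasGerm (f - g) (a - b) := by
  obtain ⟨hf_mem, rfl⟩ := hf
  obtain ⟨hg_mem, rfl⟩ := hg
  exact ⟨sub_mem hf_mem hg_mem, map_sub (toGerm I x) ⟨f, hf_mem⟩ ⟨g, hg_mem⟩⟩

theorem mul (hf : HasGerm f a) (hg : HasGerm g b) : HasGerm (f * g) (a * b) := by
  obtain ⟨hf_mem, rfl⟩ := hf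
  obtain ⟨hg_mem, rfl⟩ := hg
  exact ⟨mul_mem hf_mem hg_mem, map_mul (toGerm I x) ⟨f, hf_mem⟩ ⟨g, hg_mem⟩⟩

theorem const (r : ℝ) : HasGerm (fun _ => r) (algebraMap ℝ (FnGerm I x) r) :=
  ⟨(smoothFunctions I x).algebraMap_mem r, (toGerm I x).commutes r⟩

theorem zero : HasGerm (0 : N → ℝ) (0 : FnGerm I x) := by
  rw [← map_zero (algebraMap ℝ (FnGerm I x))]
  exact const 0

theorem one : HasGerm (1 : N → ℝ) (1 : FnGerm I x) := by
  rw [← map_one (algebraMap ℝ (FnGerm I x))]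
  exact const 1

theorem evGerm_eq (hf : HasGerm f a) : evGerm I x a = f x := by
  obtain ⟨_, rfl⟩ := hf
  rfl

end HasGerm

instance : IsLocalHom (evGerm I x) where
  map_nonunit a ha := by
    obtain ⟨f, hf⟩ := exists_hasGerm a
    rw [hf.evGerm_eq, isUnit_iff_ne_zero] at ha
    have hf_ne : ∀ᶠ p in 𝓝 x, f p ≠ 0 := hf.smooth.self_of_nhds.continuousAt.eventually_ne ha
    have smooth_inv : ∀ᶠ p in 𝓝 x, ContMDiffAt I 𝓘(ℝ, ℝ) ∞ (fun q => (f q)⁻¹) p := by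
      filter_upwards [hf_ne, hf.smooth] with p hp hfp using hfp.inv₀ hp
    obtain ⟨b, hb⟩ := exists_germ smooth_inv
    refine IsUnit.of_mul_eq_one b ((hf.mul hb).eq_of_eventuallyEq HasGerm.one ?_)
    filter_upwards [hf_ne] with p hp using mul_inv_cancel₀ hp

variable (x) in
theorem exists_hasGerm_extChartAt [IsManifold I ∞ N] (l : E →L[ℝ] ℝ) :
    ∃ a : FnGerm I x, HasGerm (l ∘ extChartAt I x) a := by
  apply exists_germ
  filter_upwards [extChartAt_source_mem_nhds (I := I) x] with p hp
  rw [extChartAt_source] at hp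
  exact l.contMDiff.contMDiffAt.comp p (contMDiffAt_extChartAt' hp)

end Germ

section FieldGerm

variable {E : Type*} [NormedAddCommGroup E] [NormedSpace ℝ E]
  {H : Type*} [TopologicalSpace H] {I : ModelWithCorners ℝ E H}
  {N : Type*} [TopologicalSpace N] [ChartedSpace H N] [IsManifold I ∞ N] {x : N}

/-- `D` is the derivation of the algebra of germs at `x` induced by the vector field `X`, which is
smooth near `x`. -/
structure HasDerivation (X : ∀ p : N, TangentSpace I p)
    (D : Derivation ℝ (FnGerm I x) (FnGerm I x)) : Prop where
  smooth : ∀ᶠ p in 𝓝 x, SmoothFieldAt X p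
  apply : ∀ {f a}, HasGerm f a → HasGerm (along X f) (D a)

variable {X Y : ∀ p : N, TangentSpace I p}

theorem exists_germ_along (hX : ∀ᶠ p in 𝓝 x, SmoothFieldAt X p) (a : FnGerm I x) :
    ∃ b : FnGerm I x, ∀ f, HasGerm f a → HasGerm (along X f) b := by
  obtain ⟨f, hf⟩ := exists_hasGerm a
  have smooth_along : ∀ᶠ p in 𝓝 x, ContMDiffAt I 𝓘(ℝ, ℝ) ∞ (along X f) p := by
    filter_upwards [hX, hf.smooth] with p hXp hfp using contMDiffAt_along hfp hXp
  obtain ⟨b, hb⟩ := exists_germ smooth_along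
  refine ⟨b, fun g hg => hb.congr ?_⟩
  filter_upwards [(hf.eventuallyEq hg).eventuallyEq_nhds] with p hp using along_congr hp

theorem exists_hasDerivation (hX : ∀ᶠ p in 𝓝 x, SmoothFieldAt X p) :
    ∃ D : Derivation ℝ (FnGerm I x) (FnGerm I x), HasDerivation X D := by
  choose D hD using exists_germ_along (x := x) hX
  have map_add (a b) : D (a + b) = D a + D b := by
    obtain ⟨f, hf⟩ := exists_hasGerm a
    obtain ⟨g, hg⟩ := exists_hasGerm b
    refine (hD _ _ (hf.add hg)).eq_of_eventuallyEq ((hD _ _ hf).add (hD _ _ hg)) ?_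
    filter_upwards [hf.smooth, hg.smooth] with p hfp hgp
    exact along_add (hfp.mdifferentiableAt (by simp)) (hgp.mdifferentiableAt (by simp))
  have leibniz (a b) : D (a * b) = a * D b + b * D a := by
    obtain ⟨f, hf⟩ := exists_hasGerm a
    obtain ⟨g, hg⟩ := exists_hasGerm b
    refine (hD _ _ (hf.mul hg)).eq_of_eventuallyEq
      ((hf.mul (hD _ _ hg)).add (hg.mul (hD _ _ hf))) ?_
    filter_upwards [hf.smooth, hg.smooth] with p hfp hgp
    exact along_mul (hfp.mdifferentiableAt (by simp)) (hgp.mdifferentiableAt (by simp))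
  have map_const (r : ℝ) : D (algebraMap ℝ _ r) = 0 :=
    (hD _ _ (HasGerm.const r)).eq_of_eventuallyEq HasGerm.zero
      (.of_forall fun p => along_const X r p)
  refine ⟨Derivation.mk' ⟨⟨D, map_add⟩, fun r a => ?_⟩ leibniz, hX, fun h => hD _ _ h⟩
  simp only [Algebra.smul_def, leibniz, map_const, mul_zero, add_zero, RingHom.id_apply]

namespace HasDerivation

variable {D D' : Derivation ℝ (FnGerm I x) (FnGerm I x)} {g : N → ℝ} {a : FnGerm I x}

theorem add (hX : HasDerivation X D) (hY : HasDerivation Y D') :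
    HasDerivation (X + Y) (D + D') where
  smooth := by filter_upwards [hX.smooth, hY.smooth] with p hXp hYp using hXp.add hYp
  apply hf := by
    rw [along_add_field]
    exact (hX.apply hf).add (hY.apply hf)

theorem smul (hg : HasGerm g a) (hX : HasDerivation X D) : HasDerivation (g • X) (a • D) where
  smooth := by filter_upwards [hX.smooth, hg.smooth] with p hXp hgp using hXp.smul hgp
  apply hf := by
    rw [along_smul_field]
    exact hg.mul (hX.apply hf)

theorem lie [CompleteSpace E] (hX : HasDerivation X D) (hY : HasDerivation Y D') :
    HasDerivation (VectorField.mlieBracket I X Y) ⁅D, D'⁆ where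
  smooth := by filter_upwards [hX.smooth, hY.smooth] with p hXp hYp using hXp.mlieBracket hYp
  apply hf := by
    rw [Derivation.commutator_apply]
    refine ((hX.apply (hY.apply hf)).sub (hY.apply (hX.apply hf))).congr ?_
    filter_upwards [hX.smooth, hY.smooth, hf.smooth.eventually_nhds] with p hXp hYp hfp
    exact (along_mlieBracket hfp hXp hYp).symm

theorem congr (hX : HasDerivation X D) (h : X =ᶠ[𝓝 x] Y) : HasDerivation Y D where
  smooth := by
    filter_upwards [hX.smooth, h.eventuallyEq_nhds] with p hXp hp
    refine ContMDiffAt.congr_of_eventuallyEq hXp ?_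
    filter_upwards [hp] with q hq
    rw [hq]
  apply hf := (hX.apply hf).congr (by
    filter_upwards [h] with p hp using along_congr_field _ hp)

theorem eq_of_eventuallyEq (hX : HasDerivation X D) (hY : HasDerivation Y D')
    (h : X =ᶠ[𝓝 x] Y) : D = D' := by
  refine Derivation.ext fun a => ?_
  obtain ⟨f, hf⟩ := exists_hasGerm a
  exact ((hX.congr h).apply hf).eq_of_eventuallyEq (hY.apply hf) .rfl

end HasDerivation

variable [CompleteSpace E]

variable (I x) in
/-- The Lie–Rinehart algebra of germs at `x` of smooth vector fields, realized as derivations of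
the algebra of germs of functions. -/
def fieldAlgebra :
    LieRinehartSubalgebra (FnGerm I x) (Derivation ℝ (FnGerm I x) (FnGerm I x)) where
  carrier := {D | ∃ X : ∀ p : N, TangentSpace I p, HasDerivation X D}
  add_mem' := by
    rintro _ _ ⟨X, hX⟩ ⟨Y, hY⟩
    exact ⟨_, hX.add hY⟩
  zero_mem' := by
    obtain ⟨D, hD⟩ := exists_hasDerivation (eventually_smoothFieldAt_coordField (I := I) x 0)
    exact ⟨_, zero_smul (FnGerm I x) D ▸ hD.smul HasGerm.zero⟩
  smul_mem' := by
    rintro a _ ⟨X, hX⟩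
    obtain ⟨g, hg⟩ := exists_hasGerm a
    exact ⟨_, hX.smul hg⟩
  lie_mem' := by
    rintro _ _ ⟨X, hX⟩ ⟨Y, hY⟩
    exact ⟨_, hX.lie hY⟩

variable (I x) in
/-- The Lie algebra of germs at `x` of smooth vector fields. -/
def FieldGerm : Type _ := fieldAlgebra I x

instance : LieRing (FieldGerm I x) := inferInstanceAs (LieRing (fieldAlgebra I x))

instance : Module (FnGerm I x) (FieldGerm I x) :=
  inferInstanceAs (Module (FnGerm I x) (fieldAlgebra I x))

instance : LieRingModule (FieldGerm I x) (FnGerm I x) :=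
  inferInstanceAs (LieRingModule (fieldAlgebra I x) (FnGerm I x))

instance : LieRinehartRing (FnGerm I x) (FieldGerm I x) :=
  inferInstanceAs (LieRinehartRing (FnGerm I x) (fieldAlgebra I x))

instance : LieAlgebra ℝ (FieldGerm I x) := inferInstanceAs (LieAlgebra ℝ (fieldAlgebra I x))

instance : LieRinehartAlgebra ℝ (FnGerm I x) (FieldGerm I x) :=
  inferInstanceAs (LieRinehartAlgebra ℝ (FnGerm I x) (fieldAlgebra I x))

/-- `D` is the germ at `x` of the vector field `X`, which is smooth near `x`. -/
def HasFieldGerm (X : ∀ p : N, TangentSpace I p) (D : FieldGerm I x) : Prop :=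
  HasDerivation X D.1

theorem exists_hasFieldGerm (D : FieldGerm I x) : ∃ X, HasFieldGerm X D := D.2

theorem exists_fieldGerm (hX : ∀ᶠ p in 𝓝 x, SmoothFieldAt X p) :
    ∃ D : FieldGerm I x, HasFieldGerm X D := by
  obtain ⟨D, hD⟩ := exists_hasDerivation hX
  exact ⟨⟨D, X, hD⟩, hD⟩

namespace HasFieldGerm

variable {D D' : FieldGerm I x} {f g : N → ℝ} {a : FnGerm I x}

theorem smooth (hX : HasFieldGerm X D) : ∀ᶠ p in 𝓝 x, SmoothFieldAt X p :=
  HasDerivation.smooth hX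

theorem act (hX : HasFieldGerm X D) (hf : HasGerm f a) : HasGerm (along X f) ⁅D, a⁆ :=
  hX.apply hf

theorem eq_of_eventuallyEq (hX : HasFieldGerm X D) (hY : HasFieldGerm Y D') (h : X =ᶠ[𝓝 x] Y) :
    D = D' :=
  Subtype.ext (HasDerivation.eq_of_eventuallyEq hX hY h)

theorem congr (hX : HasFieldGerm X D) (h : X =ᶠ[𝓝 x] Y) : HasFieldGerm Y D :=
  HasDerivation.congr hX h

theorem add (hX : HasFieldGerm X D) (hY : HasFieldGerm Y D') : HasFieldGerm (X + Y) (D + D') :=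
  HasDerivation.add hX hY

theorem smul (hg : HasGerm g a) (hX : HasFieldGerm X D) : HasFieldGerm (g • X) (a • D) :=
  HasDerivation.smul hg hX

theorem lie (hX : HasFieldGerm X D) (hY : HasFieldGerm Y D') :
    HasFieldGerm (VectorField.mlieBracket I X Y) ⁅D, D'⁆ :=
  HasDerivation.lie hX hY

theorem real_smul (r : ℝ) (hX : HasFieldGerm X D) : HasFieldGerm (r • X) (r • D) := by
  rw [← algebraMap_smul (FnGerm I x) r D]
  exact smul (HasGerm.const r) hX

theorem sub (hX : HasFieldGerm X D) (hY : HasFieldGerm Y D') : HasFieldGerm (X - Y) (D - D') := by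
  convert hX.add (hY.real_smul (-1)) using 1 <;> module

theorem sum {ι : Type*} (s : Finset ι) {X : ι → ∀ p : N, TangentSpace I p}
    {D : ι → FieldGerm I x} (h : ∀ i, HasFieldGerm (X i) (D i)) :
    HasFieldGerm (∑ i ∈ s, X i) (∑ i ∈ s, D i) := by
  classical
  induction s using Finset.induction_on with
  | empty =>
    obtain ⟨Z, hZ⟩ := exists_hasFieldGerm (0 : FieldGerm I x)
    simpa only [Finset.sum_empty, sub_self] using hZ.sub hZ
  | insert i s hi ih =>
    rw [Finset.sum_insert hi, Finset.sum_insert hi]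
    exact (h i).add ih

end HasFieldGerm

end FieldGerm

section ChartGerm

variable {E : Type*} [NormedAddCommGroup E] [NormedSpace ℝ E]
  {H : Type*} [TopologicalSpace H] {I : ModelWithCorners ℝ E H}
  {N : Type*} [TopologicalSpace N] [ChartedSpace H N] [IsManifold I ∞ N] {x p : N}
  {f : N → ℝ} {a : FnGerm I x}

variable (I x) in
/-- The germ at `x` of a linear function of the coordinates in the preferred chart at `x`. -/
def chartGerm (l : E →L[ℝ] ℝ) : FnGerm I x :=
  Classical.choose (exists_hasGerm_extChartAt x l)

theorem hasGerm_chartGerm (l : E →L[ℝ] ℝ) : HasGerm (l ∘ extChartAt I x) (chartGerm I x l) :=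
  Classical.choose_spec (exists_hasGerm_extChartAt x l)

theorem along_clm_comp_extChartAt (hp : p ∈ (extChartAt I x).source)
    (X : ∀ p : N, TangentSpace I p) (l : E →L[ℝ] ℝ) :
    along X (l ∘ extChartAt I x) p = l (chartDeriv I x p (X p)) := by
  rw [along_comp_extChartAt hp l.differentiableAt, l.fderiv]

variable [CompleteSpace E] {X : ∀ p : N, TangentSpace I p} {D : FieldGerm I x}

variable (I x) in
/-- The germ at `x` of a coordinate field of the preferred chart at `x`. -/
def coordFieldGerm (v : E) : FieldGerm I x :=
  Classical.choose (exists_fieldGerm (eventually_smoothFieldAt_coordField x v))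

theorem hasFieldGerm_coordFieldGerm (v : E) :
    HasFieldGerm (coordField I x v) (coordFieldGerm I x v) :=
  Classical.choose_spec (exists_fieldGerm (eventually_smoothFieldAt_coordField x v))

theorem coordFieldGerm_lie_chartGerm (v : E) (l : E →L[ℝ] ℝ) :
    ⁅coordFieldGerm I x v, chartGerm I x l⁆ = algebraMap ℝ _ (l v) := by
  refine ((hasFieldGerm_coordFieldGerm v).act (hasGerm_chartGerm l)).eq_of_eventuallyEq
    (.const _) ?_
  filter_upwards [extChartAt_source_mem_nhds (I := I) x] with p hp
  rw [along_clm_comp_extChartAt hp, chartDeriv_coordField hp]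

theorem hasFieldGerm_sum {ι : Type*} [Fintype ι] {c : ι → N → ℝ} {γ : ι → FnGerm I x} {v : ι → E}
    (hc : ∀ i, HasGerm (c i) (γ i))
    (hX : ∀ᶠ p in 𝓝 x, chartDeriv I x p (X p) = ∑ i, c i p • v i) :
    HasFieldGerm X (∑ i, γ i • coordFieldGerm I x (v i)) := by
  refine (HasFieldGerm.sum _ fun i => .smul (hc i) (hasFieldGerm_coordFieldGerm (v i))).congr ?_
  filter_upwards [hX, extChartAt_source_mem_nhds (I := I) x] with p hXp hp
  rw [← coordField_chartDeriv hp (X p), hXp]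
  simp only [Finset.sum_apply, Pi.smul_apply', coordField, map_sum, map_smul]
  rfl

theorem fieldGerm_eq_sum {ι : Type*} [Fintype ι] {l : ι → E →L[ℝ] ℝ} {v : ι → E}
    (h : ∀ w, w = ∑ i, l i w • v i) (D : FieldGerm I x) :
    D = ∑ i, ⁅D, chartGerm I x (l i)⁆ • coordFieldGerm I x (v i) := by
  obtain ⟨X, hX⟩ := exists_hasFieldGerm D
  refine hX.eq_of_eventuallyEq
    (hasFieldGerm_sum (fun i => hX.act (hasGerm_chartGerm (l i))) ?_) .rfl
  filter_upwards [extChartAt_source_mem_nhds (I := I) x] with p hp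
  simpa only [along_clm_comp_extChartAt hp] using h _

theorem HasFieldGerm.exists_evGerm_lie_ne_zero (hX : HasFieldGerm X D) (hne : X x ≠ 0) :
    ∃ a, evGerm I x ⁅D, a⁆ ≠ 0 := by
  have hx := mem_extChartAt_source (I := I) x
  have chartDeriv_ne_zero : chartDeriv I x x (X x) ≠ 0 := fun h => hne (by
    rw [← coordField_chartDeriv hx (X x), h, coordField, map_zero])
  obtain ⟨l, hl⟩ := SeparatingDual.exists_ne_zero (R := ℝ) chartDeriv_ne_zero
  refine ⟨chartGerm I x l, ?_⟩
  rwa [(hX.act (hasGerm_chartGerm l)).evGerm_eq, along_clm_comp_extChartAt hx]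

variable [FiniteDimensional ℝ E]

theorem zeroJet_lie_of_coordFieldGerm {k : ℕ}
    (h : ∀ v, ZeroJet (FieldGerm I x) (evGerm I x) k ⁅coordFieldGerm I x v, a⁆)
    (D : FieldGerm I x) : ZeroJet (FieldGerm I x) (evGerm I x) k ⁅D, a⁆ := by
  let b := Module.finBasis ℝ E
  rw [fieldGerm_eq_sum (l := fun i => (b.coord i).toContinuousLinearMap) (v := b)
    (fun w => (b.sum_repr w).symm) D, sum_lie]
  refine ZeroJet.sum fun i _ => ?_
  rw [LieRinehartRing.lie_smul_eq_mul]
  exact (h _).mul_left _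

/-- Only derivatives along coordinate fields occur in the Taylor polynomial in the chart, while
`ZeroJet` allows arbitrary fields: these are combinations of the coordinate fields. -/
theorem HasGerm.forall_le_iteratedFDeriv_eq_zero_iff [I.Boundaryless] {k : ℕ} (hf : HasGerm f a) :
    (∀ j ≤ k, iteratedFDeriv ℝ j (f ∘ (extChartAt I x).symm) (extChartAt I x x) = 0) ↔
      ZeroJet (FieldGerm I x) (evGerm I x) k a := by
  induction k generalizing f a with
  | zero =>
    simp only [Nat.le_zero, forall_eq, iteratedFDeriv_zero_eq_zero_iff, Function.comp_apply,
      extChartAt_to_inv, ZeroJet, hf.evGerm_eq]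
  | succ k ih =>
    have smooth := contDiffAt_comp_extChartAt_symm hf.smooth.self_of_nhds
    rw [forall_le_succ_iteratedFDeriv_eq_zero_iff
      (smooth.of_le (mod_cast le_top)), Function.comp_apply,
      extChartAt_to_inv, ← hf.evGerm_eq, ZeroJet]
    refine and_congr_right fun _ => ?_
    have along_coord (v : E) : (∀ j ≤ k, iteratedFDeriv ℝ j (fun u =>
        fderiv ℝ (f ∘ (extChartAt I x).symm) u v) (extChartAt I x x) = 0) ↔
        ZeroJet (FieldGerm I x) (evGerm I x) k ⁅coordFieldGerm I x v, a⁆ := by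
      rw [← ih ((hasFieldGerm_coordFieldGerm v).act hf)]
      refine forall₂_congr fun j _ => ?_
      rw [((along_coordField_comp_extChartAt_symm hf.smooth v).iteratedFDeriv ℝ j).eq_of_nhds]
    exact (forall_congr' along_coord).trans
      ⟨zeroJet_lie_of_coordFieldGerm, fun h v => h (coordFieldGerm I x v)⟩

end ChartGerm

section TangentGerm

variable {n : ℕ}

/-- The base coordinate functions of the model of `TM`. -/
def xCoord (i : Fin n) : ModelTM n →L[ℝ] ℝ :=
  (EuclideanSpace.proj i).comp (ContinuousLinearMap.fst ℝ _ _)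

/-- The fibre coordinate functions of the model of `TM`. -/
def yCoord (i : Fin n) : ModelTM n →L[ℝ] ℝ :=
  (EuclideanSpace.proj i).comp (ContinuousLinearMap.snd ℝ _ _)

/-- The base coordinate vectors of the model of `TM`. -/
def xVec (i : Fin n) : ModelTM n := (EuclideanSpace.single i 1, 0)

/-- The fibre coordinate vectors of the model of `TM`. -/
def yVec (i : Fin n) : ModelTM n := (0, EuclideanSpace.single i 1)

theorem xCoord_apply (i : Fin n) (v : ModelTM n) : xCoord i v = v.1 i := rfl

theorem yCoord_apply (i : Fin n) (v : ModelTM n) : yCoord i v = v.2 i := rfl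

theorem sum_smul_xVec (u : EuclideanSpace ℝ (Fin n)) : ∑ i, u i • xVec i = (u, 0) := by
  refine Prod.ext ?_ (by simp [xVec, Prod.snd_sum])
  ext j
  simp [xVec, Prod.fst_sum, Pi.single_apply]

theorem sum_smul_yVec (u : EuclideanSpace ℝ (Fin n)) : ∑ i, u i • yVec i = (0, u) := by
  refine Prod.ext (by simp [yVec, Prod.fst_sum]) ?_
  ext j
  simp [yVec, Prod.snd_sum, Pi.single_apply]

variable {M : Type*} [TopologicalSpace M] [ChartedSpace (EuclideanSpace ℝ (Fin n)) M]
  [IsManifold (𝓡 n) ∞ M] {x : TM n M} {S X : VF n M}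
  {D : FieldGerm (𝓡 n).tangent x}

theorem fieldGerm_eq_sum_add_sum (D : FieldGerm (𝓡 n).tangent x) :
    D = ∑ i, ⁅D, chartGerm (𝓡 n).tangent x (xCoord i)⁆ • coordFieldGerm (𝓡 n).tangent x (xVec i) +
      ∑ i, ⁅D, chartGerm (𝓡 n).tangent x (yCoord i)⁆ •
        coordFieldGerm (𝓡 n).tangent x (yVec i) := by
  have dual (w : ModelTM n) : w = ∑ i, Sum.elim xCoord yCoord i w • Sum.elim xVec yVec i := by
    simp [xCoord_apply, yCoord_apply, sum_smul_xVec, sum_smul_yVec]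
  simpa only [Fintype.sum_sum_type, Sum.elim_inl, Sum.elim_inr] using fieldGerm_eq_sum dual D

theorem HasFieldGerm.J_sum (hX : HasFieldGerm X D) :
    HasFieldGerm (J X) (∑ i, ⁅D, chartGerm (𝓡 n).tangent x (xCoord i)⁆ •
      coordFieldGerm (𝓡 n).tangent x (yVec i)) := by
  refine hasFieldGerm_sum (fun i => hX.act (hasGerm_chartGerm (xCoord i))) ?_
  filter_upwards [extChartAt_source_mem_nhds (I := (𝓡 n).tangent) x] with p hp
  simp only [along_clm_comp_extChartAt hp, chartDeriv_J hp, xCoord_apply, sum_smul_yVec]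

theorem hasFieldGerm_liouville :
    HasFieldGerm (liouville : VF n M) (∑ i, chartGerm (𝓡 n).tangent x (yCoord i) •
      coordFieldGerm (𝓡 n).tangent x (yVec i)) := by
  refine hasFieldGerm_sum (fun i => hasGerm_chartGerm (yCoord i)) ?_
  filter_upwards [extChartAt_source_mem_nhds (I := (𝓡 n).tangent) x] with p hp
  simp only [chartDeriv_liouville hp, Function.comp_apply, yCoord_apply, sum_smul_yVec]

/-- `T` is the germ at `x` of the spray `S`, written in some coordinates. -/
structure HasSprayGerm (S : VF n M)
    (T : SprayAlgebra (Fin n) (FnGerm (𝓡 n).tangent x) (FieldGerm (𝓡 n).tangent x)) : Prop where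
  spray : HasFieldGerm S T.S
  liouville : HasFieldGerm liouville T.C
  J : ∀ {X D}, HasFieldGerm X D → HasFieldGerm (J X) (T.J D)

theorem IsSpray.along_xCoord (hS : IsSpray S) {p : TM n M} (hp_ne : p ∈ slashed n M)
    (hp : p ∈ (extChartAt (𝓡 n).tangent x).source) (i : Fin n) :
    along S (xCoord i ∘ extChartAt (𝓡 n).tangent x) p =
      yCoord i (extChartAt (𝓡 n).tangent x p) := by
  have second_order := chartDeriv_J hp S
  rw [hS.second_order p hp_ne, chartDeriv_liouville hp] at second_order
  rw [along_clm_comp_extChartAt hp]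
  exact congr(($second_order).2 i).symm

theorem IsSpray.exists_hasSprayGerm (hS : IsSpray S) (hx : x ∈ slashed n M) :
    ∃ T : SprayAlgebra (Fin n) (FnGerm (𝓡 n).tangent x) (FieldGerm (𝓡 n).tangent x),
      HasSprayGerm S T := by
  obtain ⟨D, hD⟩ := exists_fieldGerm (smoothFieldNear_iff.1 ⟨_, slashed_mem_nhds hx, hS.smooth⟩)
  refine ⟨{
    x i := chartGerm _ x (xCoord i)
    y i := chartGerm _ x (yCoord i)
    px i := coordFieldGerm _ x (xVec i)
    py i := coordFieldGerm _ x (yVec i)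
    px_x i j := ?_
    px_y i j := ?_
    py_x i j := ?_
    py_y i j := ?_
    decomp := fieldGerm_eq_sum_add_sum
    S := D
    S_x i := (hD.act (hasGerm_chartGerm _)).eq_of_eventuallyEq (hasGerm_chartGerm _) ?_
    homogeneous := (hasFieldGerm_liouville.lie hD).eq_of_eventuallyEq hD ?_ },
    hD, hasFieldGerm_liouville, HasFieldGerm.J_sum⟩
  case refine_5 =>
    filter_upwards [extChartAt_source_mem_nhds (I := (𝓡 n).tangent) x, slashed_mem_nhds hx]
      with p hp hp_ne using hS.along_xCoord hp_ne hp i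
  case refine_6 => filter_upwards [slashed_mem_nhds hx] with p hp using hS.homogeneous p hp
  all_goals
    simp [coordFieldGerm_lie_chartGerm, xCoord_apply, yCoord_apply, xVec, yVec, eq_comm,
      apply_ite (algebraMap ℝ (FnGerm (𝓡 n).tangent x))]

end TangentGerm

section Transfer

variable {n : ℕ} {M : Type*} [TopologicalSpace M] [ChartedSpace (EuclideanSpace ℝ (Fin n)) M]
  [IsManifold (𝓡 n) ∞ M] {x : TM n M} {S X Y Z : VF n M}
  {D D₁ D₂ D₃ : FieldGerm (𝓡 n).tangent x} {F lam : TM n M → ℝ} {a b : FnGerm (𝓡 n).tangent x}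

theorem forall_smoothFieldNear_iff {P : VF n M → Prop} {Q : FieldGerm (𝓡 n).tangent x → Prop}
    (h : ∀ {X D}, HasFieldGerm X D → (P X ↔ Q D)) :
    (∀ X, SmoothFieldNear X x → P X) ↔ ∀ D, Q D := by
  constructor
  · intro hP D
    obtain ⟨X, hX⟩ := exists_hasFieldGerm D
    exact (h hX).1 (hP X (smoothFieldNear_iff.2 hX.smooth))
  · intro hQ X hX
    obtain ⟨D, hD⟩ := exists_fieldGerm (smoothFieldNear_iff.1 hX)
    exact (h hD).2 (hQ D)

theorem forall₂_smoothFieldNear_iff {P : VF n M → VF n M → Prop}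
    {Q : FieldGerm (𝓡 n).tangent x → FieldGerm (𝓡 n).tangent x → Prop}
    (h : ∀ {X Y D₁ D₂}, HasFieldGerm X D₁ → HasFieldGerm Y D₂ → (P X Y ↔ Q D₁ D₂)) :
    (∀ X Y, SmoothFieldNear X x → SmoothFieldNear Y x → P X Y) ↔ ∀ D₁ D₂, Q D₁ D₂ :=
  (forall_congr' fun _ => forall_comm).trans <| forall_smoothFieldNear_iff fun hX =>
    forall_smoothFieldNear_iff (h hX)

theorem forall₃_smoothFieldNear_iff {P : VF n M → VF n M → VF n M → Prop}
    {Q : FieldGerm (𝓡 n).tangent x → FieldGerm (𝓡 n).tangent x → FieldGerm (𝓡 n).tangent x → Prop}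
    (h : ∀ {X Y Z D₁ D₂ D₃}, HasFieldGerm X D₁ → HasFieldGerm Y D₂ → HasFieldGerm Z D₃ →
      (P X Y Z ↔ Q D₁ D₂ D₃)) :
    (∀ X Y Z, SmoothFieldNear X x → SmoothFieldNear Y x → SmoothFieldNear Z x → P X Y Z) ↔
      ∀ D₁ D₂ D₃, Q D₁ D₂ D₃ :=
  (forall_congr' fun _ => ⟨fun h hX Y Z => h Y Z hX, fun h Y Z hX => h hX Y Z⟩).trans <|
    forall_smoothFieldNear_iff fun hX => forall₂_smoothFieldNear_iff (h hX)

theorem jetVanishes_iff {k : ℕ} (hF : HasGerm F a) :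
    JetVanishes k F x ↔ ZeroJet (FieldGerm (𝓡 n).tangent x) (evGerm (𝓡 n).tangent x) k a :=
  hF.forall_le_iteratedFDeriv_eq_zero_iff

theorem hasFieldGerm_fnSelf {K : VF n M → VF n M}
    {K' : FieldGerm (𝓡 n).tangent x →ₗ[FnGerm (𝓡 n).tangent x] FieldGerm (𝓡 n).tangent x}
    (hK : ∀ {X D}, HasFieldGerm X D → HasFieldGerm (K X) (K' D)) (hX : HasFieldGerm X D₁)
    (hY : HasFieldGerm Y D₂) : HasFieldGerm (fnSelf K X Y) (fnBracket K' K' D₁ D₂) := by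
  have fnBracket_self : fnBracket K' K' D₁ D₂ =
      (2 : ℝ) • (⁅K' D₁, K' D₂⁆ + K' (K' ⁅D₁, D₂⁆) - K' ⁅K' D₁, D₂⁆ - K' ⁅D₁, K' D₂⁆) := by
    rw [fnBracket_apply]
    module
  rw [fnBracket_self]
  exact ((((hK hX).lie (hK hY)).add (hK (hK (hX.lie hY)))).sub (hK ((hK hX).lie hY))).sub
    (hK (hX.lie (hK hY))) |>.real_smul 2

variable {T : SprayAlgebra (Fin n) (FnGerm (𝓡 n).tangent x) (FieldGerm (𝓡 n).tangent x)}

namespace HasSprayGerm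

theorem conn (h : HasSprayGerm S T) (hX : HasFieldGerm X D) :
    HasFieldGerm (conn S X) (T.conn D) :=
  ((h.J hX).lie h.spray).sub (h.J (hX.lie h.spray))

theorem hor (h : HasSprayGerm S T) (hX : HasFieldGerm X D) : HasFieldGerm (hor S X) (T.hor D) :=
  (hX.add (h.conn hX)).real_smul _

theorem curv (h : HasSprayGerm S T) (hX : HasFieldGerm X D₁) (hY : HasFieldGerm Y D₂) :
    HasFieldGerm (curv S X Y) (T.curv D₁ D₂) :=
  (hasFieldGerm_fnSelf h.hor hX hY).real_smul _

theorem jacobi (h : HasSprayGerm S T) (hX : HasFieldGerm X D) :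
    HasFieldGerm (jacobi S X) (T.jacobi D) :=
  h.curv h.spray hX

theorem Om (h : HasSprayGerm S T) (hF : HasGerm F a) (hX : HasFieldGerm X D₁)
    (hY : HasFieldGerm Y D₂) : HasGerm (Om F X Y) (T.Om a D₁ D₂) :=
  ((hX.act ((h.J hY).act hF)).sub (hY.act ((h.J hX).act hF))).sub ((h.J (hX.lie hY)).act hF)

theorem ins1 (h : HasSprayGerm S T) {K : VF n M → VF n M}
    {K' : FieldGerm (𝓡 n).tangent x →ₗ[FnGerm (𝓡 n).tangent x] FieldGerm (𝓡 n).tangent x}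
    (hK : ∀ {X D}, HasFieldGerm X D → HasFieldGerm (K X) (K' D)) (hF : HasGerm F a)
    (hX : HasFieldGerm X D₁) (hY : HasFieldGerm Y D₂) :
    HasGerm (ins1 F K X Y) (insertOne (T.Om a) K' D₁ D₂) := by
  rw [insertOne_apply]
  exact (h.Om hF (hK hX) hY).add (h.Om hF hX (hK hY))

theorem ins2 (h : HasSprayGerm S T) {R : VF n M → VF n M → VF n M}
    {R' : FieldGerm (𝓡 n).tangent x →ₗ[FnGerm (𝓡 n).tangent x]
      FieldGerm (𝓡 n).tangent x →ₗ[FnGerm (𝓡 n).tangent x] FieldGerm (𝓡 n).tangent x}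
    (hR : ∀ {X Y D₁ D₂}, HasFieldGerm X D₁ → HasFieldGerm Y D₂ → HasFieldGerm (R X Y) (R' D₁ D₂))
    (hF : HasGerm F a) (hX : HasFieldGerm X D₁) (hY : HasFieldGerm Y D₂)
    (hZ : HasFieldGerm Z D₃) : HasGerm (ins2 F R X Y Z) (insertTwo (T.Om a) R' D₁ D₂ D₃) :=
  ((h.Om hF (hR hX hY) hZ).add (h.Om hF (hR hY hZ) hX)).add (h.Om hF (hR hZ hX) hY)

theorem cyc (h : HasSprayGerm S T) (hF : HasGerm F a) (hX : HasFieldGerm X D₁)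
    (hY : HasFieldGerm Y D₂) (hZ : HasFieldGerm Z D₃) :
    HasGerm (cyc F X Y Z) (lieCyclic (T.Om a) D₁ D₂ D₃) :=
  ((h.Om hF (hX.lie hY) hZ).add (h.Om hF (hY.lie hZ) hX)).add (h.Om hF (hZ.lie hX) hY)

theorem isFormalSolution_iff (h : HasSprayGerm S T) (hF : HasGerm F a) (l : ℕ) :
    IsFormalSolution S l F x ↔ T.IsSolution (evGerm (𝓡 n).tangent x) l a := by
  have homogeneity := jetVanishes_iff (k := l + 1) ((h.liouville.act hF).sub hF)
  have connection := forall₂_smoothFieldNear_iff fun hX hY =>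
    jetVanishes_iff (k := l) (h.ins1 h.conn hF hX hY)
  have curvature := forall₂_smoothFieldNear_iff fun hX hY =>
    jetVanishes_iff (k := l) (h.ins1 h.jacobi hF hX hY)
  exact ⟨fun hsol => ⟨homogeneity.1 hsol.1, connection.1 hsol.2, curvature.1 hsol.3⟩,
    fun hsol => ⟨homogeneity.2 hsol.1, connection.2 hsol.2, curvature.2 hsol.3⟩⟩

theorem prolongedFirstCondition_iff (h : HasSprayGerm S T) (hF : HasGerm F a)
    {e : Fin n → VF n M} {E : Fin n → FieldGerm (𝓡 n).tangent x}
    (he : ∀ i, HasFieldGerm (e i) (E i)) :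
    ProlongedFirstCondition S e F x ↔ T.FirstCondition (evGerm (𝓡 n).tangent x) E a := by
  have curv_cond := forall₃_smoothFieldNear_iff fun hX hY hZ =>
    jetVanishes_iff (k := 1) (h.ins2 h.curv hF hX hY hZ)
  have jacobi_cond := forall₃_smoothFieldNear_iff fun hX hY hZ =>
    jetVanishes_iff (k := 1) (h.ins2 (hasFieldGerm_fnSelf h.jacobi) hF hX hY hZ)
  have frame_cond (i j k : Fin n) :=
    jetVanishes_iff (k := 1) (h.cyc hF (h.J (he i)) (he j) (he k))
  exact ⟨fun hc => ⟨curv_cond.1 hc.1, jacobi_cond.1 hc.2,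
      fun i j k hij hjk hik => (frame_cond i j k).1 (hc.3 i j k hij hjk hik)⟩,
    fun hc => ⟨curv_cond.2 hc.1, jacobi_cond.2 hc.2,
      fun i j k hij hjk hik => (frame_cond i j k).2 (hc.3 i j k hij hjk hik)⟩⟩

theorem thirdOrderIdentity_iff (h : HasSprayGerm S T) (hF : HasGerm F a) (hX : HasFieldGerm X D₁)
    (hY : HasFieldGerm Y D₂) : ThirdOrderIdentity S F X Y x ↔
      T.ThirdOrderCondition (evGerm (𝓡 n).tangent x) a D₁ D₂ := by
  have hJX := h.J hX
  have hJY := h.J hY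
  have hHX := h.hor hX
  have hHY := h.hor hY
  have hPX := h.jacobi hX
  have hPY := h.jacobi hY
  have lhs₁ := ((hHX.lie hPX).act (h.Om hF hJY hY)).evGerm_eq
  have lhs₂ := ((hHY.lie hPY).act (h.Om hF hX hJX)).evGerm_eq
  have rhs₁ := (hPX.act (h.cyc hF hJY hHX hHY)).evGerm_eq
  have rhs₂ := (hHX.act ((h.cyc hF hJY hPX hHY).sub (h.cyc hF hJY hPY hX))).evGerm_eq
  have rhs₃ := (hPY.act (h.cyc hF hJX hHX hHY)).evGerm_eq
  have rhs₄ := (hHY.act ((h.cyc hF hJX hPX hY).sub (h.cyc hF hJX hPY hX))).evGerm_eq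
  exact (Iff.of_eq (congrArg₂ (· = ·) (congrArg₂ (· - ·) lhs₁ lhs₂) (congrArg₂ (· + ·)
    (congrArg₂ (· - ·) (congrArg₂ (· - ·) rhs₁ rhs₂) rhs₃) rhs₄))).symm

theorem isEigenvector (h : HasSprayGerm S T) (hX : HasFieldGerm X D) (hlam : HasGerm lam a)
    (he : IsEigenfield S x lam X) : T.IsEigenvector a D where
  hor_eq := (h.hor hX).eq_of_eventuallyEq hX he.horizontal
  jacobi_eq := (h.jacobi hX).eq_of_eventuallyEq (.smul hlam (h.J hX)) he.eigen

theorem exists_eigenFrame (h : HasSprayGerm S T) {lam : Fin n → TM n M → ℝ} {e : Fin n → VF n M}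
    (he : IsAdaptedFrame S x lam e) {E : Fin n → FieldGerm (𝓡 n).tangent x}
    (hE : ∀ i, HasFieldGerm (e i) (E i)) :
    ∃ L o, T.EigenFrame (evGerm (𝓡 n).tangent x) L E o := by
  choose L hL using fun i => exists_germ (smoothNear_iff.1 (he.eigenfield i).smooth_eigenfunction)
  obtain ⟨o, ho⟩ := he.spray
  refine ⟨L, o, fun i => h.isEigenvector (hE i) (hL i) (he.eigenfield i), fun i j hij => ?_,
    fun i => (hE i).exists_evGerm_lie_ne_zero (he.ne_zero i),
    (hE o).eq_of_eventuallyEq h.spray ho⟩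
  rw [(hL i).evGerm_eq, (hL j).evGerm_eq]
  exact he.distinct i j hij

theorem thirdOrderIdentity (h : HasSprayGerm S T) (hF : HasGerm F a) {lX lY : TM n M → ℝ}
    (hsol : T.IsSolution (evGerm (𝓡 n).tangent x) 2 b)
    (hjet : ZeroJet (FieldGerm (𝓡 n).tangent x) (evGerm (𝓡 n).tangent x) 3 (b - a))
    (hX : IsEigenfield S x lX X) (hY : IsEigenfield S x lY Y) (hne : lX x ≠ lY x) :
    ThirdOrderIdentity S F X Y x := by
  obtain ⟨D₁, hD₁⟩ := exists_fieldGerm (smoothFieldNear_iff.1 hX.smooth)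
  obtain ⟨D₂, hD₂⟩ := exists_fieldGerm (smoothFieldNear_iff.1 hY.smooth)
  obtain ⟨c₁, hc₁⟩ := exists_germ (smoothNear_iff.1 hX.smooth_eigenfunction)
  obtain ⟨c₂, hc₂⟩ := exists_germ (smoothNear_iff.1 hY.smooth_eigenfunction)
  rw [h.thirdOrderIdentity_iff hF hD₁ hD₂]
  refine .congr hjet (hsol.thirdOrderCondition (h.isEigenvector hD₁ hc₁ hX)
    (h.isEigenvector hD₂ hc₂ hY) ?_)
  rwa [hc₁.evGerm_eq, hc₂.evGerm_eq]

end HasSprayGerm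

end Transfer

end Rapcsak

end

open Rapcsak in
theorem mainTheorem5 {n : ℕ} {M : Type*} [TopologicalSpace M]
    [ChartedSpace (EuclideanSpace ℝ (Fin n)) M] [IsManifold (𝓡 n) ∞ M]
    (S : Rapcsak.VF n M) (hS : Rapcsak.IsSpray S)
    (x : Rapcsak.TM n M) (hx : x ∈ Rapcsak.slashed n M)
    (lam : Fin n → Rapcsak.TM n M → ℝ) (e : Fin n → Rapcsak.VF n M)
    (he : Rapcsak.IsAdaptedFrame S x lam e)
    (F : Rapcsak.TM n M → ℝ) (hF : Rapcsak.SmoothNear F x)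
    (hsol : Rapcsak.IsFormalSolution S 1 F x) :
    (∃ G : Rapcsak.TM n M → ℝ, Rapcsak.SmoothNear G x ∧ Rapcsak.SameJet 3 G F x ∧
        Rapcsak.IsFormalSolution S 2 G x) ↔
      Rapcsak.ProlongedFirstCondition S e F x ∧
        ∀ (X Y : Rapcsak.VF n M) (lX lY : Rapcsak.TM n M → ℝ),
          Rapcsak.IsEigenfield S x lX X → Rapcsak.IsEigenfield S x lY Y → lX x ≠ lY x →
            Rapcsak.ThirdOrderIdentity S F X Y x := by
  obtain ⟨T, h⟩ := hS.exists_hasSprayGerm hx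
  obtain ⟨a, ha⟩ := exists_germ (smoothNear_iff.1 hF)
  choose E hE using fun i => exists_fieldGerm (smoothFieldNear_iff.1 (he.eigenfield i).smooth)
  obtain ⟨_, o, frame⟩ := h.exists_eigenFrame he hE
  rw [h.prolongedFirstCondition_iff ha hE]
  constructor
  · rintro ⟨G, hG, hjet, hGsol⟩
    obtain ⟨g, hg⟩ := exists_germ (smoothNear_iff.1 hG)
    rw [SameJet, jetVanishes_iff (hg.sub ha)] at hjet
    rw [h.isFormalSolution_iff hg] at hGsol
    exact ⟨.congr hjet (hGsol.firstCondition frame.eigenvector frame.distinct),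
      fun X Y lX lY => h.thirdOrderIdentity ha hGsol hjet⟩
  · rintro ⟨first, third⟩
    have third_germ (i j : Fin n) (hij : i ≠ j) :=
      (h.thirdOrderIdentity_iff ha (hE i) (hE j)).1
        (third _ _ _ _ (he.eigenfield i) (he.eigenfield j) (he.distinct i j hij))
    obtain ⟨g, hjet, hgsol⟩ :=
      frame.exists_lift ((h.isFormalSolution_iff ha 1).1 hsol) first third_germ
    obtain ⟨G, hG⟩ := exists_hasGerm g
    exact ⟨G, smoothNear_iff.2 hG.smooth, (jetVanishes_iff (hG.sub ha)).2 hjet,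
      (h.isFormalSolution_iff hG 2).2 hgsol⟩
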